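/- **Setting.** A *target space* is a connected smooth manifold $M$ with a family $(Q_i)_{i\in I}$ of (embedded) submanifolds. A *path* in a diffeological space is a smooth map $[0,1]\to X$ with sitting instants (constant near $0$ and near $1$). $PM$ is the diffeological space of paths in $M$, $LM=C^\infty(S^1,M)$ the loop space, and $P_{ij}\subset PM$ the subspace of paths $\gamma$ with $\gamma(0)\in Q_i$, $\gamma(1)\in Q_j$; $\mathrm{ev}_0:P_{ij}\to Q_i$ and $\mathrm{ev}_1:P_{ij}\to Q_j$ are the end point evaluations. $\gamma_2\star\gamma_1$ is concatenation (first $\gamma_1$), $\bar\gamma$ the reversed path, $\mathrm{cp}_x$ the constant path, and $\gamma_1\cup\gamma_2\in LM$ the loop $\bar\gamma_2\star\gamma_1$ for paths with common end points. For a path $\Gamma$ in $PM$ (or $LM$), $\Gamma^\vee(s,t)=\Gamma(s)(t)$ is its adjoint; a map has rank $k$ if its differential has rank $\le k$ everywhere; $\Gamma$ is thin if $\Gamma^\vee$ has rank $1$. Vector bundles over diffeological spaces are complex, of a fixed finite rank, locally trivial along plots; a connection is a parallel transport along paths that depends only on the thin homotopy class of the path, is compatible with concatenation, and is smooth in local trivializations.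 Hermitian metrics are antilinear in the first variable. A connection $pt$ on a vector bundle over $P_{ij}$ is *superficial* if (i) $pt_{\Gamma_1}=pt_{\Gamma_2}$ for thin fixed-ends paths $\Gamma_1,\Gamma_2$ in $P_{ij}$ with the same initial and the same final point; (ii) $pt_{h_1}\circ pt_{h(0)}=pt_{h(1)}\circ pt_{h_0}$ for every path $h$ of paths in $P_{ij}$ such that $h(r)(s)(0)$ and $h(r)(s)(1)$ do not depend on $r$ and $(r,s,t)\mapsto h(r)(s)(t)$ has rank $2$, where $h_0(r)=h(r)(0)$ and $h_1(r)=h(r)(1)$. Such a connection determines canonical isomorphisms $d_{\gamma,\gamma'}$, namely parallel transport along any thin fixed-ends path from $\gamma$ to $\gamma'$. A connection on a line bundle over $LM$ is *superficial* if parallel transport along thin paths in $LM$ depends only on their end points, and closed paths in $LM$ that are homotopic through closed paths by a homotopy whose adjoint has rank $2$ have the same holonomy; again this gives canonical isomorphisms $d_{\tau,\tau'}$ between the fibres over loops connected by a thin path. A *loop space brane geometry* (LBG object) $(\mathcal L,\lambda,\mathcal R,\phi,\chi,\epsilon,\alpha)$ consists of: 1. a hermitian line bundle $\mathcal L$ over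 $LM$ with superficial unitary connection; 2. a fusion product $\lambda$: unitary isomorphisms $\lambda_{\gamma_1,\gamma_2,\gamma_3}:\mathcal L|_{\gamma_1\cup\gamma_2}\otimes\mathcal L|_{\gamma_2\cup\gamma_3}\to\mathcal L|_{\gamma_1\cup\gamma_3}$ for paths with common end points, smooth and connection-preserving, associative, and symmetrizing: $d(\lambda(p\otimes q))=\lambda(d(q)\otimes d(p))$ for $d:\mathcal L|_{\gamma\cup\gamma'}\to\mathcal L|_{\bar\gamma'\cup\bar\gamma}$. It induces neutral elements $\nu_\gamma\in\mathcal L|_{\gamma\cup\gamma}$ and antilinear maps $\tilde\lambda:\mathcal L|_{\gamma_1\cup\gamma_2}\to\mathcal L|_{\gamma_2\cup\gamma_1}$, $\lambda(p\otimes q)=h(\tilde\lambda(p),q)\,\nu_{\gamma_1}$; 3. hermitian vector bundles $\mathcal R_{ij}$ over $P_{ij}$ with metrics $h_{ij}$ and superficial unitary connections; 4. unitary isomorphisms $\phi_{ij}:\mathcal L|_{\gamma_1\cup\gamma_2}\otimes\mathcal R_{ij}|_{\gamma_2}\to\mathcal R_{ij}|_{\gamma_1}$ for $\gamma_1,\gamma_2\in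 P_{ij}$ with common end points, smooth and connection-preserving; 5. a lifted path concatenation: linear maps $\chi_{ijk}|_{\gamma_{12},\gamma_{23}}:\mathcal R_{jk}|_{\gamma_{23}}\otimes\mathcal R_{ij}|_{\gamma_{12}}\to\mathcal R_{ik}|_{\gamma_{23}\star\gamma_{12}}$ for composable paths, forming a smooth connection-preserving bundle morphism over $P_{jk}\times_{Q_j}P_{ij}$; 6. smooth parallel sections $\epsilon_i$, $\epsilon_i(x)\in\mathcal R_{ii}|_{\mathrm{cp}_x}$ for $x\in Q_i$; 7. antiunitary isomorphisms $\alpha_{ij}:\mathcal R_{ij}|_\gamma\to\mathcal R_{ji}|_{\bar\gamma}$, smooth and connection-preserving; such that, for all paths for which the terms are defined, with $x,y$ the initial and the end point of $\gamma\in P_{ij}$: - $\phi_{ij}(p\otimes\phi_{ij}(q\otimes v))=\phi_{ij}(\lambda(p\otimes q)\otimes v)$; - $d(\chi_{ijl}(\chi_{jkl}(u\otimes v)\otimes w))=\chi_{ikl}(u\otimes\chi_{ijk}(v\otimes w))$; - $\phi_{ik}(\lambda'(p\otimes q)\otimes\chi_{ijk}(v\otimes w))=\chi_{ijk}(\phi_{jk}(p\otimes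 v)\otimes\phi_{ij}(q\otimes w))$ for $p\in\mathcal L|_{\gamma_{23}\cup\gamma_{23}'}$, $q\in\mathcal L|_{\gamma_{12}\cup\gamma_{12}'}$, where, with $z$ the common end point of $\gamma_{12},\gamma_{12}'$, $\lambda'$ is $d\otimes d$ into $\mathcal L|_{(\overline{\gamma_{23}'}\star\gamma_{23})\cup\mathrm{cp}_z}\otimes\mathcal L|_{\mathrm{cp}_z\cup(\gamma_{12}'\star\overline{\gamma_{12}})}$ followed by $\lambda$ and by $d$ into $\mathcal L|_{(\gamma_{23}\star\gamma_{12})\cup(\gamma_{23}'\star\gamma_{12}')}$; - $\chi_{iij}(v\otimes\epsilon_i(x))=d_{\gamma,\gamma\star\mathrm{cp}_x}(v)$ and $\chi_{ijj}(\epsilon_j(y)\otimes v)=d_{\gamma,\mathrm{cp}_y\star\gamma}(v)$; - $h_{ii}(\chi_{iji}(\alpha_{ij}(w)\otimes v),d_{\mathrm{cp}_x,\bar\gamma\star\gamma}(\epsilon_i(x)))=h_{ij}(v,w)=h_{jj}(d_{\mathrm{cp}_y,\gamma\star\bar\gamma}(\epsilon_j(y)),\chi_{jij}(w\otimes\alpha_{ij}(v)))$;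 - $\alpha_{ii}(\epsilon_i(x))=\epsilon_i(x)$, $\alpha_{ji}\circ\alpha_{ij}=\mathrm{id}$, $\alpha_{ik}(\chi_{ijk}(v\otimes w))=\chi_{kji}(\alpha_{ij}(w)\otimes\alpha_{jk}(v))$; - $\alpha_{ij}(\phi_{ij}(p\otimes v))=\phi_{ji}(d(\tilde\lambda(p))\otimes\alpha_{ij}(v))$ for $p\in\mathcal L|_{\gamma_1\cup\gamma_2}$, with $d:\mathcal L|_{\gamma_2\cup\gamma_1}\to\mathcal L|_{\bar\gamma_1\cup\bar\gamma_2}$; - $\sum_{k}\chi_{jij}(\chi_{iij}(v_k\otimes v)\otimes\alpha_{ij}(v_k))=h_{ii}(\epsilon_i(x),v)\,d(\epsilon_j(y))$, with $d:\mathcal R_{jj}|_{\mathrm{cp}_y}\to\mathcal R_{jj}|_{(\gamma\star\mathrm{cp}_x)\star\bar\gamma}$, for every orthonormal basis $(v_k)$ of $\mathcal R_{ij}|_\gamma$ and every $v\in\mathcal R_{ii}|_{\mathrm{cp}_x}$. Let $\mathcal A_i:=\mathrm{cp}^*\mathcal R_{ii}$ over $Q_i$, with multiplication $\chi_{iii}|_{\mathrm{cp}_x,\mathrm{cp}_x}$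 and unit $\epsilon_i(x)$. Let $\mathcal A_j|_y\otimes\mathcal R_{ij}|_\gamma\to\mathcal R_{ij}|_\gamma$ and $\mathcal R_{ij}|_\gamma\otimes\mathcal A_i|_x\to\mathcal R_{ij}|_\gamma$ be $d_{\mathrm{cp}_y\star\gamma,\gamma}\circ\chi_{ijj}|_{\gamma,\mathrm{cp}_y}$ and $d_{\gamma\star\mathrm{cp}_x,\gamma}\circ\chi_{iij}|_{\mathrm{cp}_x,\gamma}$. A bundle of bimodules means: the two algebra bundles and the bimodule bundle are simultaneously locally trivial, with one typical bimodule over one pair of typical (unital, associative, complex) algebras. **Theorem.** Consider a loop space brane geometry in which every $\mathcal R_{ii}$ has positive rank. (a) For all $i,j$, $\mathcal R_{ij}$ with these multiplications is a bundle of $\mathrm{ev}_1^*\mathcal A_j$-$\mathrm{ev}_0^*\mathcal A_i$-bimodules over $P_{ij}$ (in particular, these are algebra bundles), and the two actions are connection-preserving. (b) For all $i,j,k$, with $p_{ij},p_{jk}$ the projections, $c$ the concatenation and $p_i,p_j,p_k$ the projections to initial points, common points and end points of the pairs in $P_{jk}\times_{Q_j}P_{ij}$, the tensor product $p_{jk}^*\mathcal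 R_{jk}\otimes_{p_j^*\mathcal A_j}p_{ij}^*\mathcal R_{ij}$ is, with the induced actions, a bundle of $p_k^*\mathcal A_k$-$p_i^*\mathcal A_i$-bimodules and carries an induced connection, and $\chi_{ijk}$ induces a connection-preserving isomorphism of bundles of $p_k^*\mathcal A_k$-$p_i^*\mathcal A_i$-bimodules $$p_{jk}^*\mathcal R_{jk}\otimes_{p_j^*\mathcal A_j}p_{ij}^*\mathcal R_{ij}\;\cong\;c^*\mathcal R_{ik}.$$ (c) $\mathcal R_{ij}$ and $\mathcal R_{ji}$ are inverse to each other: there are bimodule isomorphisms $$\mathcal R_{ji}|_{\bar\gamma}\otimes_{\mathcal A_j|_y}\mathcal R_{ij}|_\gamma\cong\mathcal A_i|_x,\qquad \mathcal R_{ij}|_\gamma\otimes_{\mathcal A_i|_x}\mathcal R_{ji}|_{\bar\gamma}\cong\mathcal A_j|_y$$ for all $\gamma\in P_{ij}$ from $x$ to $y$, forming bundle isomorphisms over $P_{ij}$. So $\mathcal R_{ij}|_\gamma$ and $\mathcal R_{ji}|_{\bar\gamma}$ are mutually inverse Morita equivalences. -/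

import Mathlib

open scoped Manifold ContDiff Topology ComplexConjugate
open Diffeology

noncomputable section

namespace BraneGeometry

universe u v w

/-! ## Diffeological preliminaries -/

/-- The Euclidean space `ℝⁿ`, the domain of plots. -/
abbrev Eu (n : ℕ) := EuclideanSpace ℝ (Fin n)

/-- The coarsest diffeology making `f` smooth (pullback diffeology). -/
@[reducible]
def inducedDiff {A : Type u} {X : Type v} [DiffeologicalSpace X] (f : A → X) :
    DiffeologicalSpace A where
  plots n := {p | IsPlot (f ∘ p)}
  constant_plots x := isPlot_const (x := f x)
  plot_reparam hp hf := isPlot_reparam (X := X) hp hf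
  locality h := DiffeologicalSpace.locality (X := X) fun x => by
    obtain ⟨W, hW, hx, H⟩ := h x
    exact ⟨W, hW, hx, fun hf hs => H hf hs⟩

instance instSubtypeDiff {X : Type u} [DiffeologicalSpace X] (p : X → Prop) :
    DiffeologicalSpace {x // p x} := inducedDiff Subtype.val

instance instProdDiff {X : Type u} {Y : Type v} [DiffeologicalSpace X] [DiffeologicalSpace Y] :
    DiffeologicalSpace (X × Y) := inducedDiff Prod.fst ⊓ inducedDiff Prod.snd

theorem isPlot_subtype_iff {X : Type u} [DiffeologicalSpace X] {P : X → Prop} {n : ℕ}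
    {p : Eu n → {x // P x}} : IsPlot p ↔ IsPlot (fun a => (p a).1) := Iff.rfl

theorem isPlot_prod_iff {X : Type u} {Y : Type v} [DiffeologicalSpace X] [DiffeologicalSpace Y]
    {n : ℕ} {p : Eu n → X × Y} :
    IsPlot p ↔ IsPlot (fun a => (p a).1) ∧ IsPlot (fun a => (p a).2) :=
  DiffeologicalSpace.isPlot_inf_iff

theorem dSmooth_val {X : Type u} [DiffeologicalSpace X] {P : X → Prop} :
    DSmooth (Subtype.val : {x // P x} → X) := fun _ _ h => h

/-- Locality, with neighbourhoods given by a property. -/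
theorem isPlot_of_local {X : Type u} [DiffeologicalSpace X] {n : ℕ} {p : Eu n → X}
    (h : ∀ a, ∃ W : Set (Eu n), IsOpen W ∧ a ∈ W ∧ ∃ q : Eu n → X, IsPlot q ∧ Set.EqOn p q W) :
    IsPlot p :=
  DiffeologicalSpace.locality (X := X) fun a => by
    obtain ⟨W, hW, ha, q, hq, e⟩ := h a
    refine ⟨W, hW, ha, fun {m f} hf hs => ?_⟩
    have : p ∘ f = q ∘ f := funext fun b => e (hf b)
    rw [this]
    exact isPlot_reparam hq hs

/-- The functional diffeology on a set `A` of smooth maps `ℝ → X`: the plots are the families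
`p` for which `(a, t) ↦ p a t` is smooth. -/
@[reducible]
def functionalDiff {A : Type u} {X : Type v} [DiffeologicalSpace X] (F : A → ℝ → X)
    (hF : ∀ a, DSmooth (F a)) : DiffeologicalSpace A where
  plots n := {p | ∀ (m : ℕ) (g : Eu m → Eu n) (τ : Eu m → ℝ), ContDiff ℝ ∞ g → ContDiff ℝ ∞ τ →
    IsPlot fun b => F (p (g b)) (τ b)}
  constant_plots a := fun m _ τ _ hτ => hF a m τ hτ.isPlot
  plot_reparam hp hf := fun m _ τ hg hτ => hp m _ τ (hf.comp hg) hτ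
  locality {n p} h := fun m g τ hg hτ => DiffeologicalSpace.locality (X := X) fun b => by
    obtain ⟨W, hW, hx, H⟩ := h (g b)
    refine ⟨g ⁻¹' W, hW.preimage hg.continuous, hx, fun {k f} hf hs => ?_⟩
    exact H (f := g ∘ f) hf (hg.comp hs) k id (τ ∘ f) contDiff_id (hτ.comp hs)

/-! ## Paths with sitting instants and loops -/

/-- A path in `X`: a smooth map `[0,1] → X` with sitting instants. It is recorded through its
extension to `ℝ` by constants, which is smooth because of the sitting instants. -/
@[ext]
structure DPath (X : Type u) [DiffeologicalSpace X] where
  toFun : ℝ → X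
  smooth : DSmooth toFun
  sit : ∃ ε > 0, (∀ t ≤ ε, toFun t = toFun 0) ∧ (∀ t ≥ 1 - ε, toFun t = toFun 1)

/-- A smooth loop `S¹ = ℝ / ℤ → X`, recorded as a `1`-periodic smooth map `ℝ → X`. -/
@[ext]
structure DLoop (X : Type u) [DiffeologicalSpace X] where
  toFun : ℝ → X
  smooth : DSmooth toFun
  periodic : ∀ t, toFun (t + 1) = toFun t

section Paths

variable {X : Type u} [DiffeologicalSpace X] {Y : Type v} [DiffeologicalSpace Y]

instance : CoeFun (DPath X) (fun _ => ℝ → X) := ⟨DPath.toFun⟩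
instance : CoeFun (DLoop X) (fun _ => ℝ → X) := ⟨DLoop.toFun⟩

instance : DiffeologicalSpace (DPath X) := functionalDiff DPath.toFun DPath.smooth
instance : DiffeologicalSpace (DLoop X) := functionalDiff DLoop.toFun DLoop.smooth

theorem DPath.dSmooth_eval (t : ℝ) : DSmooth (fun γ : DPath X => γ t) :=
  fun n _ hp => hp n id (fun _ => t) contDiff_id contDiff_const

/-- The image of a path under a smooth map. -/
def DPath.map (γ : DPath X) (f : X → Y) (hf : DSmooth f) : DPath Y where
  toFun t := f (γ t)
  smooth := hf.comp γ.smooth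
  sit := by
    obtain ⟨ε, h, h0, h1⟩ := γ.sit
    exact ⟨ε, h, fun t ht => congrArg f (h0 t ht), fun t ht => congrArg f (h1 t ht)⟩

/-- The constant path. -/
def DPath.const (x : X) : DPath X where
  toFun _ := x
  smooth := dSmooth_const
  sit := ⟨1, one_pos, fun _ _ => rfl, fun _ _ => rfl⟩

/-- The reversed path. -/
def DPath.rev (γ : DPath X) : DPath X where
  toFun t := γ (1 - t)
  smooth := fun _ p hp => γ.smooth _ _ (contDiff_const.sub hp.contDiff : ContDiff ℝ ∞ _).isPlot
  sit := by
    obtain ⟨ε, h, h0, h1⟩ := γ.sit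
    refine ⟨ε, h, fun t ht => ?_, fun t ht => ?_⟩
    · rw [h1 (1 - t) (by linarith), sub_zero]
    · rw [h0 (1 - t) (by linarith), sub_self]

/-- The concatenation `γ₂ ⋆ γ₁`: first `γ₁`, then `γ₂`. -/
def DPath.comp (γ₂ γ₁ : DPath X) (h : γ₁ 1 = γ₂ 0) : DPath X where
  toFun t := if t ≤ 1 / 2 then γ₁ (2 * t) else γ₂ (2 * t - 1)
  smooth := by
    intro n p hp
    have hpc : ContDiff ℝ ∞ p := hp.contDiff
    have hF : IsPlot fun a => γ₁ (2 * p a) :=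
      γ₁.smooth _ _ (contDiff_const.mul hpc : ContDiff ℝ ∞ fun a => 2 * p a).isPlot
    have hG : IsPlot fun a => γ₂ (2 * p a - 1) := γ₂.smooth _ _
      ((contDiff_const.mul hpc).sub contDiff_const : ContDiff ℝ ∞ fun a => 2 * p a - 1).isPlot
    obtain ⟨ε, hε, -, h1⟩ := γ₁.sit
    obtain ⟨δ, hδ, h0, -⟩ := γ₂.sit
    refine isPlot_of_local fun a => ?_
    rcases lt_trichotomy (p a) (1 / 2) with ha | ha | ha
    · refine ⟨p ⁻¹' Set.Iio (1 / 2), isOpen_Iio.preimage hpc.continuous, ha, _, hF, fun b hb => ?_⟩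
      exact if_pos (le_of_lt hb)
    · refine ⟨p ⁻¹' Set.Ioo (1 / 2 - ε / 2) (1 / 2 + δ / 2), isOpen_Ioo.preimage hpc.continuous,
        ⟨by linarith, by linarith⟩, _, isPlot_const (x := γ₁ 1), fun b hb => ?_⟩
      have hb1 : 1 / 2 - ε / 2 < p b := hb.1
      have hb2 : p b < 1 / 2 + δ / 2 := hb.2
      simp only [Function.comp_apply]
      split_ifs
      · exact h1 _ (by linarith)
      · rw [h0 _ (by linarith), h]
    · refine ⟨p ⁻¹' Set.Ioi (1 / 2), isOpen_Ioi.preimage hpc.continuous, ha, _, hG, fun b hb => ?_⟩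
      exact if_neg (not_le_of_gt hb)
  sit := by
    obtain ⟨ε, hε, h0, h1⟩ := γ₁.sit
    obtain ⟨δ, hδ, k0, k1⟩ := γ₂.sit
    refine ⟨min (1 / 4) (min (ε / 2) (δ / 2)), by positivity, fun t ht => ?_, fun t ht => ?_⟩
    · have h4 : t ≤ 1 / 4 := ht.trans (min_le_left _ _)
      have h5 : t ≤ ε / 2 := ht.trans ((min_le_right _ _).trans (min_le_left _ _))
      rw [if_pos (by linarith), if_pos (by norm_num), h0 _ (by linarith), mul_zero]
    · have h4 : min (1 / 4) (min (ε / 2) (δ / 2)) ≤ 1 / 4 := min_le_left _ _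
      have h5 : min (1 / 4) (min (ε / 2) (δ / 2)) ≤ δ / 2 :=
        (min_le_right _ _).trans (min_le_right _ _)
      have h6 : t ≥ 1 - min (1 / 4) (min (ε / 2) (δ / 2)) := ht
      rw [if_neg (by linarith), if_neg (by norm_num), k1 _ (by linarith)]
      norm_num

theorem DPath.comp_apply (γ₂ γ₁ : DPath X) (h : γ₁ 1 = γ₂ 0) (t : ℝ) :
    (γ₂.comp γ₁ h) t = if t ≤ 1 / 2 then γ₁ (2 * t) else γ₂ (2 * t - 1) := rfl

theorem DPath.comp_zero (γ₂ γ₁ : DPath X) (h : γ₁ 1 = γ₂ 0) : (γ₂.comp γ₁ h) 0 = γ₁ 0 := by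
  rw [DPath.comp_apply, if_pos (by norm_num), mul_zero]

theorem DPath.comp_one (γ₂ γ₁ : DPath X) (h : γ₁ 1 = γ₂ 0) : (γ₂.comp γ₁ h) 1 = γ₂ 1 := by
  rw [DPath.comp_apply, if_neg (by norm_num)]; norm_num

theorem DPath.rev_apply (γ : DPath X) (t : ℝ) : γ.rev t = γ (1 - t) := rfl
theorem DPath.rev_zero (γ : DPath X) : γ.rev 0 = γ 1 := by rw [DPath.rev_apply, sub_zero]
theorem DPath.rev_one (γ : DPath X) : γ.rev 1 = γ 0 := by rw [DPath.rev_apply, sub_self]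

theorem DPath.rev_rev (γ : DPath X) : γ.rev.rev = γ :=
  DPath.ext (funext fun t => by rw [DPath.rev_apply, DPath.rev_apply, sub_sub_cancel])

theorem DPath.const_comp_const (x : X) :
    (DPath.const x).comp (DPath.const x) rfl = DPath.const x :=
  DPath.ext (funext fun _ => ite_self _)

theorem DPath.rev_comp (γ₂ γ₁ : DPath X) (h : γ₁ 1 = γ₂ 0) :
    (γ₂.comp γ₁ h).rev = γ₁.rev.comp γ₂.rev (by rw [rev_one, rev_zero, h]) := by
  refine DPath.ext (funext fun t => ?_)
  rw [rev_apply, comp_apply, comp_apply, rev_apply, rev_apply]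
  rcases lt_trichotomy t (1 / 2) with ht | ht | ht
  · rw [if_neg (by linarith), if_pos ht.le]; congr 1; ring
  · subst ht; norm_num [h]
  · rw [if_pos (by linarith), if_neg (by linarith)]; congr 1; ring

end Paths

/-- A differential `k`-form on a diffeological space: a form on the domain of every plot,
compatibly with smooth reparametrizations. -/
structure DForm (X : Type u) [DiffeologicalSpace X] (k : ℕ) where
  toFun : ∀ {n : ℕ} (p : Eu n → X), IsPlot p → Eu n → (Eu n) [⋀^Fin k]→L[ℝ] ℝ
  smooth : ∀ {n : ℕ} (p : Eu n → X) (hp : IsPlot p), ContDiff ℝ ∞ (toFun p hp)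
  compat : ∀ {m n : ℕ} (p : Eu n → X) (hp : IsPlot p) (f : Eu m → Eu n) (hf : ContDiff ℝ ∞ f)
    (a : Eu m), toFun (p ∘ f) (isPlot_reparam hp hf) a =
      (toFun p hp (f a)).compContinuousLinearMap (fderiv ℝ f a)

/-- A plot of a diffeological space has rank `≤ k` if it pulls back all `(k+1)`-forms to zero. -/
def PlotRankLE {X : Type u} [DiffeologicalSpace X] (k : ℕ) {n : ℕ} (p : Eu n → X) : Prop :=
  ∃ hp : IsPlot p, ∀ η : DForm X (k + 1), η.toFun p hp = 0

/-- Thin homotopy of paths in a diffeological space. -/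
def ThinHomotopic {X : Type u} [DiffeologicalSpace X] (γ γ' : DPath X) : Prop :=
  ∃ H : DPath (DPath X), H 0 = γ ∧ H 1 = γ' ∧
    (∀ s, H s 0 = γ 0 ∧ H s 0 = γ' 0) ∧ (∀ s, H s 1 = γ 1 ∧ H s 1 = γ' 1) ∧
    PlotRankLE 1 (fun a : Eu 2 => H (a 0) (a 1))

/-! ## Vector bundles over diffeological spaces -/

/-- A family of complex vector spaces over `X` together with a diffeology on its total space. -/
structure VecFam (X : Type u) where
  Fiber : X → Type v
  [acg : ∀ x, AddCommGroup (Fiber x)]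
  [mod : ∀ x, Module ℂ (Fiber x)]
  diff : DiffeologicalSpace (Σ x, Fiber x)

attribute [instance] VecFam.acg VecFam.mod

namespace VecFam

variable {X : Type u} {Y : Type w}

instance : CoeFun (VecFam.{u, v} X) (fun _ => X → Type v) := ⟨VecFam.Fiber⟩

/-- Plots of the total space. -/
def IsPlot (E : VecFam.{u, v} X) {n : ℕ} (p : Eu n → Σ x, E x) : Prop :=
  @Diffeology.IsPlot _ E.diff n p

/-- The identification of the fibres over equal points. -/
def cast (E : VecFam.{u, v} X) {x y : X} (h : x = y) : E x ≃ₗ[ℂ] E y := h ▸ LinearEquiv.refl ℂ (E x)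

/-- The pullback of a family along a map, with fibre `E (f y)` over `y`. -/
abbrev pullback [DiffeologicalSpace Y] (E : VecFam.{u, v} X) (f : Y → X) : VecFam.{w, v} Y where
  Fiber y := E (f y)
  diff :=
    inducedDiff (fun p : Σ y, E (f y) => p.1) ⊓
      @inducedDiff _ _ E.diff (fun p : Σ y, E (f y) => (⟨f p.1, p.2⟩ : Σ x, E x))

variable [DiffeologicalSpace X]

/-- A local trivialization, of rank `k`, along a plot `c : ℝⁿ → X` over a subset `W` of `ℝⁿ`:
a diffeomorphism `W × ℂᵏ → W ×_X E` over `W` which is fibrewise linear. Smoothness of maps from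
`W` is tested on smooth maps `f : ℝᵐ → ℝⁿ` with values in `W`. -/
structure LocTriv (E : VecFam.{u, v} X) (k : ℕ) {n : ℕ} (c : Eu n → X) (W : Set (Eu n)) where
  φ : ∀ a : W, (Fin k → ℂ) ≃ₗ[ℂ] E (c a)
  smooth : ∀ (m : ℕ) (f : Eu m → Eu n) (hf : ∀ b, f b ∈ W), ContDiff ℝ ∞ f →
    ∀ z : Eu m → (Fin k → ℂ), ContDiff ℝ ∞ z →
      E.IsPlot fun b => ⟨c (f b), φ ⟨f b, hf b⟩ (z b)⟩
  smooth_inv : ∀ (m : ℕ) (f : Eu m → Eu n) (hf : ∀ b, f b ∈ W), ContDiff ℝ ∞ f →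
    ∀ e : ∀ b, E (c (f b)), E.IsPlot (fun b => ⟨c (f b), e b⟩) →
      ContDiff ℝ ∞ fun b => (φ ⟨f b, hf b⟩).symm (e b)

/-- `E` is a vector bundle of rank `k`. -/
def IsVectorBundle (E : VecFam.{u, v} X) (k : ℕ) : Prop :=
  @DSmooth _ _ E.diff _ (fun p : Σ x, E x => p.1) ∧
  ∀ (n : ℕ) (c : Eu n → X), Diffeology.IsPlot c → ∀ a : Eu n,
    ∃ W : Set (Eu n), IsOpen W ∧ a ∈ W ∧ Nonempty (LocTriv E k c W)

/-- A fibrewise bilinear map `E ×_X F → G`, i.e. a fibrewise linear map `E ⊗ F → G`,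
is smooth. -/
def SmoothBilin {E F G : VecFam.{u, v} X} (β : ∀ x, E x →ₗ[ℂ] F x →ₗ[ℂ] G x) : Prop :=
  ∀ (n : ℕ) (c : Eu n → X), Diffeology.IsPlot c → ∀ (e : ∀ a, E (c a)) (f : ∀ a, F (c a)),
    E.IsPlot (fun a => ⟨c a, e a⟩) → F.IsPlot (fun a => ⟨c a, f a⟩) →
      G.IsPlot (fun a => ⟨c a, β (c a) (e a) (f a)⟩)

/-! ### Connections -/

/-- A family of parallel transports along paths. -/
def Transport (E : VecFam.{u, v} X) := ∀ γ : DPath X, E (γ 0) ≃ₗ[ℂ] E (γ 1)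

/-- The pullback of a family of parallel transports along a smooth map. -/
def Transport.pullback [DiffeologicalSpace Y] {E : VecFam.{u, v} X} (pt : E.Transport) (f : Y → X)
    (hf : DSmooth f) : (E.pullback f).Transport := fun γ => pt (γ.map f hf)

/-- A connection on `E`: parallel transport depends only on the thin homotopy class of the path,
is compatible with concatenation, and is smooth in every local trivialization, i.e. the induced map
`PW → GL(ℂᵏ)` is smooth. -/
structure IsConnection (E : VecFam.{u, v} X) (pt : E.Transport) : Prop where
  thin : ∀ (γ γ' : DPath X), ThinHomotopic γ γ' → ∀ (h₀ : γ 0 = γ' 0) (h₁ : γ 1 = γ' 1)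
    (z : E (γ 0)), pt γ' (E.cast h₀ z) = E.cast h₁ (pt γ z)
  comp : ∀ (γ₂ γ₁ : DPath X) (h : γ₁ 1 = γ₂ 0) (z : E (γ₁ 0)),
    pt (γ₂.comp γ₁ h) (E.cast (γ₂.comp_zero γ₁ h).symm z) =
      E.cast (γ₂.comp_one γ₁ h).symm (pt γ₂ (E.cast h (pt γ₁ z)))
  smooth : ∀ (k n : ℕ) (c : Eu n → X) (hc : Diffeology.IsPlot c) (W : Set (Eu n)), IsOpen W →
    ∀ (T : LocTriv E k c W) (m : ℕ) (g : Eu m → DPath (Eu n)), Diffeology.IsPlot g →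
      ∀ (hg : ∀ b t, g b t ∈ W) (z : Fin k → ℂ),
        ContDiff ℝ ∞ fun b => (T.φ ⟨g b 1, hg b 1⟩).symm
          (pt ((g b).map c hc.dSmooth) (T.φ ⟨g b 0, hg b 0⟩ z))

/-- A fibrewise bilinear map `E ×_X F → G`, i.e. a fibrewise linear map `E ⊗ F → G`,
is connection-preserving. -/
def ParallelBilin {E F G : VecFam.{u, v} X} (ptE : E.Transport) (ptF : F.Transport)
    (ptG : G.Transport) (β : ∀ x, E x →ₗ[ℂ] F x →ₗ[ℂ] G x) : Prop :=
  ∀ (γ : DPath X) (e : E (γ 0)) (f : F (γ 0)),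
    β (γ 1) (ptE γ e) (ptF γ f) = ptG γ (β (γ 0) e f)

open Classical in
/-- The canonical map `E x → E y` given by parallel transport along some path from `x` to `y` in
the class `Adm`. It is only used where such paths exist and all have the same parallel
transport. -/
def canonical (E : VecFam.{u, v} X) (pt : E.Transport) (Adm : DPath X → Prop) (x y : X) :
    E x →ₗ[ℂ] E y :=
  if h : ∃ Γ : DPath X, Adm Γ ∧ Γ 0 = x ∧ Γ 1 = y then
    ((E.cast h.choose_spec.2.1.symm).trans
      ((pt h.choose).trans (E.cast h.choose_spec.2.2))).toLinearMap
  else 0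

end VecFam

/-- A hermitian vector bundle; `herm` is antilinear in the first variable. -/
structure HermBundle (X : Type u) [DiffeologicalSpace X] extends VecFam.{u, v} X where
  rank : ℕ
  isVectorBundle : toVecFam.IsVectorBundle rank
  herm : ∀ x, Fiber x →ₗ⋆[ℂ] Fiber x →ₗ[ℂ] ℂ
  herm_symm : ∀ x (e f : Fiber x), conj (herm x e f) = herm x f e
  herm_pos : ∀ x (e : Fiber x), e ≠ 0 → 0 < (herm x e e).re
  herm_smooth : ∀ (n : ℕ) (c : Eu n → X) (e f : ∀ a, Fiber (c a)),
    toVecFam.IsPlot (fun a => ⟨c a, e a⟩) → toVecFam.IsPlot (fun a => ⟨c a, f a⟩) →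
      ContDiff ℝ ∞ fun a => herm (c a) (e a) (f a)

instance {X : Type u} [DiffeologicalSpace X] :
    CoeFun (HermBundle.{u, v} X) (fun _ => X → Type v) := ⟨fun E => E.toVecFam.Fiber⟩

/-- A unitary connection on a hermitian vector bundle. -/
structure HermBundle.IsUnitaryConnection {X : Type u} [DiffeologicalSpace X]
    (E : HermBundle.{u, v} X) (pt : E.toVecFam.Transport) : Prop where
  isConnection : E.toVecFam.IsConnection pt
  unitary : ∀ (γ : DPath X) (e f : E (γ 0)),
    E.herm (γ 1) (pt γ e) (pt γ f) = E.herm (γ 0) e f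

/-! ## Bundles of algebras and bimodules -/

section Fibrewise

/-- A bilinear multiplication and a distinguished element on a complex vector space. -/
structure MulOne (A : Type u) [AddCommGroup A] [Module ℂ A] where
  mul : A →ₗ[ℂ] A →ₗ[ℂ] A
  one : A

/-- These form a unital associative algebra. -/
structure MulOne.IsAlgebra {A : Type u} [AddCommGroup A] [Module ℂ A] (a : MulOne A) : Prop where
  assoc : ∀ x y z, a.mul (a.mul x y) z = a.mul x (a.mul y z)
  one_mul : ∀ x, a.mul a.one x = x
  mul_one : ∀ x, a.mul x a.one = x

/-- Bilinear maps `A × M → M` and `M × B → M`. -/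
structure Actions (A : Type u) (B : Type v) (M : Type w) [AddCommGroup A] [Module ℂ A]
    [AddCommGroup B] [Module ℂ B] [AddCommGroup M] [Module ℂ M] where
  left : A →ₗ[ℂ] M →ₗ[ℂ] M
  right : M →ₗ[ℂ] B →ₗ[ℂ] M

/-- These are commuting unital left and right actions, i.e. `M` is an `A`-`B`-bimodule. -/
structure Actions.IsBimodule {A : Type u} {B : Type v} {M : Type w} [AddCommGroup A] [Module ℂ A]
    [AddCommGroup B] [Module ℂ B] [AddCommGroup M] [Module ℂ M]
    (m : Actions A B M) (a : MulOne A) (b : MulOne B) : Prop where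
  left_mul : ∀ x y z, m.left (a.mul x y) z = m.left x (m.left y z)
  left_one : ∀ z, m.left a.one z = z
  right_mul : ∀ z x y, m.right z (b.mul x y) = m.right (m.right z x) y
  right_one : ∀ z, m.right z b.one = z
  comm : ∀ x z y, m.right (m.left x z) y = m.left x (m.right z y)

end Fibrewise

section Bundles

variable {X : Type u} {Y : Type w} [DiffeologicalSpace X] [DiffeologicalSpace Y]

/-- A fibrewise multiplication and unit on a family of vector spaces. -/
def AlgData (A : VecFam.{u, v} X) := ∀ x, MulOne (A x)

/-- Fibrewise left and right multiplications on a family of vector spaces. -/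
def BimodData (A B M : VecFam.{u, v} X) := ∀ x, Actions (A x) (B x) (M x)

def AlgData.pullback {A : VecFam.{u, v} X} (a : AlgData A) (f : Y → X) :
    AlgData (A.pullback f) := fun y => a (f y)

/-- `A` acting on itself from both sides by multiplication. -/
def AlgData.regular {A : VecFam.{u, v} X} (a : AlgData A) : BimodData A A A :=
  fun x => ⟨(a x).mul, (a x).mul⟩

/-- An algebra structure on a family of vector spaces: fibrewise algebras, with smooth
multiplication and smooth section of units. -/
structure IsAlgebraStructure (A : VecFam.{u, v} X) (a : AlgData A) : Prop where
  isAlgebra : ∀ x, (a x).IsAlgebra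
  smooth_mul : VecFam.SmoothBilin (E := A) (F := A) (G := A) fun x => (a x).mul
  smooth_one : ∀ (n : ℕ) (c : Eu n → X), IsPlot c → A.IsPlot fun b => ⟨c b, (a (c b)).one⟩

/-- A bundle of algebras: locally trivial, as a family of algebras, with one typical fibre. -/
structure IsAlgebraBundle (A : VecFam.{u, v} X) (a : AlgData A) : Prop where
  isAlgebraStructure : IsAlgebraStructure A a
  locallyTrivial : ∃ (k : ℕ) (a₀ : MulOne (Fin k → ℂ)), A.IsVectorBundle k ∧ a₀.IsAlgebra ∧
    ∀ (n : ℕ) (c : Eu n → X), IsPlot c → ∀ b : Eu n, ∃ W : Set (Eu n), IsOpen W ∧ b ∈ W ∧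
      ∃ T : A.LocTriv k c W, ∀ q : W,
        (∀ x y, T.φ q (a₀.mul x y) = (a (c q)).mul (T.φ q x) (T.φ q y)) ∧
        T.φ q a₀.one = (a (c q)).one

/-- A bimodule structure on a family of vector spaces: fibrewise bimodules, with smooth actions. -/
structure IsBimoduleStructure {A B : VecFam.{u, v} X} (a : AlgData A) (b : AlgData B)
    (M : VecFam.{u, v} X) (m : BimodData A B M) : Prop where
  isBimodule : ∀ x, (m x).IsBimodule (a x) (b x)
  smooth_left : VecFam.SmoothBilin (E := A) (F := M) (G := M) fun x => (m x).left
  smooth_right : VecFam.SmoothBilin (E := M) (F := B) (G := M) fun x => (m x).right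

/-- A bundle of bimodules over bundles of algebras: the two algebra bundles and the family of
bimodules are simultaneously locally trivial, with one typical bimodule over one pair of typical
algebras. -/
structure IsBimoduleBundle {A B : VecFam.{u, v} X} (a : AlgData A) (b : AlgData B)
    (M : VecFam.{u, v} X) (m : BimodData A B M) : Prop where
  isBimoduleStructure : IsBimoduleStructure a b M m
  left_isAlgebraBundle : IsAlgebraBundle A a
  right_isAlgebraBundle : IsAlgebraBundle B b
  locallyTrivial : ∃ (ka kb km : ℕ) (a₀ : MulOne (Fin ka → ℂ)) (b₀ : MulOne (Fin kb → ℂ))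
    (m₀ : Actions (Fin ka → ℂ) (Fin kb → ℂ) (Fin km → ℂ)),
    M.IsVectorBundle km ∧ a₀.IsAlgebra ∧ b₀.IsAlgebra ∧ m₀.IsBimodule a₀ b₀ ∧
    ∀ (n : ℕ) (c : Eu n → X), IsPlot c → ∀ p : Eu n, ∃ W : Set (Eu n), IsOpen W ∧ p ∈ W ∧
      ∃ (TA : A.LocTriv ka c W) (TB : B.LocTriv kb c W) (TM : M.LocTriv km c W), ∀ q : W,
        (∀ x y, TA.φ q (a₀.mul x y) = (a (c q)).mul (TA.φ q x) (TA.φ q y)) ∧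
        TA.φ q a₀.one = (a (c q)).one ∧
        (∀ x y, TB.φ q (b₀.mul x y) = (b (c q)).mul (TB.φ q x) (TB.φ q y)) ∧
        TB.φ q b₀.one = (b (c q)).one ∧
        (∀ x z, TM.φ q (m₀.left x z) = (m (c q)).left (TA.φ q x) (TM.φ q z)) ∧
        (∀ z y, TM.φ q (m₀.right z y) = (m (c q)).right (TM.φ q z) (TB.φ q y))

section Tensor

variable {A B C M N : VecFam.{u, v} X}

open scoped TensorProduct

/-- The subspace of `M ⊗ N` spanned by the elements `mb ⊗ n - m ⊗ bn`. -/
def balancing (m : BimodData A B M) (n : BimodData B C N) (x : X) :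
    Submodule ℂ (M x ⊗[ℂ] N x) :=
  Submodule.span ℂ {t | ∃ (y : M x) (b : B x) (z : N x),
    t = (m x).right y b ⊗ₜ[ℂ] z - y ⊗ₜ[ℂ] (n x).left b z}

/-- The class of `y ⊗ z` in the fibre `(M ⊗_B N)|_x`. -/
def tmulB (m : BimodData A B M) (n : BimodData B C N) (x : X) (y : M x) (z : N x) :
    (M x ⊗[ℂ] N x) ⧸ balancing m n x :=
  (balancing m n x).mkQ (y ⊗ₜ[ℂ] z)

/-- The tensor product `M ⊗_B N` over `B`. A plot of its total space is, locally, a finite sum of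
classes of tensor products of plots of `M` and `N` over a common plot of `X`; these are the
plots of the quotient of `M ⊗ N`. -/
abbrev tensorB (m : BimodData A B M) (n : BimodData B C N) : VecFam.{u, v} X where
  Fiber x := (M x ⊗[ℂ] N x) ⧸ balancing m n x
  diff := DiffeologicalSpace.generateFrom
    {p | ∃ c : Eu p.1 → X, IsPlot c ∧ ∃ (s : ℕ) (y : Fin s → ∀ b, M (c b))
      (z : Fin s → ∀ b, N (c b)),
      (∀ l, M.IsPlot fun b => ⟨c b, y l b⟩) ∧ (∀ l, N.IsPlot fun b => ⟨c b, z l b⟩) ∧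
      p.2 = fun b => ⟨c b, ∑ l, tmulB m n (c b) (y l b) (z l b)⟩}

/-- The left `A`- and right `C`-multiplication on `M ⊗_B N` induced by those on `M` and `N`. -/
def IsTensorActions (m : BimodData A B M) (n : BimodData B C N)
    (t : BimodData A C (tensorB m n)) : Prop :=
  ∀ (x : X) (y : M x) (z : N x),
    (∀ r : A x, (t x).left r (tmulB m n x y z) = tmulB m n x ((m x).left r y) z) ∧
    (∀ r : C x, (t x).right (tmulB m n x y z) r = tmulB m n x y ((n x).right z r))

/-- The parallel transport on `M ⊗_B N` induced by those on `M` and `N`. -/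
def IsTensorTransport (m : BimodData A B M) (n : BimodData B C N) (ptM : M.Transport)
    (ptN : N.Transport) (pt : (tensorB m n).Transport) : Prop :=
  ∀ (γ : DPath X) (y : M (γ 0)) (z : N (γ 0)),
    pt γ (tmulB m n (γ 0) y z) = tmulB m n (γ 1) (ptM γ y) (ptN γ z)

end Tensor

/-- An isomorphism of bundles of bimodules (over the identity of `A` and `B`). -/
structure BimodIso {A B M M' : VecFam.{u, v} X} (m : BimodData A B M) (m' : BimodData A B M') where
  equiv : ∀ x, M x ≃ₗ[ℂ] M' x
  smooth : @DSmooth _ _ M.diff M'.diff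
    (fun p => (⟨p.1, equiv p.1 p.2⟩ : Σ x, M' x))
  smooth_symm : @DSmooth _ _ M'.diff M.diff
    (fun p => (⟨p.1, (equiv p.1).symm p.2⟩ : Σ x, M x))
  map_left : ∀ x (r : A x) (z : M x), equiv x ((m x).left r z) = (m' x).left r (equiv x z)
  map_right : ∀ x (z : M x) (r : B x), equiv x ((m x).right z r) = (m' x).right (equiv x z) r

/-- The bundles `M` of `A`-`B`-bimodules and `N` of `B`-`A`-bimodules are mutually inverse Morita
equivalences: `M ⊗_B N ≅ A` and `N ⊗_A M ≅ B` as bundles of bimodules. -/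
def MutuallyInverse {A B M N : VecFam.{u, v} X} (a : AlgData A) (b : AlgData B)
    (m : BimodData A B M) (n : BimodData B A N) : Prop :=
  (∃ t : BimodData A A (tensorB m n), IsTensorActions m n t ∧ Nonempty (BimodIso t a.regular)) ∧
  (∃ t : BimodData B B (tensorB n m), IsTensorActions n m t ∧ Nonempty (BimodIso t b.regular))

end Bundles

/-! ## Target spaces -/

/-- `S` is an embedded submanifold of the `d`-dimensional manifold `M`, by slice charts. -/
def IsSubmanifold {d : ℕ} {M : Type u} [TopologicalSpace M] [ChartedSpace (Eu d) M]
    (S : Set M) : Prop :=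
  ∀ x ∈ S, ∃ φ ∈ IsManifold.maximalAtlas (𝓡 d) ∞ M, x ∈ φ.source ∧
    ∃ l : ℕ, ∀ y ∈ φ.source, y ∈ S ↔ ∀ r : Fin d, l ≤ (r : ℕ) → φ y r = 0

/-- A target space: a connected smooth manifold `M` with a family of submanifolds `Q i`. -/
structure TargetSpace (I : Type w) where
  M : Type u
  dim : ℕ
  [top : TopologicalSpace M]
  [charted : ChartedSpace (Eu dim) M]
  [manifold : IsManifold (𝓡 dim) ∞ M]
  [t2 : T2Space M]
  [secondCountable : SecondCountableTopology M]
  [connected : ConnectedSpace M]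
  Q : I → Set M
  isSubmanifold : ∀ i, IsSubmanifold (d := dim) (Q i)

attribute [instance] TargetSpace.top TargetSpace.charted TargetSpace.manifold TargetSpace.t2
  TargetSpace.secondCountable TargetSpace.connected

namespace TargetSpace

variable {I : Type w} (T : TargetSpace.{u, w} I)

/-- The manifold diffeology: plots are the smooth maps `ℝⁿ → M`. -/
instance : DiffeologicalSpace T.M where
  plots n := {p | ContMDiff (𝓡 n) (𝓡 T.dim) ∞ p}
  constant_plots _ := contMDiff_const
  plot_reparam hp hf := hp.comp hf.contMDiff
  locality {n p} h := by
    intro a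
    obtain ⟨W, hW, ha, H⟩ := h a
    obtain ⟨ε, hε, hε'⟩ := Metric.isOpen_iff.mp hW a ha
    have h1 : ContMDiff (𝓡 n) (𝓡 T.dim) ∞ (p ∘ OpenPartialHomeomorph.univBall a ε) := by
      refine H (fun b => hε' ?_) OpenPartialHomeomorph.contDiff_univBall
      have hb := (OpenPartialHomeomorph.univBall a ε).map_source (x := b)
      rw [OpenPartialHomeomorph.univBall_target a hε] at hb
      exact hb (by simp)
    have h2 : ContMDiffOn (𝓡 n) (𝓡 T.dim) ∞
        ((p ∘ OpenPartialHomeomorph.univBall a ε) ∘ (OpenPartialHomeomorph.univBall a ε).symm)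
        (Metric.ball a ε) :=
      h1.comp_contMDiffOn (OpenPartialHomeomorph.contDiffOn_univBall_symm.contMDiffOn)
    refine (ContMDiffOn.congr h2 fun b hb => ?_).contMDiffAt (Metric.ball_mem_nhds a hε)
    simp only [Function.comp_apply]
    rw [(OpenPartialHomeomorph.univBall a ε).right_inv
      (by rwa [OpenPartialHomeomorph.univBall_target a hε])]

theorem isPlot_iff {n : ℕ} {p : Eu n → T.M} : IsPlot p ↔ ContMDiff (𝓡 n) (𝓡 T.dim) ∞ p := Iff.rfl

/-- The differential of `f : ℝⁿ → M` has rank `≤ k` everywhere. -/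
def RankLE (k : ℕ) {n : ℕ} (f : Eu n → T.M) : Prop :=
  ∀ a, Module.finrank ℝ (LinearMap.range (mfderiv (𝓡 n) (𝓡 T.dim) f a).toLinearMap) ≤ k


/-! ### Smoothness of concatenation -/

variable {T}

theorem _root_.BraneGeometry.DPath.eq_of_le_zero {X : Type u} [DiffeologicalSpace X]
    (γ : DPath X) {t : ℝ} (ht : t ≤ 0) : γ t = γ 0 := by
  obtain ⟨ε, hε, h0, -⟩ := γ.sit
  exact h0 t (by linarith)

theorem _root_.BraneGeometry.DPath.eq_of_one_le {X : Type u} [DiffeologicalSpace X]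
    (γ : DPath X) {t : ℝ} (ht : 1 ≤ t) : γ t = γ 1 := by
  obtain ⟨ε, hε, -, h1⟩ := γ.sit
  exact h1 t (by linarith)

/-- Gluing two smooth maps along `s = 0`, if each is constantly extended across. -/
theorem contMDiffAt_glue {n : ℕ} {F G y : Eu n → T.M} {s : Eu n → ℝ} {a : Eu n}
    (hF : IsPlot F) (hG : IsPlot G) (hy : IsPlot y) (hs : Continuous s)
    (hFy : ∀ b, 0 ≤ s b → F b = y b) (hGy : ∀ b, s b ≤ 0 → G b = y b) :
    ContMDiffAt (𝓡 n) (𝓡 T.dim) ∞ (fun b => if s b ≤ 0 then F b else G b) a := by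
  have hF' : ContMDiff (𝓡 n) (𝓡 T.dim) ∞ F := hF
  have hG' : ContMDiff (𝓡 n) (𝓡 T.dim) ∞ G := hG
  have hy' : ContMDiff (𝓡 n) (𝓡 T.dim) ∞ y := hy
  rcases lt_trichotomy (s a) 0 with h | h | h
  · refine (hF' a).congr_of_eventuallyEq ?_
    filter_upwards [hs.continuousAt.eventually (gt_mem_nhds h)] with b hb
    exact if_pos (le_of_lt hb)
  · set e := extChartAt (𝓡 T.dim) (y a) with he
    have hFa : F a = y a := hFy a h.ge
    have hGa : G a = y a := hGy a h.le
    have eF : ContMDiffAt (𝓡 n) 𝓘(ℝ, Eu T.dim) ∞ (fun b => e (F b)) a := by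
      refine ContMDiffAt.comp a (contMDiffAt_extChartAt' ?_) (hF' a)
      rw [hFa]; exact mem_chart_source _ _
    have eG : ContMDiffAt (𝓡 n) 𝓘(ℝ, Eu T.dim) ∞ (fun b => e (G b)) a := by
      refine ContMDiffAt.comp a (contMDiffAt_extChartAt' ?_) (hG' a)
      rw [hGa]; exact mem_chart_source _ _
    have ey : ContMDiffAt (𝓡 n) 𝓘(ℝ, Eu T.dim) ∞ (fun b => e (y b)) a :=
      ContMDiffAt.comp a (contMDiffAt_extChartAt' (mem_chart_source _ _)) (hy' a)
    have esum : ContMDiffAt (𝓡 n) 𝓘(ℝ, Eu T.dim) ∞ (fun b => e (F b) + e (G b) - e (y b)) a :=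
      (eF.add eG).sub ey
    have hval : e (F a) + e (G a) - e (y a) = e (y a) := by rw [hFa, hGa, add_sub_cancel_right]
    have hsymm : ContMDiffAt 𝓘(ℝ, Eu T.dim) (𝓡 T.dim) ∞ e.symm
        (e (F a) + e (G a) - e (y a)) := by
      rw [hval]
      exact (contMDiffOn_extChartAt_symm (y a)).contMDiffAt
        (extChartAt_target_mem_nhds (y a))
    refine (ContMDiffAt.comp a hsymm esum).congr_of_eventuallyEq ?_
    have hsrc : IsOpen e.source := isOpen_extChartAt_source _
    have m1 : ∀ᶠ b in 𝓝 a, F b ∈ e.source :=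
      hF'.continuous.continuousAt.eventually (hsrc.mem_nhds (by
        rw [hFa]; exact mem_extChartAt_source _))
    have m2 : ∀ᶠ b in 𝓝 a, G b ∈ e.source :=
      hG'.continuous.continuousAt.eventually (hsrc.mem_nhds (by
        rw [hGa]; exact mem_extChartAt_source _))
    filter_upwards [m1, m2] with b h1 h2
    simp only [Function.comp_apply]
    split_ifs with hb
    · rw [hGy b hb, add_sub_cancel_right, e.left_inv h1]
    · rw [hFy b (not_le.mp hb).le, add_sub_cancel_left, e.left_inv h2]
  · refine (hG' a).congr_of_eventuallyEq ?_
    filter_upwards [hs.continuousAt.eventually (lt_mem_nhds h)] with b hb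
    exact if_neg (not_le_of_gt hb)

variable (T)

/-- Composable pairs `(γ₂, γ₁)` of paths in `M`. -/
abbrev PMComp := {q : DPath T.M × DPath T.M // q.2 1 = q.1 0}

theorem dSmooth_comp : DSmooth (fun q : T.PMComp => q.1.1.comp q.1.2 q.2) := by
  intro n q hq m g τ hg hτ a
  obtain ⟨h2, h1⟩ := isPlot_prod_iff.1 (isPlot_subtype_iff.1 hq)
  have key := contMDiffAt_glue (T := T) (a := a) (s := fun b => τ b - 1 / 2)
    (h1 m g (fun b => 2 * τ b) hg (contDiff_const.mul hτ))
    (h2 m g (fun b => 2 * τ b - 1) hg ((contDiff_const.mul hτ).sub contDiff_const))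
    (h1 m g (fun _ => 1) hg contDiff_const) (hτ.continuous.sub continuous_const)
    (fun b hb => DPath.eq_of_one_le _ (by linarith))
    (fun b hb => (DPath.eq_of_le_zero _ (by linarith)).trans (q (g b)).2.symm)
  simp only [sub_nonpos] at key
  exact key

theorem dSmooth_rev : DSmooth (fun γ : DPath T.M => γ.rev) :=
  fun _ _ hp m g _ hg hτ => hp m g _ hg (contDiff_const.sub hτ)

/-- A smooth family of closed paths is a smooth family of loops. -/
theorem isPlot_fract {n : ℕ} {p : Eu n → DPath T.M} (hp : IsPlot p) (hc : ∀ b, p b 0 = p b 1)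
    {τ : Eu n → ℝ} (hτ : ContDiff ℝ ∞ τ) : IsPlot fun b => p b (Int.fract (τ b)) := by
  intro a
  by_cases ha : Int.fract (τ a) = 0
  · have key := contMDiffAt_glue (T := T) (a := a) (s := fun b => τ b - ⌊τ a⌋)
      (hp n id (fun b => τ b - ⌊τ a⌋ + 1) contDiff_id
        ((hτ.sub contDiff_const).add contDiff_const))
      (hp n id (fun b => τ b - ⌊τ a⌋) contDiff_id (hτ.sub contDiff_const))
      (hp n id (fun _ => 1) contDiff_id contDiff_const) (hτ.continuous.sub continuous_const)
      (fun b hb => DPath.eq_of_one_le _ (by linarith))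
      (fun b hb => (DPath.eq_of_le_zero _ hb).trans (hc b))
    refine key.congr_of_eventuallyEq ?_
    have hfl : (⌊τ a⌋ : ℝ) = τ a := by
      have := Int.floor_add_fract (τ a); rw [ha, add_zero] at this; exact this
    filter_upwards [hτ.continuous.continuousAt.eventually
      (Ioo_mem_nhds (show τ a - 1 < τ a by linarith) (show τ a < τ a + 1 by linarith))] with b hb
    have hb1 : τ a - 1 < τ b := hb.1
    have hb2 : τ b < τ a + 1 := hb.2
    simp only [id]
    rcases lt_trichotomy (τ b) (τ a) with h | h | h
    · rw [if_pos (by linarith)]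
      congr 1
      rw [Int.fract_eq_iff]
      exact ⟨by linarith, by linarith, ⌊τ a⌋ - 1, by push_cast; ring⟩
    · rw [if_pos (by linarith), h, ha, hfl, sub_self, zero_add, hc b]
    · rw [if_neg (by linarith)]
      congr 1
      rw [Int.fract_eq_iff]
      exact ⟨by linarith, by linarith, ⌊τ a⌋, by ring⟩
  · have h1 : ContMDiff (𝓡 n) (𝓡 T.dim) ∞ fun b => p b (τ b - ⌊τ a⌋) :=
      hp n id (fun b => τ b - ⌊τ a⌋) contDiff_id (hτ.sub contDiff_const)
    refine (h1 a).congr_of_eventuallyEq ?_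
    have hpos : (⌊τ a⌋ : ℝ) < τ a := by
      have := Int.floor_add_fract (τ a)
      have := lt_of_le_of_ne (Int.fract_nonneg (τ a)) (Ne.symm ha)
      linarith
    filter_upwards [hτ.continuous.continuousAt.eventually
      (Ioo_mem_nhds hpos (Int.lt_floor_add_one (τ a)))] with b hb
    have hb1 : (⌊τ a⌋ : ℝ) < τ b := hb.1
    have hb2 : τ b < ⌊τ a⌋ + 1 := hb.2
    congr 1
    rw [Int.fract_eq_iff]
    exact ⟨by linarith, by linarith, ⌊τ a⌋, by ring⟩

/-- Two paths have the same initial point and the same end point. -/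
def _root_.BraneGeometry.Par {X : Type u} [DiffeologicalSpace X] (γ₁ γ₂ : DPath X) : Prop :=
  γ₁ 0 = γ₂ 0 ∧ γ₁ 1 = γ₂ 1

variable {T}

theorem _root_.BraneGeometry.Par.trans {X : Type u} [DiffeologicalSpace X] {γ₁ γ₂ γ₃ : DPath X}
    (h : Par γ₁ γ₂) (h' : Par γ₂ γ₃) : Par γ₁ γ₃ := ⟨h.1.trans h'.1, h.2.trans h'.2⟩

theorem _root_.BraneGeometry.Par.symm {X : Type u} [DiffeologicalSpace X] {γ₁ γ₂ : DPath X}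
    (h : Par γ₁ γ₂) : Par γ₂ γ₁ := ⟨h.1.symm, h.2.symm⟩

theorem _root_.BraneGeometry.Par.refl {X : Type u} [DiffeologicalSpace X] (γ : DPath X) :
    Par γ γ := ⟨rfl, rfl⟩

theorem _root_.BraneGeometry.Par.rev {X : Type u} [DiffeologicalSpace X] {γ₁ γ₂ : DPath X}
    (h : Par γ₁ γ₂) : Par γ₁.rev γ₂.rev :=
  ⟨by rw [DPath.rev_zero, DPath.rev_zero, h.2], by rw [DPath.rev_one, DPath.rev_one, h.1]⟩

theorem _root_.BraneGeometry.Par.comp {X : Type u} [DiffeologicalSpace X]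
    {γ₁ γ₁' γ₂ γ₂' : DPath X} (h₁ : Par γ₁ γ₁') (h₂ : Par γ₂ γ₂') (h : γ₁ 1 = γ₂ 0)
    (h' : γ₁' 1 = γ₂' 0) : Par (γ₂.comp γ₁ h) (γ₂'.comp γ₁' h') :=
  ⟨by rw [DPath.comp_zero, DPath.comp_zero, h₁.1], by rw [DPath.comp_one, DPath.comp_one, h₂.2]⟩

theorem _root_.BraneGeometry.Par.comp_rev {X : Type u} [DiffeologicalSpace X] {γ₁ γ₂ : DPath X}
    (h : Par γ₁ γ₂) : γ₁ 1 = γ₂.rev 0 := by rw [DPath.rev_zero, h.2]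

/-- The closed path `γ̄₂ ⋆ γ₁`. -/
def cupPath (γ₁ γ₂ : DPath T.M) (h : Par γ₁ γ₂) : DPath T.M := γ₂.rev.comp γ₁ h.comp_rev

theorem cupPath_closed (γ₁ γ₂ : DPath T.M) (h : Par γ₁ γ₂) :
    cupPath γ₁ γ₂ h 0 = cupPath γ₁ γ₂ h 1 := by
  rw [cupPath, DPath.comp_zero, DPath.comp_one, DPath.rev_one, h.1]

/-- The loop `γ₁ ∪ γ₂ = γ̄₂ ⋆ γ₁`, which first follows `γ₁` and then returns along `γ₂`. -/
def cup (γ₁ γ₂ : DPath T.M) (h : Par γ₁ γ₂) : DLoop T.M where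
  toFun t := cupPath γ₁ γ₂ h (Int.fract t)
  smooth := fun _ _ hp =>
    T.isPlot_fract (isPlot_const (x := cupPath γ₁ γ₂ h)) (fun _ => cupPath_closed γ₁ γ₂ h)
      hp.contDiff
  periodic t := by rw [Int.fract_add_one]

variable (T)

/-- Pairs of paths in `M` with common end points. -/
abbrev PM2 := {g : DPath T.M × DPath T.M // Par g.1 g.2}

theorem dSmooth_cup : DSmooth (fun g : T.PM2 => cup g.1.1 g.1.2 g.2) := by
  intro n q hq m g τ hg hτ
  obtain ⟨h1, h2⟩ := isPlot_prod_iff.1 (isPlot_subtype_iff.1 hq)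
  have hq' : IsPlot fun b => cupPath (q b).1.1 (q b).1.2 (q b).2 := by
    have hr : IsPlot fun b => (⟨((q b).1.2.rev, (q b).1.1), (q b).2.comp_rev⟩ : T.PMComp) :=
      isPlot_subtype_iff.2 (isPlot_prod_iff.2 ⟨T.dSmooth_rev _ _ h2, h1⟩)
    exact T.dSmooth_comp _ _ hr
  exact T.isPlot_fract (isPlot_reparam hq' hg) (fun b => cupPath_closed _ _ (q (g b)).2) hτ


/-- Triples of paths in `M` with common end points. -/
abbrev PM3 := {g : DPath T.M × DPath T.M × DPath T.M // Par g.1 g.2.1 ∧ Par g.2.1 g.2.2}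

theorem dSmooth_cup₁₂ : DSmooth (fun g : T.PM3 => cup g.1.1 g.1.2.1 g.2.1) := by
  intro n q hq
  obtain ⟨h1, h23⟩ := isPlot_prod_iff.1 (isPlot_subtype_iff.1 hq)
  obtain ⟨h2, h3⟩ := isPlot_prod_iff.1 h23
  exact T.dSmooth_cup n (fun a => ⟨((q a).1.1, (q a).1.2.1), (q a).2.1⟩)
    (isPlot_subtype_iff.2 (isPlot_prod_iff.2 ⟨h1, h2⟩))

theorem dSmooth_cup₂₃ : DSmooth (fun g : T.PM3 => cup g.1.2.1 g.1.2.2 g.2.2) := by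
  intro n q hq
  obtain ⟨h1, h23⟩ := isPlot_prod_iff.1 (isPlot_subtype_iff.1 hq)
  obtain ⟨h2, h3⟩ := isPlot_prod_iff.1 h23
  exact T.dSmooth_cup n (fun a => ⟨((q a).1.2.1, (q a).1.2.2), (q a).2.2⟩)
    (isPlot_subtype_iff.2 (isPlot_prod_iff.2 ⟨h2, h3⟩))

theorem dSmooth_cup₁₃ : DSmooth (fun g : T.PM3 => cup g.1.1 g.1.2.2 (g.2.1.trans g.2.2)) := by
  intro n q hq
  obtain ⟨h1, h23⟩ := isPlot_prod_iff.1 (isPlot_subtype_iff.1 hq)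
  obtain ⟨h2, h3⟩ := isPlot_prod_iff.1 h23
  exact T.dSmooth_cup n (fun a => ⟨((q a).1.1, (q a).1.2.2), (q a).2.1.trans (q a).2.2⟩)
    (isPlot_subtype_iff.2 (isPlot_prod_iff.2 ⟨h1, h3⟩))

/-! ### Spaces of paths between branes -/

/-- The space `P i j` of paths from `Q i` to `Q j`. -/
abbrev P (i j : I) := {γ : DPath T.M // γ 0 ∈ T.Q i ∧ γ 1 ∈ T.Q j}

variable {T} {i j k : I}

/-- The initial point. -/
def ev₀ (γ : T.P i j) : T.Q i := ⟨γ.1 0, γ.2.1⟩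

/-- The end point. -/
def ev₁ (γ : T.P i j) : T.Q j := ⟨γ.1 1, γ.2.2⟩

/-- The constant path at a point of a brane. -/
def cp (x : T.Q i) : T.P i i := ⟨DPath.const x.1, x.2, x.2⟩

/-- The reversed path. -/
def rev (γ : T.P i j) : T.P j i :=
  ⟨γ.1.rev, by rw [DPath.rev_zero]; exact γ.2.2, by rw [DPath.rev_one]; exact γ.2.1⟩

/-- The concatenation `γ₂ ⋆ γ₁`: first `γ₁`, then `γ₂`. -/
def comp (γ₂ : T.P j k) (γ₁ : T.P i j) (h : γ₁.1 1 = γ₂.1 0) : T.P i k :=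
  ⟨γ₂.1.comp γ₁.1 h, by rw [DPath.comp_zero]; exact γ₁.2.1, by rw [DPath.comp_one]; exact γ₂.2.2⟩

theorem comp_zero (γ₂ : T.P j k) (γ₁ : T.P i j) (h : γ₁.1 1 = γ₂.1 0) :
    (comp γ₂ γ₁ h).1 0 = γ₁.1 0 := DPath.comp_zero _ _ h
theorem comp_one (γ₂ : T.P j k) (γ₁ : T.P i j) (h : γ₁.1 1 = γ₂.1 0) :
    (comp γ₂ γ₁ h).1 1 = γ₂.1 1 := DPath.comp_one _ _ h
theorem rev_zero (γ : T.P i j) : (rev γ).1 0 = γ.1 1 := DPath.rev_zero _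
theorem rev_one (γ : T.P i j) : (rev γ).1 1 = γ.1 0 := DPath.rev_one _
theorem rev_rev (γ : T.P i j) : rev (rev γ) = γ := Subtype.ext (DPath.rev_rev _)
theorem rev_cp (x : T.Q i) : rev (cp x) = cp x := rfl
theorem cp_comp_cp (x : T.Q i) : comp (cp x) (cp x) rfl = cp x :=
  Subtype.ext (DPath.const_comp_const _)
theorem rev_comp (γ₂ : T.P j k) (γ₁ : T.P i j) (h : γ₁.1 1 = γ₂.1 0) :
    rev (comp γ₂ γ₁ h) = comp (rev γ₁) (rev γ₂) (by rw [rev_one, rev_zero, h]) :=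
  Subtype.ext (DPath.rev_comp _ _ h)

theorem rev_one_comp_cp (γ : T.P i j) : (rev γ).1 1 = (comp γ (cp (ev₀ γ)) rfl).1 0 :=
  (rev_one γ).trans (comp_zero γ (cp (ev₀ γ)) rfl).symm

variable (T) (i j k)

/-- The space `P j k ×_{Q j} P i j` of composable pairs `(γ₂, γ₁)`. -/
abbrev Comp := {q : T.P j k × T.P i j // q.2.1 1 = q.1.1 0}

/-- Pairs of paths from `Q i` to `Q j` with common end points. -/
abbrev P2 := {g : T.P i j × T.P i j // Par g.1.1 g.2.1}

variable {T} {i j k}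

/-- The concatenation map. -/
def conc (q : T.Comp i j k) : T.P i k := comp q.1.1 q.1.2 q.2

theorem dSmooth_ev₀ : DSmooth (ev₀ : T.P i j → T.Q i) :=
  fun n _ hp => DPath.dSmooth_eval (X := T.M) 0 n _ hp
theorem dSmooth_ev₁ : DSmooth (ev₁ : T.P i j → T.Q j) :=
  fun n _ hp => DPath.dSmooth_eval (X := T.M) 1 n _ hp
theorem dSmooth_cp : DSmooth (cp : T.Q i → T.P i i) :=
  fun _ _ hp _ _ _ hg _ => isPlot_reparam (X := T.M) hp hg
theorem dSmooth_revP : DSmooth (rev : T.P i j → T.P j i) :=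
  fun n _ hp => T.dSmooth_rev n _ hp
theorem dSmooth_fst : DSmooth (fun q : T.Comp i j k => q.1.1) :=
  fun _ _ hp => (isPlot_prod_iff.1 (isPlot_subtype_iff.1 hp)).1
theorem dSmooth_snd : DSmooth (fun q : T.Comp i j k => q.1.2) :=
  fun _ _ hp => (isPlot_prod_iff.1 (isPlot_subtype_iff.1 hp)).2
theorem dSmooth_conc : DSmooth (conc : T.Comp i j k → T.P i k) := by
  intro n p hp
  obtain ⟨h1, h2⟩ := isPlot_prod_iff.1 (isPlot_subtype_iff.1 hp)
  exact T.dSmooth_comp n (fun a => ⟨((p a).1.1.1, (p a).1.2.1), (p a).2⟩)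
    (isPlot_subtype_iff.2 (isPlot_prod_iff.2 ⟨h1, h2⟩))
theorem dSmooth_P2fst : DSmooth (fun g : T.P2 i j => g.1.1) :=
  fun _ _ hp => (isPlot_prod_iff.1 (isPlot_subtype_iff.1 hp)).1
theorem dSmooth_P2snd : DSmooth (fun g : T.P2 i j => g.1.2) :=
  fun _ _ hp => (isPlot_prod_iff.1 (isPlot_subtype_iff.1 hp)).2
theorem dSmooth_P2cup : DSmooth (fun g : T.P2 i j => cup g.1.1.1 g.1.2.1 g.2) := by
  intro n p hp
  obtain ⟨h1, h2⟩ := isPlot_prod_iff.1 (isPlot_subtype_iff.1 hp)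
  exact T.dSmooth_cup n (fun a => ⟨((p a).1.1.1, (p a).1.2.1), (p a).2⟩)
    (isPlot_subtype_iff.2 (isPlot_prod_iff.2 ⟨h1, h2⟩))

/-! ### Superficial connections -/

/-- A path in `P i j` which fixes the end points and whose adjoint map `(s, t) ↦ Γ s t` has
rank one. -/
def FixedEndsThin (Γ : DPath (T.P i j)) : Prop :=
  (∀ s, (Γ s).1 0 = (Γ 0).1 0 ∧ (Γ s).1 1 = (Γ 0).1 1) ∧
  T.RankLE 1 (fun a : Eu 2 => (Γ (a 0)).1 (a 1))

/-- Superficial connections on vector bundles over `P i j`. In the second condition,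
`h` is a rank-two homotopy between `h 0` and `h 1`. -/
structure IsSuperficial (E : VecFam.{u, v} (T.P i j)) (pt : E.Transport) : Prop where
  thin : ∀ Γ₁ Γ₂ : DPath (T.P i j), FixedEndsThin Γ₁ → FixedEndsThin Γ₂ →
    ∀ (h₀ : Γ₁ 0 = Γ₂ 0) (h₁ : Γ₁ 1 = Γ₂ 1) (z : E (Γ₁ 0)),
      pt Γ₂ (E.cast h₀ z) = E.cast h₁ (pt Γ₁ z)
  rankTwo : ∀ h : DPath (DPath (T.P i j)),
    (∀ r s, (h r s).1 0 = (h 0 s).1 0 ∧ (h r s).1 1 = (h 0 s).1 1) →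
    T.RankLE 2 (fun a : Eu 3 => (h (a 0) (a 1)).1 (a 2)) →
    ∀ z : E (h 0 0),
      pt (h.map (fun Γ => Γ 1) (DPath.dSmooth_eval 1)) (pt (h 0) z) =
        pt (h 1) (pt (h.map (fun Γ => Γ 0) (DPath.dSmooth_eval 0)) z)

/-- A path of loops in `M` whose adjoint map has rank one. -/
def ThinLoopPath (Γ : DPath (DLoop T.M)) : Prop :=
  T.RankLE 1 (fun a : Eu 2 => Γ (a 0) (a 1))

/-- Superficial connections on line bundles over the loop space: parallel transport along a thin
path of loops depends only on its end points, and closed paths in the loop space that are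
homotopic through a rank-two homotopy of closed paths have the same holonomy. -/
structure IsSuperficialLoop (E : VecFam.{u, v} (DLoop T.M)) (pt : E.Transport) : Prop where
  thin : ∀ Γ₁ Γ₂ : DPath (DLoop T.M), ThinLoopPath Γ₁ → ThinLoopPath Γ₂ →
    ∀ (h₀ : Γ₁ 0 = Γ₂ 0) (h₁ : Γ₁ 1 = Γ₂ 1) (z : E (Γ₁ 0)),
      pt Γ₂ (E.cast h₀ z) = E.cast h₁ (pt Γ₁ z)
  rankTwo : ∀ h : DPath (DPath (DLoop T.M)), (∀ r, h r 0 = h r 1) →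
    T.RankLE 2 (fun a : Eu 3 => h (a 0) (a 1) (a 2)) →
    ∀ z : E (h 0 0),
      pt (h.map (fun Γ => Γ 1) (DPath.dSmooth_eval 1)) (pt (h 0) z) =
        pt (h 1) (pt (h.map (fun Γ => Γ 0) (DPath.dSmooth_eval 0)) z)

end TargetSpace

open TargetSpace

/-! ## Loop space brane geometry -/

/-- The data of a loop space brane geometry: a hermitian line bundle `L` over the loop space with
a fusion product `lam`, hermitian vector bundles `R i j` over `P i j`, parallel transports, a
fusion representation `phi`, a lifted path concatenation `chi`, lifted constant paths `eps` and a
lifted path reversal `alpha`. Linear maps out of tensor products are recorded as bilinear maps, and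
linear maps into complex conjugate bundles as antilinear maps. -/
structure LBGData {I : Type w} (T : TargetSpace.{u, w} I) where
  L : HermBundle.{u, v} (DLoop T.M)
  ptL : L.toVecFam.Transport
  lam : ∀ (γ₁ γ₂ γ₃ : DPath T.M) (h : Par γ₁ γ₂) (h' : Par γ₂ γ₃),
    L (cup γ₁ γ₂ h) →ₗ[ℂ] L (cup γ₂ γ₃ h') →ₗ[ℂ] L (cup γ₁ γ₃ (h.trans h'))
  R : ∀ i j : I, HermBundle.{u, v} (T.P i j)
  ptR : ∀ i j, (R i j).toVecFam.Transport
  phi : ∀ (i j : I) (γ₁ γ₂ : T.P i j) (h : Par γ₁.1 γ₂.1),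
    L (cup γ₁.1 γ₂.1 h) →ₗ[ℂ] R i j γ₂ →ₗ[ℂ] R i j γ₁
  chi : ∀ (i j k : I) (γ₁₂ : T.P i j) (γ₂₃ : T.P j k) (h : γ₁₂.1 1 = γ₂₃.1 0),
    R j k γ₂₃ →ₗ[ℂ] R i j γ₁₂ →ₗ[ℂ] R i k (comp γ₂₃ γ₁₂ h)
  eps : ∀ (i : I) (x : T.Q i), R i i (cp x)
  alpha : ∀ (i j : I) (γ : T.P i j), R i j γ ≃ₗ⋆[ℂ] R j i (rev γ)

namespace LBGData

variable {I : Type w} {T : TargetSpace.{u, w} I} (G : LBGData.{u, v, w} T)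

/-- The canonical isomorphism `d` between the fibres of `R i j` over thin homotopic paths. -/
def dR (i j : I) (γ γ' : T.P i j) : G.R i j γ →ₗ[ℂ] G.R i j γ' :=
  (G.R i j).toVecFam.canonical (G.ptR i j) FixedEndsThin γ γ'

/-- The canonical isomorphism `d` between the fibres of `L` over thin homotopic loops. -/
def dL (τ τ' : DLoop T.M) : G.L τ →ₗ[ℂ] G.L τ' :=
  G.L.toVecFam.canonical G.ptL ThinLoopPath τ τ'

/-- `ν` is the element of `L|_{γ ∪ γ}` which is neutral for the fusion product. -/
def IsFusionUnit (γ : DPath T.M) (ν : G.L (cup γ γ (Par.refl γ))) : Prop :=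
  ∀ (γ' : DPath T.M) (h : Par γ γ') (q : G.L (cup γ γ' h)), G.lam γ γ γ' (Par.refl γ) h ν q = q

/-- `p'` is the image of `p` under the antilinear map `L|_{γ₁ ∪ γ₂} → L|_{γ₂ ∪ γ₁}` induced by the
fusion product and the hermitian metric. -/
def IsFusionDual (γ₁ γ₂ : DPath T.M) (h : Par γ₁ γ₂) (p : G.L (cup γ₁ γ₂ h))
    (p' : G.L (cup γ₂ γ₁ h.symm)) : Prop :=
  ∃ ν : G.L (cup γ₁ γ₁ (Par.refl γ₁)), G.IsFusionUnit γ₁ ν ∧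
    ∀ q : G.L (cup γ₂ γ₁ h.symm),
      G.lam γ₁ γ₂ γ₁ h h.symm p q = G.L.herm (cup γ₂ γ₁ h.symm) p' q • ν

/-- The map `L|_{γ₂₃ ∪ γ₂₃'} ⊗ L|_{γ₁₂ ∪ γ₁₂'} → L|_{(γ₂₃ ⋆ γ₁₂) ∪ (γ₂₃' ⋆ γ₁₂')}` induced by the
fusion product and canonical isomorphisms. -/
def lam' (γ₂₃ γ₂₃' γ₁₂ γ₁₂' : DPath T.M) (h : Par γ₂₃ γ₂₃') (h' : Par γ₁₂ γ₁₂')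
    (hc : γ₁₂ 1 = γ₂₃ 0) (p : G.L (cup γ₂₃ γ₂₃' h)) (q : G.L (cup γ₁₂ γ₁₂' h')) :
    G.L (cup (γ₂₃.comp γ₁₂ hc) (γ₂₃'.comp γ₁₂' (h'.2.symm.trans (hc.trans h.1)))
      (h'.comp h _ _)) :=
  have e₁ : Par (γ₂₃'.rev.comp γ₂₃ h.comp_rev) (DPath.const (γ₂₃ 0)) :=
    ⟨DPath.comp_zero _ _ _, by rw [DPath.comp_one, DPath.rev_one, ← h.1]; rfl⟩
  have e₂ : γ₁₂.rev 1 = γ₁₂' 0 := by rw [DPath.rev_one, h'.1]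
  have e₃ : Par (DPath.const (γ₂₃ 0)) (γ₁₂'.comp γ₁₂.rev e₂) :=
    ⟨by rw [DPath.comp_zero, DPath.rev_zero, hc]; rfl,
      by rw [DPath.comp_one, ← h'.2, hc]; rfl⟩
  G.dL _ _ (G.lam (γ₂₃'.rev.comp γ₂₃ h.comp_rev) (DPath.const (γ₂₃ 0)) (γ₁₂'.comp γ₁₂.rev e₂)
    e₁ e₃ (G.dL _ _ p) (G.dL _ _ q))

/-- The regularity conditions and the axioms of a loop space brane geometry. -/
structure IsLBG : Prop where
  -- the line bundle over the loop space
  L_rank : G.L.rank = 1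
  L_connection : G.L.IsUnitaryConnection G.ptL
  L_superficial : IsSuperficialLoop G.L.toVecFam G.ptL
  -- the fusion product
  lam_unitary : ∀ γ₁ γ₂ γ₃ h h' p q p' q',
    G.L.herm _ (G.lam γ₁ γ₂ γ₃ h h' p q) (G.lam γ₁ γ₂ γ₃ h h' p' q') =
      G.L.herm _ p p' * G.L.herm _ q q'
  lam_smooth : VecFam.SmoothBilin (X := T.PM3)
    (E := G.L.toVecFam.pullback fun g => cup g.1.1 g.1.2.1 g.2.1)
    (F := G.L.toVecFam.pullback fun g => cup g.1.2.1 g.1.2.2 g.2.2)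
    (G := G.L.toVecFam.pullback fun g => cup g.1.1 g.1.2.2 (g.2.1.trans g.2.2))
    fun g => G.lam g.1.1 g.1.2.1 g.1.2.2 g.2.1 g.2.2
  lam_parallel : VecFam.ParallelBilin (X := T.PM3)
    (G.ptL.pullback _ T.dSmooth_cup₁₂) (G.ptL.pullback _ T.dSmooth_cup₂₃)
    (G.ptL.pullback _ T.dSmooth_cup₁₃) fun g => G.lam g.1.1 g.1.2.1 g.1.2.2 g.2.1 g.2.2
  lam_assoc : ∀ (γ₁ γ₂ γ₃ γ₄ : DPath T.M) (h₁ : Par γ₁ γ₂) (h₂ : Par γ₂ γ₃) (h₃ : Par γ₃ γ₄) p q r,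
    G.lam γ₁ γ₃ γ₄ (h₁.trans h₂) h₃ (G.lam γ₁ γ₂ γ₃ h₁ h₂ p q) r =
      G.lam γ₁ γ₂ γ₄ h₁ (h₂.trans h₃) p (G.lam γ₂ γ₃ γ₄ h₂ h₃ q r)
  lam_symmetrizing : ∀ (γ₁ γ₂ γ₃ : DPath T.M) (h : Par γ₁ γ₂) (h' : Par γ₂ γ₃) p q,
    G.dL (cup γ₁ γ₃ (h.trans h')) (cup γ₃.rev γ₁.rev (h.trans h').symm.rev)
        (G.lam γ₁ γ₂ γ₃ h h' p q) =
      G.lam γ₃.rev γ₂.rev γ₁.rev h'.symm.rev h.symm.rev (G.dL _ _ q) (G.dL _ _ p)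
  -- the vector bundles over the path spaces
  R_connection : ∀ i j, (G.R i j).IsUnitaryConnection (G.ptR i j)
  R_superficial : ∀ i j, IsSuperficial (G.R i j).toVecFam (G.ptR i j)
  -- the fusion representation
  phi_unitary : ∀ i j γ₁ γ₂ h p q v w,
    (G.R i j).herm _ (G.phi i j γ₁ γ₂ h p v) (G.phi i j γ₁ γ₂ h q w) =
      G.L.herm _ p q * (G.R i j).herm _ v w
  phi_smooth : ∀ i j, VecFam.SmoothBilin (X := T.P2 i j)
    (E := G.L.toVecFam.pullback fun g => cup g.1.1.1 g.1.2.1 g.2)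
    (F := (G.R i j).toVecFam.pullback fun g => g.1.2)
    (G := (G.R i j).toVecFam.pullback fun g => g.1.1)
    fun g => G.phi i j g.1.1 g.1.2 g.2
  phi_parallel : ∀ i j, VecFam.ParallelBilin (X := T.P2 i j)
    (G.ptL.pullback _ dSmooth_P2cup) ((G.ptR i j).pullback _ dSmooth_P2snd)
    ((G.ptR i j).pullback _ dSmooth_P2fst) fun g => G.phi i j g.1.1 g.1.2 g.2
  -- the lifted path concatenation
  chi_smooth : ∀ i j k, VecFam.SmoothBilin (X := T.Comp i j k)
    (E := (G.R j k).toVecFam.pullback fun q => q.1.1)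
    (F := (G.R i j).toVecFam.pullback fun q => q.1.2)
    (G := (G.R i k).toVecFam.pullback conc)
    fun q => G.chi i j k q.1.2 q.1.1 q.2
  chi_parallel : ∀ i j k, VecFam.ParallelBilin (X := T.Comp i j k)
    ((G.ptR j k).pullback _ dSmooth_fst) ((G.ptR i j).pullback _ dSmooth_snd)
    ((G.ptR i k).pullback _ dSmooth_conc) fun q => G.chi i j k q.1.2 q.1.1 q.2
  -- the lifted constant paths
  eps_smooth : ∀ (i : I) (n : ℕ) (c : Eu n → T.Q i), IsPlot c →
    (G.R i i).toVecFam.IsPlot fun a => ⟨cp (c a), G.eps i (c a)⟩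
  eps_parallel : ∀ (i : I) (η : DPath (T.Q i)),
    G.ptR i i (η.map cp dSmooth_cp) (G.eps i (η 0)) = G.eps i (η 1)
  -- the lifted path reversal
  alpha_unitary : ∀ i j γ v w,
    (G.R j i).herm _ (G.alpha i j γ v) (G.alpha i j γ w) = conj ((G.R i j).herm γ v w)
  alpha_smooth : ∀ (i j : I) (n : ℕ) (c : Eu n → T.P i j) (v : ∀ a, G.R i j (c a)),
    (G.R i j).toVecFam.IsPlot (fun a => ⟨c a, v a⟩) →
      (G.R j i).toVecFam.IsPlot fun a => ⟨rev (c a), G.alpha i j (c a) (v a)⟩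
  alpha_parallel : ∀ (i j : I) (Γ : DPath (T.P i j)) (v : G.R i j (Γ 0)),
    G.ptR j i (Γ.map rev dSmooth_revP) (G.alpha i j (Γ 0) v) =
      G.alpha i j (Γ 1) (G.ptR i j Γ v)
  /-- The fusion representation is compatible with the fusion product. -/
  phi_lam : ∀ (i j : I) (γ₁ γ₂ γ₃ : T.P i j) (h : Par γ₁.1 γ₂.1) (h' : Par γ₂.1 γ₃.1) p q v,
    G.phi i j γ₁ γ₂ h p (G.phi i j γ₂ γ₃ h' q v) =
      G.phi i j γ₁ γ₃ (h.trans h') (G.lam γ₁.1 γ₂.1 γ₃.1 h h' p q) v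
  /-- The lifted path concatenation is associative. -/
  chi_assoc : ∀ (i j k l : I) (γ₁₂ : T.P i j) (γ₂₃ : T.P j k) (γ₃₄ : T.P k l)
    (h : γ₁₂.1 1 = γ₂₃.1 0) (h' : γ₂₃.1 1 = γ₃₄.1 0) (x : G.R k l γ₃₄) (y : G.R j k γ₂₃)
    (z : G.R i j γ₁₂),
    G.dR i l (comp (comp γ₃₄ γ₂₃ h') γ₁₂ (h.trans (comp_zero _ _ _).symm))
        (comp γ₃₄ (comp γ₂₃ γ₁₂ h) ((comp_one _ _ _).trans h'))
        (G.chi i j l γ₁₂ (comp γ₃₄ γ₂₃ h') (h.trans (comp_zero _ _ _).symm)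
          (G.chi j k l γ₂₃ γ₃₄ h' x y) z) =
      G.chi i k l (comp γ₂₃ γ₁₂ h) γ₃₄ ((comp_one _ _ _).trans h') x (G.chi i j k γ₁₂ γ₂₃ h y z)
  /-- Compatibility of fusion representation and lifted path concatenation. -/
  phi_chi : ∀ (i j k : I) (γ₁₂ γ₁₂' : T.P i j) (γ₂₃ γ₂₃' : T.P j k) (h : Par γ₂₃.1 γ₂₃'.1)
    (h' : Par γ₁₂.1 γ₁₂'.1) (hc : γ₁₂.1 1 = γ₂₃.1 0) (p : G.L (cup γ₂₃.1 γ₂₃'.1 h))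
    (q : G.L (cup γ₁₂.1 γ₁₂'.1 h')) (x : G.R j k γ₂₃') (y : G.R i j γ₁₂'),
    G.phi i k (comp γ₂₃ γ₁₂ hc) (comp γ₂₃' γ₁₂' (h'.2.symm.trans (hc.trans h.1)))
        (h'.comp h hc (h'.2.symm.trans (hc.trans h.1))) (G.lam' γ₂₃.1 γ₂₃'.1 γ₁₂.1 γ₁₂'.1 h h' hc p q)
        (G.chi i j k γ₁₂' γ₂₃' (h'.2.symm.trans (hc.trans h.1)) x y) =
      G.chi i j k γ₁₂ γ₂₃ hc (G.phi j k γ₂₃ γ₂₃' h p x) (G.phi i j γ₁₂ γ₁₂' h' q y)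
  /-- The lifted constant paths are units for the lifted path concatenation. -/
  chi_eps : ∀ (i j : I) (γ : T.P i j) (v : G.R i j γ),
    G.chi i i j (cp (ev₀ γ)) γ rfl v (G.eps i (ev₀ γ)) = G.dR i j γ (comp γ (cp (ev₀ γ)) rfl) v
  eps_chi : ∀ (i j : I) (γ : T.P i j) (v : G.R i j γ),
    G.chi i j j γ (cp (ev₁ γ)) rfl (G.eps j (ev₁ γ)) v = G.dR i j γ (comp (cp (ev₁ γ)) γ rfl) v
  /-- Compatibility of the lifted path reversal with the hermitian metrics. -/
  herm_left : ∀ (i j : I) (γ : T.P i j) (v w : G.R i j γ),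
    (G.R i i).herm _ (G.chi i j i γ (rev γ) (rev_zero γ).symm (G.alpha i j γ w) v)
      (G.dR i i (cp (ev₀ γ)) (comp (rev γ) γ (rev_zero γ).symm) (G.eps i (ev₀ γ))) =
        (G.R i j).herm γ v w
  herm_right : ∀ (i j : I) (γ : T.P i j) (v w : G.R i j γ),
    (G.R j j).herm _ (G.dR j j (cp (ev₁ γ)) (comp γ (rev γ) (rev_one γ)) (G.eps j (ev₁ γ)))
      (G.chi j i j (rev γ) γ (rev_one γ) w (G.alpha i j γ v)) = (G.R i j).herm γ v w
  /-- Lifted constant paths are invariant under lifted path reversal. -/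
  alpha_eps : ∀ (i : I) (x : T.Q i), G.alpha i i (cp x) (G.eps i x) = G.eps i x
  /-- Lifted path reversal is involutive. -/
  alpha_alpha : ∀ (i j : I) (γ : T.P i j) (v : G.R i j γ),
    (G.R i j).toVecFam.cast (rev_rev γ) (G.alpha j i (rev γ) (G.alpha i j γ v)) = v
  /-- Lifted path reversal is an anti-homomorphism. -/
  alpha_chi : ∀ (i j k : I) (γ₁ : T.P i j) (γ₂ : T.P j k) (h : γ₁.1 1 = γ₂.1 0)
    (x : G.R j k γ₂) (y : G.R i j γ₁),
    (G.R k i).toVecFam.cast (rev_comp γ₂ γ₁ h)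
        (G.alpha i k (comp γ₂ γ₁ h) (G.chi i j k γ₁ γ₂ h x y)) =
      G.chi k j i (rev γ₂) (rev γ₁) (by rw [rev_one, rev_zero, h])
        (G.alpha i j γ₁ y) (G.alpha j k γ₂ x)
  /-- Lifted path reversal intertwines the fusion representation. -/
  alpha_phi : ∀ (i j : I) (γ₁ γ₂ : T.P i j) (h : Par γ₁.1 γ₂.1) (p : G.L (cup γ₁.1 γ₂.1 h))
    (p' : G.L (cup γ₂.1 γ₁.1 h.symm)) (v : G.R i j γ₂), G.IsFusionDual γ₁.1 γ₂.1 h p p' →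
    G.alpha i j γ₁ (G.phi i j γ₁ γ₂ h p v) =
      G.phi j i (rev γ₁) (rev γ₂) h.rev (G.dL _ _ p') (G.alpha i j γ₂ v)
  /-- The normalization condition, for every orthonormal basis `b` of `R i j|_γ`. -/
  cardy : ∀ (i j : I) (γ : T.P i j) (n : ℕ) (b : Module.Basis (Fin n) ℂ (G.R i j γ)),
    (∀ r s, (G.R i j).herm γ (b r) (b s) = if r = s then 1 else 0) →
    ∀ v : G.R i i (cp (ev₀ γ)),
      ∑ r, G.chi j i j (rev γ) (comp γ (cp (ev₀ γ)) rfl)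
          (rev_one_comp_cp γ)
          (G.chi i i j (cp (ev₀ γ)) γ rfl (b r) v) (G.alpha i j γ (b r)) =
        (G.R i i).herm _ (G.eps i (ev₀ γ)) v •
          G.dR j j (cp (ev₁ γ)) (comp (comp γ (cp (ev₀ γ)) rfl) (rev γ)
            (rev_one_comp_cp γ)) (G.eps j (ev₁ γ))

/-! ### The induced algebras and bimodules -/

/-- The family `A i` over `Q i`: the restriction of `R i i` to constant paths. -/
abbrev A (i : I) : VecFam.{u, v} (T.Q i) := (G.R i i).toVecFam.pullback cp

/-- The multiplication on `A i` given by lifted path concatenation, and its unit. -/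
def algA (i : I) : AlgData (G.A i) := fun x =>
  ⟨(G.chi i i i (cp x) (cp x) rfl).compr₂
      ((G.R i i).toVecFam.cast (cp_comp_cp x)).toLinearMap,
    G.eps i x⟩

/-- The left multiplication `A j|_y ⊗ R i j|_γ → R i j|_γ`, for `γ` ending at `y`. -/
def lact (i j : I) (γ : T.P i j) (y : T.Q j) (h : ev₁ γ = y) :
    G.A j y →ₗ[ℂ] G.R i j γ →ₗ[ℂ] G.R i j γ :=
  (G.chi i j j γ (cp y) (congrArg Subtype.val h)).compr₂ (G.dR i j _ γ)

/-- The right multiplication `R i j|_γ ⊗ A i|_x → R i j|_γ`, for `γ` starting at `x`. -/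
def ract (i j : I) (γ : T.P i j) (x : T.Q i) (h : ev₀ γ = x) :
    G.R i j γ →ₗ[ℂ] G.A i x →ₗ[ℂ] G.R i j γ :=
  (G.chi i i j (cp x) γ (congrArg Subtype.val h).symm).compr₂ (G.dR i j _ γ)

/-- The left `ev₁^* A j`- and right `ev₀^* A i`-multiplication on `R i j`. -/
def bimod (i j : I) :
    BimodData ((G.A j).pullback ev₁) ((G.A i).pullback ev₀) (G.R i j).toVecFam :=
  fun γ => ⟨G.lact i j γ (ev₁ γ) rfl, G.ract i j γ (ev₀ γ) rfl⟩

/-- The pullback of these multiplications along a map `r : Y → P i j`, where `e₁` and `e₀` are the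
maps to end points and initial points. -/
def bimodAlong {Y : Type u} [DiffeologicalSpace Y] (i j : I) (r : Y → T.P i j) (e₁ : Y → T.Q j)
    (e₀ : Y → T.Q i) (h₁ : ∀ y, ev₁ (r y) = e₁ y) (h₀ : ∀ y, ev₀ (r y) = e₀ y) :
    BimodData ((G.A j).pullback e₁) ((G.A i).pullback e₀) ((G.R i j).toVecFam.pullback r) :=
  fun y => ⟨G.lact i j (r y) (e₁ y) (h₁ y), G.ract i j (r y) (e₀ y) (h₀ y)⟩

/-- The bundle of bimodules `p_{jk}^* R j k` over the space of composable pairs. -/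
abbrev compLeft (i j k : I) :=
  G.bimodAlong j k (fun q : T.Comp i j k => q.1.1) (fun q => ev₁ q.1.1) (fun q => ev₁ q.1.2)
    (fun _ => rfl) (fun q => Subtype.ext q.2.symm)

/-- The bundle of bimodules `p_{ij}^* R i j` over the space of composable pairs. -/
abbrev compRight (i j k : I) :=
  G.bimodAlong i j (fun q : T.Comp i j k => q.1.2) (fun q => ev₁ q.1.2) (fun q => ev₀ q.1.2)
    (fun _ => rfl) (fun _ => rfl)

/-- The bundle of bimodules `c^* R i k` over the space of composable pairs. -/
abbrev compTotal (i j k : I) :=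
  G.bimodAlong i k (conc : T.Comp i j k → T.P i k) (fun q => ev₁ q.1.1) (fun q => ev₀ q.1.2)
    (fun q => Subtype.ext (comp_one _ _ q.2)) (fun q => Subtype.ext (comp_zero _ _ q.2))

/-- The bundle over `P i j` with fibre the `A i|_x`-`A j|_y`-bimodule `R j i|_{γ̄}` over a
path `γ` from `x` to `y`. -/
abbrev revBimod (i j : I) :=
  G.bimodAlong j i (rev : T.P i j → T.P j i) ev₀ ev₁ (fun γ => Subtype.ext (rev_one γ))
    (fun γ => Subtype.ext (rev_zero γ))

end LBGData
end BraneGeometry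
end

open BraneGeometry BraneGeometry.TargetSpace

universe u v w

noncomputable section

set_option linter.unusedSectionVars false

/-! Write uv for `chi` followed by the canonical isomorphism into the fibre over a path thinly
equivalent to the concatenation; this is `mu`. Since `chi` commutes with canonical isomorphisms
(`chi_dR`) and concatenation is associative and unital up to thin homotopy, this product is
associative for every choice of representatives (`mu_assoc`) and has the units `eps`. The laws of
the algebras and bimodules, and the balancedness and equivariance of concatenation, are instances of
this associativity in which some of the paths are constant, together with the unit laws.

The substance comes from the normalization condition `cardy`. For v = ε it reads, after rescaling, 1
= ∑ b_r b'_r in A_j|_y with b_r in R_ij|_γ and b'_r in R_ji|_γ̄ (`exists_sum_mu`). The scalar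
divided by is h(ε, ε), which is nonzero because positive rank makes the algebras nonzero. Such a
partition of unity inverts concatenation on the tensor product over the middle algebra: u ↦ ∑ b_r ⊗
b'_r u (`tensorLift_bijective`, `exists_mu_inverse`). With targets c^*R_ik, A_i and A_j this gives
the fibrewise isomorphisms of (b) and (c). For the reversed path it reads 1 = ∑ c_r c'_r in A_i|_x,
so that a left linear endomorphism F of R_ij|_γ is right multiplication by ∑ c_r F(c'_r)
(`isBalancedRight`). On a constant path, with v = z* z where z* is `alpha` of z, the condition
becomes ∑ b_r z* z b_r* = h(1, z* z) 1, and h(1, z* z) is conjugate to h(z, z). Hence A_i|_x is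
simple (`isSimple`).

A bundle of bimodules needs a single typical fibre even when the base is disconnected, so transport
alone does not suffice. But a simple complex algebra of finite dimension is determined by its
dimension, and so are its modules; the algebra on the right is then recovered as the endomorphism
algebra. Thus any two fibres are isomorphic as bimodules (`Actions.exists_bimoduleIso`).

Smoothness and local triviality follow from parallelism: in the trivializations given by transport
along straight paths, parallel structure maps have constant coefficients (`apply_radial`,
`isBimoduleBundle_of_parallel`). To see that `mu` itself is parallel, the canonical isomorphisms
involved must commute with transport. They do so when they arise from a deformation of a whole
family of paths by piecewise reparametrization: the homotopy swept out by a path in the family then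
has rank two, and the second superficiality condition applies (`isNatural_of_deformation`). The
required deformations shrink away a constant path or contract γ̄ ⋆ γ to a point. -/

namespace BraneGeometry

/-! ## Simple algebras and their bimodules -/

/-- Over a simple Artinian ring, all modules are isotypic of the type of any simple left ideal. -/
theorem isIsotypicOfType_ideal {R : Type u} [Ring R] [IsSimpleRing R] [IsArtinianRing R]
    (S : Ideal R) [IsSimpleModule R S] (N : Type v) [AddCommGroup N] [Module R N] :
    IsIsotypicOfType R N S := fun m _ => by
  obtain ⟨J, ⟨e⟩⟩ := IsSemisimpleRing.exists_linearEquiv_ideal_of_isSimpleModule R m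
  have := IsSimpleModule.congr e.symm
  obtain ⟨e'⟩ := IsSimpleRing.isIsotypic R R S J
  exact ⟨e.trans e'⟩

section FibreAlgebra

variable {A : Type u} {A' : Type v} [AddCommGroup A] [Module ℂ A] [AddCommGroup A'] [Module ℂ A']

/-- Every nonzero element generates the unit as a two-sided ideal. -/
def MulOne.IsSimple (a : MulOne A) : Prop :=
  ∀ z : A, z ≠ 0 → ∃ (n : ℕ) (x y : Fin n → A), ∑ r, a.mul (a.mul (x r) z) (y r) = a.one

/-- The ring structure given by a unital associative algebra structure. -/
@[reducible]
def MulOne.IsAlgebra.ring {a : MulOne A} (ha : a.IsAlgebra) : Ring A :=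
  { (inferInstance : AddCommGroup A) with
    mul := fun x y => a.mul x y
    one := a.one
    left_distrib := fun x y z => map_add (a.mul x) y z
    right_distrib := fun x y z => by
      change a.mul (x + y) z = a.mul x z + a.mul y z
      rw [map_add]; rfl
    zero_mul := fun x => by
      change a.mul 0 x = 0
      rw [map_zero]; rfl
    mul_zero := fun x => map_zero (a.mul x)
    mul_assoc := ha.assoc
    one_mul := ha.one_mul
    mul_one := ha.mul_one }

/-- The complex algebra structure given by a unital associative algebra structure. -/
@[reducible]
def MulOne.IsAlgebra.algebra {a : MulOne A} (ha : a.IsAlgebra) :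
    @Algebra ℂ A _ ha.ring.toSemiring :=
  let _ := ha.ring
  Algebra.ofModule (fun c x y => by
      change a.mul (c • x) y = c • a.mul x y
      rw [map_smul]; rfl)
    (fun c x y => map_smul (a.mul x) c y)

/-- A two-sided ideal containing some z ≠ 0 contains the unit, which is a sum of products x z y. -/
theorem MulOne.IsSimple.isSimpleRing [Nontrivial A] {a : MulOne A} (ha : a.IsAlgebra)
    (hs : a.IsSimple) : @IsSimpleRing A (@NonAssocRing.toNonUnitalNonAssocRing A (@Ring.toNonAssocRing A ha.ring)) := by
  let _ := ha.ring
  refine ⟨⟨fun J => ?_⟩⟩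
  by_cases hJ : ∃ z ∈ J, z ≠ 0
  · right
    obtain ⟨z, hz, hz0⟩ := hJ
    obtain ⟨n, x, y, h⟩ := hs z hz0
    have h1 : (1 : A) ∈ J := by
      change a.one ∈ J
      rw [← h]
      refine sum_mem fun r _ => ?_
      exact J.mul_mem_right _ _ (J.mul_mem_left _ _ hz)
    rw [eq_top_iff]
    intro w _
    have := J.mul_mem_left w 1 h1
    rwa [mul_one] at this
  · left
    push Not at hJ
    rw [eq_bot_iff]
    intro z hz
    rw [TwoSidedIdeal.mem_bot]
    exact hJ z hz

/-- Two simple algebras of the same finite dimension are isomorphic. -/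
theorem MulOne.exists_algebraIso [Module.Finite ℂ A] [Module.Finite ℂ A'] [Nontrivial A]
    [Nontrivial A'] {a : MulOne A} {a' : MulOne A'} (ha : a.IsAlgebra) (ha' : a'.IsAlgebra)
    (hs : a.IsSimple) (hs' : a'.IsSimple)
    (hd : Module.finrank ℂ A = Module.finrank ℂ A') :
    ∃ f : A ≃ₗ[ℂ] A', (∀ x y, f (a.mul x y) = a'.mul (f x) (f y)) ∧ f a.one = a'.one := by
  let _ := ha.ring
  let _ := ha'.ring
  let _ := ha.algebra
  let _ := ha'.algebra
  have := hs.isSimpleRing ha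
  have := hs'.isSimpleRing ha'
  -- By Wedderburn's theorem over ℂ both algebras are full matrix algebras; their sizes agree
  -- because the dimension is the square of the size.
  obtain ⟨n, _, ⟨e⟩⟩ := IsSimpleRing.exists_algEquiv_matrix_of_isAlgClosed ℂ A
  obtain ⟨n', _, ⟨e'⟩⟩ := IsSimpleRing.exists_algEquiv_matrix_of_isAlgClosed ℂ A'
  have h1 : Module.finrank ℂ A = n * n := by
    rw [LinearEquiv.finrank_eq e.toLinearEquiv, Module.finrank_matrix]; simp
  have h2 : Module.finrank ℂ A' = n' * n' := by
    rw [LinearEquiv.finrank_eq e'.toLinearEquiv, Module.finrank_matrix]; simp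
  have h3 : n = n' := Nat.mul_self_inj.1 (by rw [← h1, ← h2, hd])
  subst h3
  exact ⟨(e.trans e'.symm).toLinearEquiv, fun x y => map_mul (e.trans e'.symm) x y,
    map_one (e.trans e'.symm)⟩

variable {M : Type u} {M' : Type v} [AddCommGroup M] [Module ℂ M] [AddCommGroup M'] [Module ℂ M']

/-- Modules of the same finite dimension over a simple algebra are isomorphic. -/
theorem MulOne.exists_moduleIso [Module.Finite ℂ A] [Nontrivial A] [Module.Finite ℂ M]
    [Module.Finite ℂ M'] {a : MulOne A} (ha : a.IsAlgebra) (hs : a.IsSimple)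
    (l : A →ₗ[ℂ] M →ₗ[ℂ] M) (l' : A →ₗ[ℂ] M' →ₗ[ℂ] M')
    (hl : ∀ x y z, l (a.mul x y) z = l x (l y z)) (hl1 : ∀ z, l a.one z = z)
    (hl' : ∀ x y z, l' (a.mul x y) z = l' x (l' y z)) (hl1' : ∀ z, l' a.one z = z)
    (hd : Module.finrank ℂ M = Module.finrank ℂ M') :
    ∃ θ : M ≃ₗ[ℂ] M', ∀ x z, θ (l x z) = l' x (θ z) := by
  let _ := ha.ring
  let _ := ha.algebra
  have := hs.isSimpleRing ha
  have : IsArtinianRing A := IsArtinianRing.of_finite ℂ A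
  let _ : Module A M :=
    { smul := fun x z => l x z
      one_smul := hl1
      mul_smul := hl
      smul_zero := fun x => map_zero (l x)
      smul_add := fun x => map_add (l x)
      add_smul := fun x y z => by
        change l (x + y) z = l x z + l y z
        rw [map_add]; rfl
      zero_smul := fun z => by
        change l 0 z = 0
        rw [map_zero]; rfl }
  let _ : Module A M' :=
    { smul := fun x z => l' x z
      one_smul := hl1'
      mul_smul := hl'
      smul_zero := fun x => map_zero (l' x)
      smul_add := fun x => map_add (l' x)
      add_smul := fun x y z => by
        change l' (x + y) z = l' x z + l' y z
        rw [map_add]; rfl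
      zero_smul := fun z => by
        change l' 0 z = 0
        rw [map_zero]; rfl }
  have : IsScalarTower ℂ A M := ⟨fun c x z => by
    change l (c • x) z = c • l x z
    rw [map_smul]; rfl⟩
  have : IsScalarTower ℂ A M' := ⟨fun c x z => by
    change l' (c • x) z = c • l' x z
    rw [map_smul]; rfl⟩
  have : Module.Finite A M := Module.Finite.of_restrictScalars_finite ℂ A M
  have : Module.Finite A M' := Module.Finite.of_restrictScalars_finite ℂ A M'
  -- Every finitely generated module is a power of one simple left ideal S, and the exponent is the
  -- quotient of the complex dimensions.
  obtain ⟨S, hS⟩ := IsAtomic.exists_atom (Ideal A)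
  have hS' := isSimpleModule_iff_isAtom.2 hS
  obtain ⟨n, ⟨e⟩⟩ := (isIsotypicOfType_ideal S M).linearEquiv_fun
  obtain ⟨n', ⟨e'⟩⟩ := (isIsotypicOfType_ideal S M').linearEquiv_fun
  have : Nontrivial S := IsSimpleModule.nontrivial A S
  have : Module.Finite ℂ S := Module.Finite.of_injective ((Submodule.subtype S).restrictScalars ℂ)
    Subtype.val_injective
  have hpos : 0 < Module.finrank ℂ S := Module.finrank_pos
  have h1 : Module.finrank ℂ M = n * Module.finrank ℂ S := by
    rw [LinearEquiv.finrank_eq (e.restrictScalars ℂ), Module.finrank_pi_fintype]; simp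
  have h2 : Module.finrank ℂ M' = n' * Module.finrank ℂ S := by
    rw [LinearEquiv.finrank_eq (e'.restrictScalars ℂ), Module.finrank_pi_fintype]; simp
  have h3 : n = n' := Nat.eq_of_mul_eq_mul_right hpos (by rw [← h1, ← h2, hd])
  subst h3
  exact ⟨(e.trans e'.symm).restrictScalars ℂ, fun x z => map_smul (e.trans e'.symm) x z⟩

variable {B : Type u} {B' : Type v} [AddCommGroup B] [Module ℂ B] [AddCommGroup B'] [Module ℂ B']

/-- Every endomorphism of the left module `M` is the right multiplication by a unique element. -/
def Actions.IsBalancedRight (m : Actions A B M) : Prop :=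
  ∀ T : M →ₗ[ℂ] M, (∀ x z, T (m.left x z) = m.left x (T z)) →
    ∃! y : B, ∀ z, T z = m.right z y

/-- Bimodules of the same dimension, over simple algebras of the same dimension, for which the
algebra acting on the right is the full algebra of endomorphisms, are isomorphic. -/
theorem Actions.exists_bimoduleIso [Module.Finite ℂ A] [Module.Finite ℂ A'] [Nontrivial A]
    [Nontrivial A'] [Module.Finite ℂ M] [Module.Finite ℂ M'] {a : MulOne A} {a' : MulOne A'}
    {b : MulOne B} {b' : MulOne B'} {m : Actions A B M} {m' : Actions A' B' M'}
    (ha : a.IsAlgebra) (ha' : a'.IsAlgebra) (hs : a.IsSimple) (hs' : a'.IsSimple)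
    (hdA : Module.finrank ℂ A = Module.finrank ℂ A')
    (hdM : Module.finrank ℂ M = Module.finrank ℂ M')
    (hm : m.IsBimodule a b) (hm' : m'.IsBimodule a' b')
    (hb : m.IsBalancedRight) (hb' : m'.IsBalancedRight) :
    ∃ (f : A ≃ₗ[ℂ] A') (g : B ≃ₗ[ℂ] B') (θ : M ≃ₗ[ℂ] M'),
      (∀ x y, f (a.mul x y) = a'.mul (f x) (f y)) ∧ f a.one = a'.one ∧
      (∀ x y, g (b.mul x y) = b'.mul (g x) (g y)) ∧ g b.one = b'.one ∧
      (∀ x z, θ (m.left x z) = m'.left (f x) (θ z)) ∧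
      (∀ z y, θ (m.right z y) = m'.right (θ z) (g y)) := by
  obtain ⟨f, hf, hf1⟩ := MulOne.exists_algebraIso ha ha' hs hs' hdA
  obtain ⟨θ, hθ⟩ := MulOne.exists_moduleIso ha hs m.left (m'.left.comp f.toLinearMap)
    hm.left_mul hm.left_one
    (fun x y z => by simp only [LinearMap.comp_apply, LinearEquiv.coe_coe, hf, hm'.left_mul])
    (fun z => by simp only [LinearMap.comp_apply, LinearEquiv.coe_coe, hf1, hm'.left_one]) hdM
  simp only [LinearMap.comp_apply, LinearEquiv.coe_coe] at hθ
  have hθ' : ∀ x z, θ.symm (m'.left (f x) z) = m.left x (θ.symm z) := fun x z => by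
    rw [LinearEquiv.symm_apply_eq, hθ, LinearEquiv.apply_symm_apply]
  -- Conjugating a right multiplication by θ gives an endomorphism commuting with the left action of
  -- `A'`. As f is surjective, this need only be tested on elements f x. By the balancing hypothesis
  -- the conjugate is again a right multiplication.
  have ex : ∀ y : B, ∃ y' : B', ∀ z, θ (m.right z y) = m'.right (θ z) y' := fun y => by
    obtain ⟨y', hy', -⟩ := hb' (θ.toLinearMap ∘ₗ m.right.flip y ∘ₗ θ.symm.toLinearMap)
      (fun x' z => by
        obtain ⟨x, rfl⟩ := f.surjective x'
        simp only [LinearMap.comp_apply, LinearEquiv.coe_coe, LinearMap.flip_apply, hθ', hm.comm,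
          hθ])
    exact ⟨y', fun z => by simpa using hy' (θ z)⟩
  have ex' : ∀ y' : B', ∃ y : B, ∀ z, θ (m.right z y) = m'.right (θ z) y' := fun y' => by
    obtain ⟨y, hy, -⟩ := hb (θ.symm.toLinearMap ∘ₗ m'.right.flip y' ∘ₗ θ.toLinearMap)
      (fun x z => by
        simp only [LinearMap.comp_apply, LinearEquiv.coe_coe, LinearMap.flip_apply, hθ, hm'.comm,
          hθ'])
    exact ⟨y, fun z => by rw [← hy z]; simp⟩
  have uniq : ∀ y y' : B, (∀ z, m.right z y = m.right z y') → y = y' := fun y y' h => by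
    obtain ⟨w, -, hw⟩ := hb (m.right.flip y) (fun x z => hm.comm x z y)
    rw [hw y fun z => rfl, hw y' fun z => h z]
  have uniq' : ∀ y y' : B', (∀ z, m'.right z y = m'.right z y') → y = y' := fun y y' h => by
    obtain ⟨w, -, hw⟩ := hb' (m'.right.flip y) (fun x z => hm'.comm x z y)
    rw [hw y fun z => rfl, hw y' fun z => h z]
  choose g hg using ex
  -- The element g y is pinned down by its action on `M'`, so linearity and multiplicativity of g
  -- can all be checked after acting.
  have geq : ∀ y y', (∀ z, θ (m.right z y) = m'.right (θ z) y') → g y = y' := fun y y' h =>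
    uniq' _ _ fun z => by
      obtain ⟨z, rfl⟩ := θ.surjective z
      rw [← hg, h]
  let gl : B →ₗ[ℂ] B' :=
    { toFun := g
      map_add' := fun x y => geq _ _ fun z => by rw [map_add, map_add, map_add, hg, hg]
      map_smul' := fun c x => geq _ _ fun z => by
        rw [map_smul, map_smul, map_smul, hg, RingHom.id_apply] }
  have hbij : Function.Bijective gl := by
    constructor
    · intro y y' h
      refine uniq _ _ fun z => θ.injective ?_
      change g y = g y' at h
      rw [hg, hg, h]
    · intro y'
      obtain ⟨y, hy⟩ := ex' y'
      exact ⟨y, geq _ _ hy⟩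
  refine ⟨f, LinearEquiv.ofBijective gl hbij, θ, hf, hf1, fun x y => ?_, ?_, hθ, fun z y => hg y z⟩
  · exact geq _ _ fun z => by rw [hm.right_mul, hg, hg, hm'.right_mul]; rfl
  · exact geq _ _ fun z => by rw [hm.right_one, hm'.right_one]

end FibreAlgebra

/-! ### Orthonormal bases for the fibre metrics -/

/-- A finite-dimensional space with a positive definite hermitian form has an orthonormal basis. -/
theorem exists_orthonormal_basis {V : Type u} [AddCommGroup V] [Module ℂ V] [Module.Finite ℂ V]
    (h : V →ₗ⋆[ℂ] V →ₗ[ℂ] ℂ) (hsymm : ∀ e f, conj (h e f) = h f e)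
    (hpos : ∀ e, e ≠ 0 → 0 < (h e e).re) :
    ∃ (n : ℕ) (b : Module.Basis (Fin n) ℂ V), ∀ r s, h (b r) (b s) = if r = s then 1 else 0 := by
  let core : InnerProductSpace.Core ℂ V :=
    { inner := fun x y => h x y
      conj_inner_symm := fun x y => hsymm y x
      re_inner_nonneg := fun x => by
        by_cases hx : x = 0
        · simp [hx]
        · exact (hpos x hx).le
      add_left := fun x y z => by simp
      smul_left := fun x y c => by simp
      definite := fun x hx => by
        by_contra hx0
        have := hpos x hx0
        change h x x = 0 at hx
        rw [hx] at this
        simp at this }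
  let _ : NormedAddCommGroup V := core.toNormedAddCommGroup
  let _ : InnerProductSpace ℂ V := InnerProductSpace.ofCore core.toCore
  let b := stdOrthonormalBasis ℂ V
  refine ⟨_, b.toBasis, fun r s => ?_⟩
  have := orthonormal_iff_ite.1 b.orthonormal r s
  rw [b.coe_toBasis]
  exact this

/-! ## Transport between given fibres -/

namespace VecFam

variable {X : Type u} {Y : Type w}

theorem cast_cast (E : VecFam.{u, v} X) {x y z : X} (h : x = y) (h' : y = z) (e : E x) :
    E.cast h' (E.cast h e) = E.cast (h.trans h') e := by subst h; subst h'; rfl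

theorem cast_symm_cast (E : VecFam.{u, v} X) {x y : X} (h : x = y) (e : E x) :
    E.cast h.symm (E.cast h e) = e := by subst h; rfl

variable [DiffeologicalSpace X] [DiffeologicalSpace Y]

/-- Parallel transport along a path with prescribed end points. -/
def along {E : VecFam.{u, v} X} (pt : E.Transport) (γ : DPath X) {x y : X} (h₀ : γ 0 = x)
    (h₁ : γ 1 = y) : E x ≃ₗ[ℂ] E y :=
  (E.cast h₀.symm).trans ((pt γ).trans (E.cast h₁))

variable {E F G : VecFam.{u, v} X} {ptE : E.Transport} {ptF : F.Transport} {ptG : G.Transport}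

theorem along_eq_cast (γ : DPath X) {x y : X} (h₀ : γ 0 = x) (h₁ : γ 1 = y) (e : E x) :
    along ptE γ h₀ h₁ e = E.cast h₁ (ptE γ (E.cast h₀.symm e)) := rfl

theorem along_congr {γ γ' : DPath X} (h : γ = γ') {x y : X} (h₀ : γ 0 = x) (h₁ : γ 1 = y)
    (e : E x) : along ptE γ h₀ h₁ e = along ptE γ' (h ▸ h₀) (h ▸ h₁) e := by subst h; rfl

theorem ParallelBilin.along {β : ∀ x, E x →ₗ[ℂ] F x →ₗ[ℂ] G x}
    (hβ : ParallelBilin ptE ptF ptG β) (γ : DPath X) {x y : X} (h₀ : γ 0 = x) (h₁ : γ 1 = y)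
    (e : E x) (f : F x) :
    β y (along ptE γ h₀ h₁ e) (along ptF γ h₀ h₁ f) = along ptG γ h₀ h₁ (β x e f) := by
  subst h₀; subst h₁; exact hβ γ e f

theorem IsConnection.along_comp (hE : E.IsConnection ptE) (γ₂ γ₁ : DPath X) {x y z : X}
    (h₀ : γ₁ 0 = x) (h₁ : γ₁ 1 = y) (k₀ : γ₂ 0 = y) (k₁ : γ₂ 1 = z) (e : E x) :
    along ptE γ₂ k₀ k₁ (along ptE γ₁ h₀ h₁ e) =
      along ptE (γ₂.comp γ₁ (h₁.trans k₀.symm)) ((γ₂.comp_zero γ₁ _).trans h₀)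
        ((γ₂.comp_one γ₁ _).trans k₁) e := by
  subst h₀; subst h₁; subst k₁
  change _ = E.cast _ (ptE (γ₂.comp γ₁ k₀.symm) (E.cast (γ₂.comp_zero γ₁ _).symm e))
  rw [hE.comp γ₂ γ₁ k₀.symm e]
  refine Eq.trans ?_ (E.cast_cast _ _ _).symm
  rfl

/-! ## Radial trivializations -/

theorem LocTriv.symm_cast {k n : ℕ} {c : Eu n → X} {W : Set (Eu n)} (T : LocTriv E k c W)
    {p q : Eu n} (hp : p ∈ W) (hq : q ∈ W) (h : p = q) (e : E (c p)) :
    (T.φ ⟨q, hq⟩).symm (E.cast (congrArg c h) e) = (T.φ ⟨p, hp⟩).symm e := by subst h; rfl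

theorem LocTriv.cast_apply {k n : ℕ} {c : Eu n → X} {W : Set (Eu n)} (T : LocTriv E k c W)
    {p q : Eu n} (hp : p ∈ W) (hq : q ∈ W) (h : p = q) (z : Fin k → ℂ) :
    E.cast (congrArg c h) (T.φ ⟨p, hp⟩ z) = T.φ ⟨q, hq⟩ z := by subst h; rfl

end VecFam

/-! ### Smooth step function and straight paths -/

/-- A smooth function with sitting instants, from `0` to `1`. -/
def step (t : ℝ) : ℝ := Real.smoothTransition (2 * t - 1 / 2)

theorem contDiff_step : ContDiff ℝ ∞ step :=
  Real.smoothTransition.contDiff.comp ((contDiff_const.mul contDiff_id).sub contDiff_const)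

theorem step_of_le {t : ℝ} (h : t ≤ 1 / 4) : step t = 0 :=
  Real.smoothTransition.zero_of_nonpos (by linarith)

theorem step_of_ge {t : ℝ} (h : 3 / 4 ≤ t) : step t = 1 :=
  Real.smoothTransition.one_of_one_le (by linarith)

theorem step_nonneg (t : ℝ) : 0 ≤ step t := Real.smoothTransition.nonneg _
theorem step_le_one (t : ℝ) : step t ≤ 1 := Real.smoothTransition.le_one _
theorem step_zero : step 0 = 0 := step_of_le (by norm_num)
theorem step_one : step 1 = 1 := step_of_ge (by norm_num)

/-- The straight path from `a` to `b`, with sitting instants. -/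
def straight {n : ℕ} (a b : Eu n) : DPath (Eu n) where
  toFun t := a + step t • (b - a)
  smooth := (contDiff_const.add (contDiff_step.smul contDiff_const) :
    ContDiff ℝ ∞ fun t => a + step t • (b - a)).dSmooth
  sit := by
    refine ⟨1 / 4, by norm_num, fun t ht => ?_, fun t ht => ?_⟩
    · rw [step_of_le ht, step_zero]
    · rw [step_of_ge (by linarith), step_one]

theorem straight_zero {n : ℕ} (a b : Eu n) : straight a b 0 = a := by
  change a + step 0 • (b - a) = a
  rw [step_zero]; simp

theorem straight_one {n : ℕ} (a b : Eu n) : straight a b 1 = b := by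
  change a + step 1 • (b - a) = b
  rw [step_one]; simp

theorem straight_mem_ball {n : ℕ} {a b : Eu n} {ε : ℝ} (h : b ∈ Metric.ball a ε) (t : ℝ) :
    straight a b t ∈ Metric.ball a ε := by
  rw [Metric.mem_ball, dist_eq_norm] at h ⊢
  change ‖a + step t • (b - a) - a‖ < ε
  rw [add_sub_cancel_left, norm_smul, Real.norm_eq_abs, abs_of_nonneg (step_nonneg t)]
  exact lt_of_le_of_lt (mul_le_of_le_one_left (norm_nonneg _) (step_le_one t)) h

theorem isPlot_straight {n m : ℕ} (a : Eu n) {f : Eu m → Eu n} (hf : ContDiff ℝ ∞ f) :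
    IsPlot fun b => straight a (f b) := by
  intro k g τ hg hτ
  refine ContDiff.isPlot ?_
  exact contDiff_const.add ((contDiff_step.comp hτ).smul ((hf.comp hg).sub contDiff_const))

/-! ### Smooth families of linear maps in coordinates -/

/-- A linear map into a finite-dimensional space, applied to a smooth function. -/
theorem contDiff_linearMap {m k l : ℕ} (S : (Fin k → ℂ) →ₗ[ℂ] (Fin l → ℂ))
    {z : Eu m → Fin k → ℂ} (hz : ContDiff ℝ ∞ z) : ContDiff ℝ ∞ fun b => S (z b) :=
  ((LinearMap.toContinuousLinearMap S).restrictScalars ℝ).contDiff.comp hz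

theorem contDiff_bilin {m k l r : ℕ} (S : (Fin k → ℂ) →ₗ[ℂ] (Fin l → ℂ) →ₗ[ℂ] (Fin r → ℂ))
    {z : Eu m → Fin k → ℂ} {y : Eu m → Fin l → ℂ} (hz : ContDiff ℝ ∞ z) (hy : ContDiff ℝ ∞ y) :
    ContDiff ℝ ∞ fun b => S (z b) (y b) := by
  have e : (fun b => S (z b) (y b)) =
      fun b => ∑ i, z b i • S (Pi.single i 1) (y b) := by
    funext b
    conv_lhs => rw [pi_eq_sum_univ' (z b)]
    simp [LinearMap.sum_apply]
  rw [e]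
  refine ContDiff.sum fun i _ => ?_
  exact (contDiff_pi.1 hz i).smul (contDiff_linearMap _ hy)

/-- Smoothness at each fixed vector says that the columns of the matrix are smooth; expanding the
argument in the standard basis gives joint smoothness. -/
theorem contDiff_linearFamily {m k : ℕ} (A : Eu m → (Fin k → ℂ) →ₗ[ℂ] (Fin k → ℂ))
    (hA : ∀ z, ContDiff ℝ ∞ fun b => A b z) {z : Eu m → Fin k → ℂ} (hz : ContDiff ℝ ∞ z) :
    ContDiff ℝ ∞ fun b => A b (z b) := by
  have e : (fun b => A b (z b)) = fun b => ∑ i, z b i • A b (Pi.single i 1) := by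
    funext b
    conv_lhs => rw [pi_eq_sum_univ' (z b)]
    simp
  rw [e]
  refine ContDiff.sum fun i _ => ?_
  exact (contDiff_pi.1 hz i).smul (hA _)

/-- Inversion of continuous linear equivalences is smooth. Scalars are restricted to ℝ because
smoothness is real smoothness. -/
theorem contDiff_linearFamily_symm {m k : ℕ} (A : Eu m → (Fin k → ℂ) ≃ₗ[ℂ] (Fin k → ℂ))
    (hA : ∀ z, ContDiff ℝ ∞ fun b => A b z) {z : Eu m → Fin k → ℂ} (hz : ContDiff ℝ ∞ z) :
    ContDiff ℝ ∞ fun b => (A b).symm (z b) := by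
  let B : Eu m → (Fin k → ℂ) ≃L[ℝ] (Fin k → ℂ) := fun b =>
    ((A b).restrictScalars ℝ).toContinuousLinearEquiv
  have hB : ContDiff ℝ ∞ fun b => (B b : (Fin k → ℂ) →L[ℝ] (Fin k → ℂ)) :=
    contDiff_clm_apply_iff.2 hA
  have hB' : ContDiff ℝ ∞ fun b => ((B b).symm : (Fin k → ℂ) →L[ℝ] (Fin k → ℂ)) := by
    refine contDiff_iff_contDiffAt.2 fun b => ?_
    have := (contDiffAt_map_inverse (n := ∞) (B b)).comp b hB.contDiffAt
    refine this.congr_of_eventuallyEq (Filter.Eventually.of_forall fun b' => ?_)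
    simp
  exact hB'.clm_apply hz

/-! ### Plots of the total space -/

namespace VecFam

variable {X : Type u} {E F G : VecFam.{u, v} X}

theorem IsPlot.reparam {n m : ℕ} {p : Eu n → Σ x, E x} (hp : E.IsPlot p) {f : Eu m → Eu n}
    (hf : ContDiff ℝ ∞ f) : E.IsPlot fun b => p (f b) :=
  letI := E.diff
  Diffeology.isPlot_reparam (X := Σ x, E x) hp hf

theorem isPlot_of_locally {n : ℕ} {p : Eu n → Σ x, E x}
    (h : ∀ a, ∃ W : Set (Eu n), IsOpen W ∧ a ∈ W ∧ ∀ (m : ℕ) (f : Eu m → Eu n), (∀ b, f b ∈ W) →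
      ContDiff ℝ ∞ f → E.IsPlot fun b => p (f b)) : E.IsPlot p :=
  letI := E.diff
  DiffeologicalSpace.locality (X := Σ x, E x) fun a => by
    obtain ⟨W, hW, ha, H⟩ := h a
    exact ⟨W, hW, ha, fun {m f} hf hs => H m f hf hs⟩

variable [DiffeologicalSpace X] {ptE : E.Transport} {ptF : F.Transport} {ptG : G.Transport}

/-- Parallel transport from the fibre over `c a` along the straight path from `a` to `q`. -/
def radial (ptE : E.Transport) {n : ℕ} {c : Eu n → X} (hc : Diffeology.IsPlot c) (a q : Eu n) :
    E (c a) ≃ₗ[ℂ] E (c q) :=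
  along ptE ((straight a q).map c hc.dSmooth) (congrArg c (straight_zero a q))
    (congrArg c (straight_one a q))

/-- A parallel bilinear map has constant coefficients in the radial trivializations around a. Both
the smoothness of the structure maps and their local triviality rest on this. -/
theorem ParallelBilin.apply_radial {β : ∀ x, E x →ₗ[ℂ] F x →ₗ[ℂ] G x}
    (hβ : ParallelBilin ptE ptF ptG β) {n : ℕ} {c : Eu n → X} (hc : Diffeology.IsPlot c)
    (a q : Eu n) (e : E (c a)) (f : F (c a)) :
    β (c q) (radial ptE hc a q e) (radial ptF hc a q f) = radial ptG hc a q (β (c a) e f) :=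
  hβ.along _ _ _ _ _

/-- Around every point, parallel transport along straight paths trivializes the bundle. -/
theorem IsVectorBundle.exists_radial {k : ℕ} (hE : E.IsVectorBundle k)
    (hpt : E.IsConnection ptE) {n : ℕ} {c : Eu n → X} (hc : Diffeology.IsPlot c) (a : Eu n)
    (θ : (Fin k → ℂ) ≃ₗ[ℂ] E (c a)) :
    ∃ ε₀ > 0, ∀ ε ≤ ε₀, ∃ T : LocTriv E k c (Metric.ball a ε),
      ∀ q : Metric.ball a ε, T.φ q = θ.trans (radial ptE hc a q) := by
  obtain ⟨W, hW, ha, ⟨T⟩⟩ := hE.2 n c hc a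
  obtain ⟨ε₀, hε₀, hb⟩ := Metric.isOpen_iff.1 hW a ha
  refine ⟨ε₀, hε₀, fun ε hε => ?_⟩
  have hbW : Metric.ball a ε ⊆ W := (Metric.ball_subset_ball hε).trans hb
  -- the transition functions
  have key : ∀ (m : ℕ) (f : Eu m → Eu n) (hf : ∀ b, f b ∈ Metric.ball a ε), ContDiff ℝ ∞ f →
      ∀ z, ContDiff ℝ ∞ fun b => (θ.trans ((radial ptE hc a (f b)).trans
        (T.φ ⟨f b, hbW (hf b)⟩).symm)) z := by
    intro m f hf hs z
    -- The straight paths from a to the points f b form a plot of paths in W, since balls are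
    -- star-shaped about their centre. Smoothness of the connection in the given trivialization T
    -- then makes the transition functions smooth.
    have h1 := hpt.smooth k n c hc W hW T m _ (isPlot_straight a hs)
      (fun b t => hbW (straight_mem_ball (hf b) t)) ((T.φ ⟨a, ha⟩).symm (θ z))
    refine (congrArg (ContDiff ℝ ∞) (funext fun b => ?_)).mpr h1
    simp only [LinearEquiv.trans_apply]
    change (T.φ ⟨f b, _⟩).symm (E.cast (congrArg c (straight_one a (f b)))
      (ptE ((straight a (f b)).map c hc.dSmooth)
        (E.cast (congrArg c (straight_zero a (f b)).symm) (θ z)))) = _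
    refine (T.symm_cast (hbW (straight_mem_ball (hf b) 1)) (hbW (hf b)) (straight_one a (f b))
      _).trans ?_
    congr 2
    have h2 := T.cast_apply ha (hbW (straight_mem_ball (hf b) 0)) (straight_zero a (f b)).symm
      ((T.φ ⟨a, ha⟩).symm (θ z))
    rw [LinearEquiv.apply_symm_apply] at h2
    exact h2
  refine ⟨{ φ := fun q => θ.trans (radial ptE hc a q), smooth := ?_, smooth_inv := ?_ },
    fun q => rfl⟩
  · intro m f hf hs z hz
    have h1 := contDiff_linearFamily (fun b => (θ.trans ((radial ptE hc a (f b)).trans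
        (T.φ ⟨f b, hbW (hf b)⟩).symm)).toLinearMap) (fun z => key m f hf hs z) hz
    have h2 := T.smooth m f (fun b => hbW (hf b)) hs _ h1
    simpa using h2
  · intro m f hf hs e he
    have h1 := T.smooth_inv m f (fun b => hbW (hf b)) hs e he
    have h2 := contDiff_linearFamily_symm (fun b => θ.trans ((radial ptE hc a (f b)).trans
        (T.φ ⟨f b, hbW (hf b)⟩).symm)) (fun z => key m f hf hs z) h1
    simpa using h2

theorem IsVectorBundle.nonempty_equiv {k : ℕ} (hE : E.IsVectorBundle k) (x : X) :
    Nonempty ((Fin k → ℂ) ≃ₗ[ℂ] E x) := by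
  obtain ⟨W, -, ha, ⟨T⟩⟩ := hE.2 0 (fun _ => x) isPlot_const 0
  exact ⟨T.φ ⟨0, ha⟩⟩

theorem IsVectorBundle.finite {k : ℕ} (hE : E.IsVectorBundle k) (x : X) : Module.Finite ℂ (E x) :=
  Module.Finite.equiv (hE.nonempty_equiv x).some

theorem IsVectorBundle.finrank {k : ℕ} (hE : E.IsVectorBundle k) (x : X) :
    Module.finrank ℂ (E x) = k := by
  rw [← LinearEquiv.finrank_eq (hE.nonempty_equiv x).some]; simp

/-- Parallel bilinear maps between bundles with connection are smooth. -/
theorem ParallelBilin.smoothBilin {k l r : ℕ} (hE : E.IsVectorBundle k) (hF : F.IsVectorBundle l)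
    (hG : G.IsVectorBundle r) (cE : E.IsConnection ptE) (cF : F.IsConnection ptF)
    (cG : G.IsConnection ptG) {β : ∀ x, E x →ₗ[ℂ] F x →ₗ[ℂ] G x}
    (hβ : ParallelBilin ptE ptF ptG β) : SmoothBilin β := by
  intro n c hc e f he hf
  refine isPlot_of_locally fun a => ?_
  obtain ⟨θE⟩ := hE.nonempty_equiv (c a)
  obtain ⟨θF⟩ := hF.nonempty_equiv (c a)
  obtain ⟨θG⟩ := hG.nonempty_equiv (c a)
  obtain ⟨ε₁, h₁, H₁⟩ := hE.exists_radial cE hc a θE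
  obtain ⟨ε₂, h₂, H₂⟩ := hF.exists_radial cF hc a θF
  obtain ⟨ε₃, h₃, H₃⟩ := hG.exists_radial cG hc a θG
  -- Radial trivializations exist on every smaller ball, so one radius serves all three bundles.
  let ε := min ε₁ (min ε₂ ε₃)
  have hε : 0 < ε := lt_min h₁ (lt_min h₂ h₃)
  obtain ⟨TE, hTE⟩ := H₁ ε (min_le_left _ _)
  obtain ⟨TF, hTF⟩ := H₂ ε ((min_le_right _ _).trans (min_le_left _ _))
  obtain ⟨TG, hTG⟩ := H₃ ε ((min_le_right _ _).trans (min_le_right _ _))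
  refine ⟨Metric.ball a ε, Metric.isOpen_ball, Metric.mem_ball_self hε, fun m g hg hs => ?_⟩
  have hz := TE.smooth_inv m g hg hs (fun b => e (g b)) (he.reparam hs)
  have hy := TF.smooth_inv m g hg hs (fun b => f (g b)) (hf.reparam hs)
  -- In these trivializations β becomes the constant bilinear map read off over the centre a.
  have h4 := TG.smooth m g hg hs _ (contDiff_bilin
    ((((β (c a)).comp θE.toLinearMap).compl₂ θF.toLinearMap).compr₂ θG.symm.toLinearMap) hz hy)
  convert h4 using 3 with b
  have e1 : e (g b) = radial ptE hc a (g b) (θE ((TE.φ ⟨g b, hg b⟩).symm (e (g b)))) := by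
    simp only [hTE, LinearEquiv.trans_apply, LinearEquiv.apply_symm_apply, LinearEquiv.trans_symm]
  have e2 : f (g b) = radial ptF hc a (g b) (θF ((TF.φ ⟨g b, hg b⟩).symm (f (g b)))) := by
    simp only [hTF, LinearEquiv.trans_apply, LinearEquiv.apply_symm_apply, LinearEquiv.trans_symm]
  conv_lhs => rw [e1, e2]
  rw [hβ.apply_radial hc a (g b), hTG]
  simp

end VecFam

/-! ## Pullbacks of bundles and connections -/

/-- The pullback of a differential form. -/
def DForm.pullback {X : Type u} {Y : Type w} [DiffeologicalSpace X] [DiffeologicalSpace Y] {k : ℕ}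
    (η : DForm X k) (f : Y → X) (hf : DSmooth f) : DForm Y k where
  toFun p hp := η.toFun (f ∘ p) (hf _ _ hp)
  smooth p hp := η.smooth (f ∘ p) (hf _ _ hp)
  compat p hp g hg a := η.compat (f ∘ p) (hf _ _ hp) g hg a

/-- A form on X evaluated on f ∘ p is its pullback along f evaluated on p, so composing with a
smooth map cannot raise the rank. This lets thin homotopies be pushed forward, and connections be
pulled back. -/
theorem PlotRankLE.comp {X : Type u} {Y : Type w} [DiffeologicalSpace X] [DiffeologicalSpace Y]
    {k n : ℕ} {p : Eu n → Y} (h : PlotRankLE k p) {f : Y → X} (hf : DSmooth f) :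
    PlotRankLE k fun a => f (p a) := by
  obtain ⟨hp, h⟩ := h
  exact ⟨hf _ _ hp, fun η => h (η.pullback f hf)⟩

theorem DPath.dSmooth_map {X : Type u} {Y : Type w} [DiffeologicalSpace X] [DiffeologicalSpace Y]
    {f : Y → X} (hf : DSmooth f) : DSmooth fun γ : DPath Y => γ.map f hf :=
  fun _ _ hp m g τ hg hτ => hf _ _ (hp m g τ hg hτ)

theorem ThinHomotopic.map {X : Type u} {Y : Type w} [DiffeologicalSpace X] [DiffeologicalSpace Y]
    {γ γ' : DPath Y} (h : ThinHomotopic γ γ') {f : Y → X} (hf : DSmooth f) :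
    ThinHomotopic (γ.map f hf) (γ'.map f hf) := by
  obtain ⟨H, h0, h1, k0, k1, hr⟩ := h
  exact ⟨H.map _ (DPath.dSmooth_map hf), congrArg (fun γ => γ.map f hf) h0,
    congrArg (fun γ => γ.map f hf) h1, fun s => ⟨congrArg f (k0 s).1, congrArg f (k0 s).2⟩,
    fun s => ⟨congrArg f (k1 s).1, congrArg f (k1 s).2⟩, hr.comp hf⟩

namespace VecFam

theorem eq_cast_symm {X : Type u} (E : VecFam.{u, v} X) {x y : X} (h : x = y) {e : E x} {e' : E y}
    (he : e' = E.cast h e) : e = E.cast h.symm e' := by subst h; exact he.symm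

section Pullback

variable {X : Type u} {Y : Type w} [DiffeologicalSpace X] [DiffeologicalSpace Y]
  {E F G : VecFam.{u, v} X} {ptE : E.Transport} {ptF : F.Transport} {ptG : G.Transport}

theorem isPlot_pullback_iff {f : Y → X} {n : ℕ} {p : Eu n → Σ y, E (f y)} :
    (E.pullback f).IsPlot p ↔
      Diffeology.IsPlot (fun b => (p b).1) ∧ E.IsPlot fun b => ⟨f (p b).1, (p b).2⟩ :=
  letI := E.diff
  @DiffeologicalSpace.isPlot_inf_iff (Σ y, E (f y)) (inducedDiff (fun p : Σ y, E (f y) => p.1))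
    (inducedDiff (fun p : Σ y, E (f y) => (⟨f p.1, p.2⟩ : Σ x, E x))) n p

/-- A local trivialization of a pullback is one of the original bundle. -/
def LocTriv.ofPullback {f : Y → X} {k n : ℕ} {c : Eu n → Y} (hc : Diffeology.IsPlot c)
    {W : Set (Eu n)} (T : LocTriv (E.pullback f) k c W) : LocTriv E k (fun b => f (c b)) W where
  φ := T.φ
  smooth m g hg hs z hz := (isPlot_pullback_iff.1 (T.smooth m g hg hs z hz)).2
  smooth_inv m g hg hs e he := T.smooth_inv m g hg hs e
    (isPlot_pullback_iff.2 ⟨Diffeology.isPlot_reparam hc hs, he⟩)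

/-- A local trivialization induces one of the pullback. -/
def LocTriv.pullback {f : Y → X} {k n : ℕ} {c : Eu n → Y} (hc : Diffeology.IsPlot c)
    {W : Set (Eu n)} (T : LocTriv E k (fun b => f (c b)) W) : LocTriv (E.pullback f) k c W where
  φ := T.φ
  smooth m g hg hs z hz :=
    isPlot_pullback_iff.2 ⟨Diffeology.isPlot_reparam hc hs, T.smooth m g hg hs z hz⟩
  smooth_inv m g hg hs e he := T.smooth_inv m g hg hs e (isPlot_pullback_iff.1 he).2

theorem IsVectorBundle.pullback {k : ℕ} (hE : E.IsVectorBundle k) {f : Y → X} (hf : DSmooth f) :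
    (E.pullback f).IsVectorBundle k := by
  refine ⟨fun n p hp => (isPlot_pullback_iff (E := E) (f := f).1 hp).1, fun n c hc a => ?_⟩
  obtain ⟨W, hW, ha, ⟨T⟩⟩ := hE.2 n (fun b => f (c b)) (hf _ _ hc) a
  exact ⟨W, hW, ha, ⟨T.pullback hc⟩⟩

theorem IsConnection.pullback (hE : E.IsConnection ptE) {f : Y → X} (hf : DSmooth f) :
    (E.pullback f).IsConnection (ptE.pullback f hf) where
  thin γ γ' h h₀ h₁ z := by
    have := hE.thin _ _ (h.map hf) (congrArg f h₀) (congrArg f h₁) z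
    have hcast : ∀ {y y' : Y} (h : y = y') (e : E (f y)),
        (E.pullback f).cast h e = E.cast (congrArg f h) e := by
      intro y y' h e; subst h; rfl
    rw [hcast, hcast]
    exact this
  comp γ₂ γ₁ h z := by
    have hcast : ∀ {y y' : Y} (h : y = y') (e : E (f y)),
        (E.pullback f).cast h e = E.cast (congrArg f h) e := by
      intro y y' h e; subst h; rfl
    rw [hcast, hcast, hcast]
    have h' : (γ₂.map f hf).comp (γ₁.map f hf) (congrArg f h) = (γ₂.comp γ₁ h).map f hf :=
      DPath.ext (funext fun t => by
        change (if t ≤ 1 / 2 then f (γ₁ (2 * t)) else f (γ₂ (2 * t - 1))) =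
          f (if t ≤ 1 / 2 then γ₁ (2 * t) else γ₂ (2 * t - 1))
        split_ifs <;> rfl)
    have key := (hE.along_comp (γ₂.map f hf) (γ₁.map f hf) rfl rfl (congrArg f h.symm) rfl z).trans
      (along_congr h' _ _ _)
    change E.cast rfl (ptE (γ₂.map f hf) _) = E.cast _ (ptE _ (E.cast _ z)) at key
    change ptE ((γ₂.comp γ₁ h).map f hf) (E.cast _ z) = E.cast _ (ptE (γ₂.map f hf) _)
    exact E.eq_cast_symm _ key
  smooth k n c hc W hW T m g hg hgW z :=
    hE.smooth k n (fun b => f (c b)) (hf _ _ hc) W hW (T.ofPullback hc) m g hg hgW z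

theorem ParallelBilin.pullback {β : ∀ x, E x →ₗ[ℂ] F x →ₗ[ℂ] G x}
    (hβ : ParallelBilin ptE ptF ptG β) {f : Y → X} (hf : DSmooth f) :
    ParallelBilin (ptE.pullback f hf) (ptF.pullback f hf) (ptG.pullback f hf)
      (fun y => β (f y)) := fun γ => hβ (γ.map f hf)

end Pullback

/-! ### Sums, and sections of bundles -/

variable {X : Type u} [DiffeologicalSpace X] {E F : VecFam.{u, v} X} {ptE : E.Transport}
  {ptF : F.Transport}

theorem IsVectorBundle.isPlot_sum {k : ℕ} (hE : E.IsVectorBundle k) {n s : ℕ} {c : Eu n → X}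
    (hc : Diffeology.IsPlot c) {e : Fin s → ∀ b, E (c b)}
    (he : ∀ l, E.IsPlot fun b => ⟨c b, e l b⟩) : E.IsPlot fun b => ⟨c b, ∑ l, e l b⟩ := by
  refine isPlot_of_locally fun a => ?_
  obtain ⟨W, hW, ha, ⟨T⟩⟩ := hE.2 n c hc a
  refine ⟨W, hW, ha, fun m f hf hs => ?_⟩
  have h := T.smooth m f hf hs (fun b => ∑ l, (T.φ ⟨f b, hf b⟩).symm (e l (f b)))
    (ContDiff.sum fun l _ => T.smooth_inv m f hf hs (fun b => e l (f b)) ((he l).reparam hs))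
  simpa using h

/-- A parallel section is constant in a radial trivialization. -/
theorem IsVectorBundle.isPlot_of_parallel {k : ℕ} (hE : E.IsVectorBundle k)
    (cE : E.IsConnection ptE) {s : ∀ x, E x} (hs : ∀ γ : DPath X, ptE γ (s (γ 0)) = s (γ 1))
    {n : ℕ} {c : Eu n → X} (hc : Diffeology.IsPlot c) : E.IsPlot fun b => ⟨c b, s (c b)⟩ := by
  refine isPlot_of_locally fun a => ?_
  obtain ⟨θ⟩ := hE.nonempty_equiv (c a)
  obtain ⟨ε, hε, H⟩ := hE.exists_radial cE hc a θ
  obtain ⟨T, hT⟩ := H ε le_rfl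
  refine ⟨_, Metric.isOpen_ball, Metric.mem_ball_self hε, fun m f hf hsm => ?_⟩
  have h := T.smooth m f hf hsm (fun _ => θ.symm (s (c a))) contDiff_const
  have along_s : ∀ (γ : DPath X) {x y : X} (h₀ : γ 0 = x) (h₁ : γ 1 = y),
      along ptE γ h₀ h₁ (s x) = s y := by
    intro γ x y h₀ h₁; subst h₀; subst h₁; exact hs γ
  convert h using 3 with b
  rw [hT, LinearEquiv.trans_apply, LinearEquiv.apply_symm_apply]
  exact (along_s _ _ _).symm

end VecFam

/-! ## Bundles of bimodules from parallel structures -/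

section Typical

variable {V : Type u} {A : Type v} [AddCommGroup V] [Module ℂ V] [AddCommGroup A] [Module ℂ A]

/-- The structure on `V` for which `θ` is an isomorphism. -/
def MulOne.induced (a : MulOne A) (θ : V ≃ₗ[ℂ] A) : MulOne V :=
  ⟨((a.mul.comp θ.toLinearMap).compl₂ θ.toLinearMap).compr₂ θ.symm.toLinearMap, θ.symm a.one⟩

theorem MulOne.induced_mul (a : MulOne A) (θ : V ≃ₗ[ℂ] A) (x y : V) :
    (a.induced θ).mul x y = θ.symm (a.mul (θ x) (θ y)) := rfl

theorem MulOne.IsAlgebra.induced {a : MulOne A} (ha : a.IsAlgebra) (θ : V ≃ₗ[ℂ] A) :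
    (a.induced θ).IsAlgebra where
  assoc x y z := by simp only [induced_mul, LinearEquiv.apply_symm_apply, ha.assoc]
  one_mul x := by
    rw [induced_mul]
    change θ.symm (a.mul (θ (θ.symm a.one)) (θ x)) = x
    rw [LinearEquiv.apply_symm_apply, ha.one_mul, LinearEquiv.symm_apply_apply]
  mul_one x := by
    rw [induced_mul]
    change θ.symm (a.mul (θ x) (θ (θ.symm a.one))) = x
    rw [LinearEquiv.apply_symm_apply, ha.mul_one, LinearEquiv.symm_apply_apply]

variable {V' V'' : Type u} {B M : Type v} [AddCommGroup V'] [Module ℂ V'] [AddCommGroup V'']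
  [Module ℂ V''] [AddCommGroup B] [Module ℂ B] [AddCommGroup M] [Module ℂ M]

/-- The actions on `V''` corresponding to those on `M` under given isomorphisms. -/
def Actions.induced (m : Actions A B M) (θA : V ≃ₗ[ℂ] A) (θB : V' ≃ₗ[ℂ] B) (θ : V'' ≃ₗ[ℂ] M) :
    Actions V V' V'' :=
  ⟨((m.left.comp θA.toLinearMap).compl₂ θ.toLinearMap).compr₂ θ.symm.toLinearMap,
    ((m.right.comp θ.toLinearMap).compl₂ θB.toLinearMap).compr₂ θ.symm.toLinearMap⟩

theorem Actions.induced_left (m : Actions A B M) (θA : V ≃ₗ[ℂ] A) (θB : V' ≃ₗ[ℂ] B)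
    (θ : V'' ≃ₗ[ℂ] M) (x : V) (z : V'') :
    (m.induced θA θB θ).left x z = θ.symm (m.left (θA x) (θ z)) := rfl

theorem Actions.induced_right (m : Actions A B M) (θA : V ≃ₗ[ℂ] A) (θB : V' ≃ₗ[ℂ] B)
    (θ : V'' ≃ₗ[ℂ] M) (z : V'') (y : V') :
    (m.induced θA θB θ).right z y = θ.symm (m.right (θ z) (θB y)) := rfl

theorem Actions.IsBimodule.induced {a : MulOne A} {b : MulOne B} {m : Actions A B M}
    (hm : m.IsBimodule a b) (θA : V ≃ₗ[ℂ] A) (θB : V' ≃ₗ[ℂ] B) (θ : V'' ≃ₗ[ℂ] M) :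
    (m.induced θA θB θ).IsBimodule (a.induced θA) (b.induced θB) where
  left_mul x y z := by
    simp only [MulOne.induced_mul, induced_left, LinearEquiv.apply_symm_apply, hm.left_mul]
  left_one z := by
    rw [induced_left]
    change θ.symm (m.left (θA (θA.symm a.one)) _) = z
    rw [LinearEquiv.apply_symm_apply, hm.left_one, LinearEquiv.symm_apply_apply]
  right_mul x y z := by
    simp only [MulOne.induced_mul, induced_right, LinearEquiv.apply_symm_apply, hm.right_mul]
  right_one z := by
    rw [induced_right]
    change θ.symm (m.right _ (θB (θB.symm b.one))) = z
    rw [LinearEquiv.apply_symm_apply, hm.right_one, LinearEquiv.symm_apply_apply]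
  comm x z y := by
    simp only [induced_left, induced_right, LinearEquiv.apply_symm_apply, hm.comm]

end Typical

open VecFam in
/-- Fibrewise bimodules with parallel structure maps, any two of which are isomorphic, form a
bundle of bimodules. -/
theorem isBimoduleBundle_of_parallel {X : Type u} [DiffeologicalSpace X] {A B M : VecFam.{u, v} X}
    {ka kb km : ℕ} (vA : A.IsVectorBundle ka) (vB : B.IsVectorBundle kb) (vM : M.IsVectorBundle km)
    {ptA : A.Transport} {ptB : B.Transport} {ptM : M.Transport}
    (cA : A.IsConnection ptA) (cB : B.IsConnection ptB) (cM : M.IsConnection ptM)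
    {a : AlgData A} {b : AlgData B} {m : BimodData A B M}
    (ha : ∀ x, (a x).IsAlgebra) (hb : ∀ x, (b x).IsAlgebra)
    (hm : ∀ x, (m x).IsBimodule (a x) (b x))
    (pa : ParallelBilin ptA ptA ptA fun x => (a x).mul)
    (pa₁ : ∀ γ : DPath X, ptA γ (a (γ 0)).one = (a (γ 1)).one)
    (pb : ParallelBilin ptB ptB ptB fun x => (b x).mul)
    (pb₁ : ∀ γ : DPath X, ptB γ (b (γ 0)).one = (b (γ 1)).one)
    (pl : ParallelBilin ptA ptM ptM fun x => (m x).left)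
    (pr : ParallelBilin ptM ptB ptM fun x => (m x).right)
    (iso : ∀ x x', ∃ (f : A x ≃ₗ[ℂ] A x') (g : B x ≃ₗ[ℂ] B x') (θ : M x ≃ₗ[ℂ] M x'),
      (∀ y z, f ((a x).mul y z) = (a x').mul (f y) (f z)) ∧ f (a x).one = (a x').one ∧
      (∀ y z, g ((b x).mul y z) = (b x').mul (g y) (g z)) ∧ g (b x).one = (b x').one ∧
      (∀ y z, θ ((m x).left y z) = (m x').left (f y) (θ z)) ∧
      (∀ z y, θ ((m x).right z y) = (m x').right (θ z) (g y))) :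
    IsBimoduleBundle a b M m := by
  have along_one : ∀ {C : VecFam.{u, v} X} {ptC : C.Transport} (s : ∀ x, C x)
      (_ : ∀ γ : DPath X, ptC γ (s (γ 0)) = s (γ 1)) (γ : DPath X) {x y : X} (h₀ : γ 0 = x)
      (h₁ : γ 1 = y), along ptC γ h₀ h₁ (s x) = s y := by
    intro C ptC s hs γ x y h₀ h₁; subst h₀; subst h₁; exact hs γ
  have triv : ∃ (ka kb km : ℕ) (a₀ : MulOne (Fin ka → ℂ)) (b₀ : MulOne (Fin kb → ℂ))
    (m₀ : Actions (Fin ka → ℂ) (Fin kb → ℂ) (Fin km → ℂ)),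
    A.IsVectorBundle ka ∧ B.IsVectorBundle kb ∧
    M.IsVectorBundle km ∧ a₀.IsAlgebra ∧ b₀.IsAlgebra ∧ m₀.IsBimodule a₀ b₀ ∧
    ∀ (n : ℕ) (c : Eu n → X), IsPlot c → ∀ p : Eu n, ∃ W : Set (Eu n), IsOpen W ∧ p ∈ W ∧
      ∃ (TA : A.LocTriv ka c W) (TB : B.LocTriv kb c W) (TM : M.LocTriv km c W), ∀ q : W,
        (∀ x y, TA.φ q (a₀.mul x y) = (a (c q)).mul (TA.φ q x) (TA.φ q y)) ∧
        TA.φ q a₀.one = (a (c q)).one ∧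
        (∀ x y, TB.φ q (b₀.mul x y) = (b (c q)).mul (TB.φ q x) (TB.φ q y)) ∧
        TB.φ q b₀.one = (b (c q)).one ∧
        (∀ x z, TM.φ q (m₀.left x z) = (m (c q)).left (TA.φ q x) (TM.φ q z)) ∧
        (∀ z y, TM.φ q (m₀.right z y) = (m (c q)).right (TM.φ q z) (TB.φ q y)) := by
    rcases isEmpty_or_nonempty X with hX | ⟨⟨x₀⟩⟩
    -- Over an empty base there is no fibre from which to take a typical algebra. Every rank is
    -- vacuously correct there, and the zero spaces carry the required structures.
    · have hv : ∀ {C : VecFam.{u, v} X} {k : ℕ}, C.IsVectorBundle k → C.IsVectorBundle 0 :=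
        fun h => ⟨h.1, fun n c _ _ => isEmptyElim (c 0)⟩
      refine ⟨0, 0, 0, ⟨0, 0⟩, ⟨0, 0⟩, ⟨0, 0⟩, hv vA, hv vB, hv vM, ⟨?_, ?_, ?_⟩, ⟨?_, ?_, ?_⟩,
        ⟨?_, ?_, ?_, ?_, ?_⟩, fun n c _ _ => isEmptyElim (c 0)⟩
      all_goals intros; exact Subsingleton.elim _ _
    · obtain ⟨θA⟩ := vA.nonempty_equiv x₀
      obtain ⟨θB⟩ := vB.nonempty_equiv x₀
      obtain ⟨θM⟩ := vM.nonempty_equiv x₀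
      refine ⟨ka, kb, km, (a x₀).induced θA, (b x₀).induced θB, (m x₀).induced θA θB θM, vA, vB, vM,
        (ha x₀).induced θA, (hb x₀).induced θB, (hm x₀).induced θA θB θM, fun n c hc p => ?_⟩
      -- The typical fibre is the one over x₀. It is compared with the fibre over the centre of the
      -- ball by an abstract isomorphism, as no path from x₀ need exist, and spread from there by
      -- radial transport.
      obtain ⟨f, g, θ, hf, hf₁, hg, hg₁, hl, hr⟩ := iso x₀ (c p)
      obtain ⟨ε₁, h₁, H₁⟩ := vA.exists_radial cA hc p (θA.trans f)
      obtain ⟨ε₂, h₂, H₂⟩ := vB.exists_radial cB hc p (θB.trans g)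
      obtain ⟨ε₃, h₃, H₃⟩ := vM.exists_radial cM hc p (θM.trans θ)
      let ε := min ε₁ (min ε₂ ε₃)
      have hε : 0 < ε := lt_min h₁ (lt_min h₂ h₃)
      obtain ⟨TA, hTA⟩ := H₁ ε (min_le_left _ _)
      obtain ⟨TB, hTB⟩ := H₂ ε ((min_le_right _ _).trans (min_le_left _ _))
      obtain ⟨TM, hTM⟩ := H₃ ε ((min_le_right _ _).trans (min_le_right _ _))
      refine ⟨Metric.ball p ε, Metric.isOpen_ball, Metric.mem_ball_self hε, TA, TB, TM,
        fun q => ?_⟩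
      rw [hTA, hTB, hTM]
      simp only [LinearEquiv.trans_apply, MulOne.induced_mul, Actions.induced_left,
        Actions.induced_right, LinearEquiv.apply_symm_apply, hf, hg, hl, hr]
      refine ⟨fun x y => (pa.apply_radial hc p q _ _).symm, ?_,
        fun x y => (pb.apply_radial hc p q _ _).symm, ?_,
        fun x y => (pl.apply_radial hc p q _ _).symm, fun x y => (pr.apply_radial hc p q _ _).symm⟩
      · change radial ptA hc p q (f (θA (θA.symm (a x₀).one))) = _
        rw [LinearEquiv.apply_symm_apply, hf₁]
        exact along_one (fun x => (a x).one) pa₁ _ _ _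
      · change radial ptB hc p q (g (θB (θB.symm (b x₀).one))) = _
        rw [LinearEquiv.apply_symm_apply, hg₁]
        exact along_one (fun x => (b x).one) pb₁ _ _ _
  obtain ⟨la, lb, lm, a₀, b₀, m₀, wA, wB, wM, ha₀, hb₀, hm₀, H⟩ := triv
  refine ⟨⟨hm, pl.smoothBilin vA vM vM cA cM cM, pr.smoothBilin vM vB vM cM cB cM⟩,
    ⟨⟨ha, pa.smoothBilin vA vA vA cA cA cA, fun n c hc => vA.isPlot_of_parallel (s := fun x => (a x).one) cA pa₁ hc⟩,
      la, a₀, wA, ha₀, fun n c hc p => ?_⟩,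
    ⟨⟨hb, pb.smoothBilin vB vB vB cB cB cB, fun n c hc => vB.isPlot_of_parallel (s := fun x => (b x).one) cB pb₁ hc⟩,
      lb, b₀, wB, hb₀, fun n c hc p => ?_⟩,
    ⟨la, lb, lm, a₀, b₀, m₀, wM, ha₀, hb₀, hm₀, H⟩⟩
  · obtain ⟨W, hW, hp, TA, TB, TM, h⟩ := H n c hc p
    exact ⟨W, hW, hp, TA, fun q => ⟨(h q).1, (h q).2.1⟩⟩
  · obtain ⟨W, hW, hp, TA, TB, TM, h⟩ := H n c hc p
    exact ⟨W, hW, hp, TB, fun q => ⟨(h q).2.2.1, (h q).2.2.2.1⟩⟩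

/-! ## Tensor products over algebra bundles -/

section TensorIso

open scoped TensorProduct
open VecFam

variable {X : Type u} [DiffeologicalSpace X] {A B C M N G : VecFam.{u, v} X}

theorem tmulB_balanced (m : BimodData A B M) (n : BimodData B C N) (x : X) (y : M x) (r : B x)
    (z : N x) : tmulB m n x ((m x).right y r) z = tmulB m n x y ((n x).left r z) :=
  (Submodule.Quotient.eq _).2 (Submodule.subset_span ⟨y, r, z, rfl⟩)

/-- The class of a tensor, as a bilinear map. -/
def tmulBilin (m : BimodData A B M) (n : BimodData B C N) (x : X) :
    M x →ₗ[ℂ] N x →ₗ[ℂ] tensorB m n x :=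
  (TensorProduct.mk ℂ (M x) (N x)).compr₂ (balancing m n x).mkQ

theorem tmulBilin_apply (m : BimodData A B M) (n : BimodData B C N) (x : X) (y : M x) (z : N x) :
    tmulBilin m n x y z = tmulB m n x y z := rfl

theorem tensorB_induction {m : BimodData A B M} {n : BimodData B C N} {x : X}
    {p : tensorB m n x → Prop} (t : tensorB m n x) (h : ∀ y z, p (tmulB m n x y z)) (h0 : p 0)
    (hadd : ∀ s t, p s → p t → p (s + t)) : p t := by
  obtain ⟨t, rfl⟩ := (balancing m n x).mkQ_surjective t
  induction t using TensorProduct.induction_on with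
  | zero => rw [map_zero]; exact h0
  | tmul y z => exact h y z
  | add s t hs ht => rw [map_add]; exact hadd _ _ hs ht

/-- The linear map on `M ⊗_B N` induced by a balanced bilinear map. -/
def tensorLift (m : BimodData A B M) (n : BimodData B C N) (x : X)
    (β : M x →ₗ[ℂ] N x →ₗ[ℂ] G x)
    (h : ∀ y r z, β ((m x).right y r) z = β y ((n x).left r z)) : tensorB m n x →ₗ[ℂ] G x :=
  (balancing m n x).liftQ (TensorProduct.lift β) (Submodule.span_le.2 fun t ht => by
    obtain ⟨y, r, z, rfl⟩ := ht
    change TensorProduct.lift β _ = 0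
    rw [map_sub, TensorProduct.lift.tmul, TensorProduct.lift.tmul, h, sub_self])

theorem tensorLift_tmulB (m : BimodData A B M) (n : BimodData B C N) (x : X)
    (β : M x →ₗ[ℂ] N x →ₗ[ℂ] G x) (h) (y : M x) (z : N x) :
    tensorLift m n x β h (tmulB m n x y z) = β y z := rfl

/-- A balanced bilinear map which has a right inverse given by a partition of unity
`∑ b_r s_r(w) = w` of the right module `M x` induces an isomorphism on `M ⊗_B N`. -/
theorem tensorLift_bijective (m : BimodData A B M) (n : BimodData B C N) (x : X)
    (β : M x →ₗ[ℂ] N x →ₗ[ℂ] G x) (h) {s : ℕ} (b : Fin s → M x) (p : Fin s → G x →ₗ[ℂ] N x)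
    (σ : Fin s → M x → B x) (h₁ : ∀ u, ∑ r, β (b r) (p r u) = u)
    (h₂ : ∀ w, ∑ r, (m x).right (b r) (σ r w) = w)
    (h₃ : ∀ r w z, p r (β w z) = (n x).left (σ r w) z) :
    Function.Bijective (tensorLift m n x β h) := by
  let inv : G x →ₗ[ℂ] tensorB m n x := ∑ r, (tmulBilin m n x (b r)).comp (p r)
  have hinv : ∀ u, inv u = ∑ r, tmulB m n x (b r) (p r u) := fun u => by
    simp only [inv, LinearMap.sum_apply, LinearMap.comp_apply]
    rfl
  have left : ∀ t, inv (tensorLift m n x β h t) = t := fun t => by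
    induction t using tensorB_induction with
    | h y z =>
      rw [tensorLift_tmulB, hinv]
      -- On a generator the composite is ∑ b_r ⊗ σ_r(y) z = ∑ b_r σ_r(y) ⊗ z = y ⊗ z.
      simp only [h₃, ← tmulB_balanced]
      conv_rhs => rw [← h₂ y]
      simp only [← tmulBilin_apply, map_sum, LinearMap.sum_apply]
    | h0 => rw [map_zero, map_zero]
    | hadd s t hs ht => rw [map_add, map_add, hs, ht]
  have right : ∀ u, tensorLift m n x β h (inv u) = u := fun u => by
    rw [hinv, map_sum]
    exact h₁ u
  exact Function.bijective_iff_has_inverse.2 ⟨inv, left, right⟩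

variable {ptM : M.Transport} {ptN : N.Transport} {ptG : G.Transport}

theorem dSmooth_tensor_of_smoothBilin {k : ℕ} (vG : G.IsVectorBundle k) {m : BimodData A B M}
    {n : BimodData B C N} {β : ∀ x, M x →ₗ[ℂ] N x →ₗ[ℂ] G x} (hβ : SmoothBilin β)
    (e : ∀ x, tensorB m n x →ₗ[ℂ] G x) (he : ∀ x y z, e x (tmulB m n x y z) = β x y z) :
    @DSmooth _ _ (tensorB m n).diff G.diff
      (fun p => (⟨p.1, e p.1 p.2⟩ : Σ x, G x)) := by
  intro l p hp
  -- The generated diffeology is contained in every diffeology containing the generating plots.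
  -- Applied to the pullback of the diffeology of G along e, this reduces the claim to finite sums
  -- of tensors.
  refine hp (@inducedDiff _ _ G.diff (fun p : Σ x, tensorB m n x => (⟨p.1, e p.1 p.2⟩ : Σ x, G x)))
    ?_
  rintro ⟨l, q⟩ ⟨c, hc, s, y, z, hy, hz, hq⟩
  dsimp only at c hc y z hy hz hq
  have h := vG.isPlot_sum hc (e := fun i b => β (c b) (y i b) (z i b))
    fun i => hβ l c hc _ _ (hy i) (hz i)
  change G.IsPlot fun b => ⟨(q b).1, e (q b).1 (q b).2⟩
  rw [hq]
  simpa only [map_sum, he] using h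

/-- A plot of G must be lifted locally to a finite sum of tensors of plots. A lift with linear
coefficients is chosen over one point only; because β is parallel, the same coefficients work over a
whole ball in radial frames. -/
theorem dSmooth_tensor_symm {k l s : ℕ} (vM : M.IsVectorBundle k) (vN : N.IsVectorBundle l)
    (vG : G.IsVectorBundle s) (cM : M.IsConnection ptM) (cN : N.IsConnection ptN)
    (cG : G.IsConnection ptG) {m : BimodData A B M} {n : BimodData B C N}
    {β : ∀ x, M x →ₗ[ℂ] N x →ₗ[ℂ] G x} (hβ : ParallelBilin ptM ptN ptG β)
    (e : ∀ x, tensorB m n x ≃ₗ[ℂ] G x) (he : ∀ x y z, e x (tmulB m n x y z) = β x y z) :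
    @DSmooth _ _ G.diff (tensorB m n).diff
      (fun p => (⟨p.1, (e p.1).symm p.2⟩ : Σ x, tensorB m n x)) := by
  intro d p hp
  have hc : Diffeology.IsPlot fun b => (p b).1 := vG.1 d p hp
  refine isPlot_of_locally (E := tensorB m n) fun a => ?_
  set c : Eu d → X := fun b => (p b).1 with hcdef
  obtain ⟨θM⟩ := vM.nonempty_equiv (c a)
  obtain ⟨θN⟩ := vN.nonempty_equiv (c a)
  obtain ⟨θG⟩ := vG.nonempty_equiv (c a)
  obtain ⟨ε₁, h₁, H₁⟩ := vM.exists_radial cM hc a θM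
  obtain ⟨ε₂, h₂, H₂⟩ := vN.exists_radial cN hc a θN
  obtain ⟨ε₃, h₃, H₃⟩ := vG.exists_radial cG hc a θG
  let ε := min ε₁ (min ε₂ ε₃)
  have hε : 0 < ε := lt_min h₁ (lt_min h₂ h₃)
  obtain ⟨TM, hTM⟩ := H₁ ε (min_le_left _ _)
  obtain ⟨TN, hTN⟩ := H₂ ε ((min_le_right _ _).trans (min_le_left _ _))
  obtain ⟨TG, hTG⟩ := H₃ ε ((min_le_right _ _).trans (min_le_right _ _))
  -- every tensor over the base point is a combination of the frame of `M` with coefficients in `N`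
  let τ : (Fin k → Fin l → ℂ) →ₗ[ℂ] tensorB m n (c a) :=
    ∑ i, (tmulBilin m n (c a) (θM (Pi.single i 1))).comp
      (θN.toLinearMap.comp (LinearMap.proj i))
  have hτ : ∀ w, τ w = ∑ i, tmulB m n (c a) (θM (Pi.single i 1)) (θN (w i)) := fun w => by
    simp only [τ, LinearMap.sum_apply]; rfl
  have hτs : Function.Surjective τ := fun t => by
    induction t using tensorB_induction with
    | h y z =>
      refine ⟨fun i => θM.symm y i • θN.symm z, ?_⟩
      rw [hτ]
      have : y = ∑ i, θM.symm y i • θM (Pi.single i 1) := by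
        conv_lhs => rw [← θM.apply_symm_apply y, pi_eq_sum_univ' (θM.symm y)]
        rw [map_sum]
        simp only [map_smul]
      conv_rhs => rw [this]
      simp only [← tmulBilin_apply, map_sum, map_smul, LinearMap.sum_apply, LinearMap.smul_apply,
        LinearEquiv.apply_symm_apply]
    | h0 => exact ⟨0, map_zero _⟩
    | hadd s t hs ht =>
      obtain ⟨w, rfl⟩ := hs
      obtain ⟨w', rfl⟩ := ht
      exact ⟨w + w', map_add _ _ _⟩
  -- A linear section of τ turns each tensor over the centre into k summands whose coefficients
  -- depend linearly on it.
  obtain ⟨S, hS⟩ := τ.exists_rightInverse_of_surjective (LinearMap.range_eq_top.2 hτs)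
  have hS' : ∀ t, τ (S t) = t := fun t => LinearMap.congr_fun hS t
  refine ⟨Metric.ball a ε, Metric.isOpen_ball, Metric.mem_ball_self hε, fun r f hf hs => ?_⟩
  have hz := TG.smooth_inv r f hf hs (fun b => (p (f b)).2) (IsPlot.reparam (E := G) hp hs)
  set z := fun b => (TG.φ ⟨f b, hf b⟩).symm (p (f b)).2 with hzdef
  let S' : (Fin s → ℂ) →ₗ[ℂ] (Fin k → Fin l → ℂ) :=
    S.comp ((e (c a)).symm.toLinearMap.comp θG.toLinearMap)
  refine DiffeologicalSpace.isPlot_generatedFrom_of_mem ⟨fun b => c (f b),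
    Diffeology.isPlot_reparam hc hs, k, fun i b => TM.φ ⟨f b, hf b⟩ (Pi.single i 1),
    fun i b => TN.φ ⟨f b, hf b⟩ (S' (z b) i), fun i => TM.smooth r f hf hs _ contDiff_const,
    fun i => TN.smooth r f hf hs _
      (contDiff_linearMap ((LinearMap.proj i).comp S') hz), funext fun b => ?_⟩
  change (⟨c (f b), (e (c (f b))).symm (p (f b)).2⟩ : Σ x, tensorB m n x) = _
  congr 1
  rw [LinearEquiv.symm_apply_eq, map_sum]
  simp only [he, hTM, hTN, LinearEquiv.trans_apply]
  simp only [hβ.apply_radial hc a (f b)]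
  rw [← map_sum]
  have h5 : ∑ i, β (c a) (θM (Pi.single i 1)) (θN (S' (z b) i)) = θG (z b) := by
    simp only [← he]
    rw [← map_sum, ← hτ]
    change e (c a) (τ (S ((e (c a)).symm (θG (z b))))) = _
    rw [hS', LinearEquiv.apply_symm_apply]
  rw [h5]
  have h6 := (TG.φ ⟨f b, hf b⟩).apply_symm_apply (p (f b)).2
  rw [hTG] at h6
  rw [← h6]
  simp only [LinearEquiv.trans_apply, z, hTG]

/-- A parallel, balanced and equivariant bilinear map `M × N → G` of bundles of bimodules which
is fibrewise invertible in the sense of `tensorLift_bijective` induces an isomorphism of bundles of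
bimodules `M ⊗_B N ≅ G`. -/
theorem exists_tensorIso {k l s : ℕ} (vM : M.IsVectorBundle k) (vN : N.IsVectorBundle l)
    (vG : G.IsVectorBundle s) (cM : M.IsConnection ptM) (cN : N.IsConnection ptN)
    (cG : G.IsConnection ptG) {m : BimodData A B M} {n : BimodData B C N} {g : BimodData A C G}
    {β : ∀ x, M x →ₗ[ℂ] N x →ₗ[ℂ] G x} (hβ : ParallelBilin ptM ptN ptG β)
    (hbal : ∀ x y r z, β x ((m x).right y r) z = β x y ((n x).left r z))
    (hl : ∀ x r y z, β x ((m x).left r y) z = (g x).left r (β x y z))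
    (hr : ∀ x y z r, β x y ((n x).right z r) = (g x).right (β x y z) r)
    (hinv : ∀ x, ∃ (s : ℕ) (b : Fin s → M x) (p : Fin s → G x →ₗ[ℂ] N x) (σ : Fin s → M x → B x),
      (∀ u, ∑ r, β x (b r) (p r u) = u) ∧ (∀ w, ∑ r, (m x).right (b r) (σ r w) = w) ∧
      ∀ r w z, p r (β x w z) = (n x).left (σ r w) z) :
    ∃ t : BimodData A C (tensorB m n), IsTensorActions m n t ∧
      ∃ Φ : BimodIso t g, ∀ x y z, Φ.equiv x (tmulB m n x y z) = β x y z := by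
  have hbij : ∀ x, Function.Bijective (tensorLift m n x (β x) (hbal x)) := fun x => by
    obtain ⟨s, b, p, σ, h₁, h₂, h₃⟩ := hinv x
    exact tensorLift_bijective m n x (β x) (hbal x) b p σ h₁ h₂ h₃
  let e : ∀ x, tensorB m n x ≃ₗ[ℂ] G x := fun x => LinearEquiv.ofBijective _ (hbij x)
  have he : ∀ x y z, e x (tmulB m n x y z) = β x y z := fun x y z => rfl
  have hes : ∀ x y z, (e x).symm (β x y z) = tmulB m n x y z := fun x y z => by
    rw [← he, LinearEquiv.symm_apply_apply]
  -- The actions are transported from G along e instead of being constructed on the quotient;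
  -- equivariance of β shows that they are the induced ones.
  let t : BimodData A C (tensorB m n) := fun x =>
    ⟨((g x).left.compl₂ (e x).toLinearMap).compr₂ (e x).symm.toLinearMap,
      ((g x).right.comp (e x).toLinearMap).compr₂ (e x).symm.toLinearMap⟩
  have htl : ∀ x r w, (t x).left r w = (e x).symm ((g x).left r (e x w)) := fun _ _ _ => rfl
  have htr : ∀ x w r, (t x).right w r = (e x).symm ((g x).right (e x w) r) := fun _ _ _ => rfl
  refine ⟨t, fun x y z => ⟨fun r => ?_, fun r => ?_⟩, ⟨e,
    dSmooth_tensor_of_smoothBilin vG (hβ.smoothBilin vM vN vG cM cN cG)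
      (fun x => (e x).toLinearMap) he,
    dSmooth_tensor_symm vM vN vG cM cN cG hβ e he, fun x r z => ?_, fun x z r => ?_⟩, he⟩
  · rw [htl, he, ← hl, hes]
  · rw [htr, he, ← hr, hes]
  · rw [htl, LinearEquiv.apply_symm_apply]
  · rw [htr, LinearEquiv.apply_symm_apply]

end TensorIso

/-! ## Transfer along isomorphisms -/

namespace BimodIso

open VecFam

variable {X : Type u} [DiffeologicalSpace X] {A B M M' : VecFam.{u, v} X}
  {m : BimodData A B M} {m' : BimodData A B M'} (Φ : BimodIso m m')

theorem isPlot_apply {n : ℕ} {p : Eu n → Σ x, M x} (hp : M.IsPlot p) :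
    M'.IsPlot fun b => ⟨(p b).1, Φ.equiv (p b).1 (p b).2⟩ := Φ.smooth n p hp

theorem isPlot_symm_apply {n : ℕ} {p : Eu n → Σ x, M' x} (hp : M'.IsPlot p) :
    M.IsPlot fun b => ⟨(p b).1, (Φ.equiv (p b).1).symm (p b).2⟩ := Φ.smooth_symm n p hp

theorem equiv_cast {x y : X} (h : x = y) (e : M x) :
    Φ.equiv y (M.cast h e) = M'.cast h (Φ.equiv x e) := by subst h; rfl

/-- The local trivialization of the source induced by one of the target. -/
def locTriv {k n : ℕ} {c : Eu n → X} {W : Set (Eu n)} (T : LocTriv M' k c W) :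
    LocTriv M k c W where
  φ a := (T.φ a).trans (Φ.equiv _).symm
  smooth r f hf hs z hz := Φ.isPlot_symm_apply (T.smooth r f hf hs z hz)
  smooth_inv r f hf hs e he :=
    T.smooth_inv r f hf hs (fun b => Φ.equiv _ (e b)) (Φ.isPlot_apply he)

/-- The local trivialization of the target induced by one of the source. -/
def locTrivSymm {k n : ℕ} {c : Eu n → X} {W : Set (Eu n)} (T : LocTriv M k c W) :
    LocTriv M' k c W where
  φ a := (T.φ a).trans (Φ.equiv _)
  smooth r f hf hs z hz := Φ.isPlot_apply (T.smooth r f hf hs z hz)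
  smooth_inv r f hf hs e he :=
    T.smooth_inv r f hf hs (fun b => (Φ.equiv _).symm (e b)) (Φ.isPlot_symm_apply he)

theorem isVectorBundle (Φ : BimodIso m m') {k : ℕ} (h : M'.IsVectorBundle k) : M.IsVectorBundle k := by
  refine ⟨fun n p hp => h.1 n _ (Φ.isPlot_apply hp), fun n c hc a => ?_⟩
  obtain ⟨W, hW, ha, ⟨T⟩⟩ := h.2 n c hc a
  exact ⟨W, hW, ha, ⟨Φ.locTriv T⟩⟩

/-- The induced parallel transport. -/
def transport (pt : M'.Transport) : M.Transport := fun γ =>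
  (Φ.equiv (γ 0)).trans ((pt γ).trans (Φ.equiv (γ 1)).symm)

theorem equiv_transport (pt : M'.Transport) (γ : DPath X) (z : M (γ 0)) :
    Φ.equiv (γ 1) (Φ.transport pt γ z) = pt γ (Φ.equiv (γ 0) z) :=
  LinearEquiv.apply_symm_apply _ _

theorem isConnection (Φ : BimodIso m m') {pt : M'.Transport} (h : M'.IsConnection pt) :
    M.IsConnection (Φ.transport pt) where
  thin γ γ' hγ h₀ h₁ z := (Φ.equiv _).injective (by
    rw [equiv_transport, equiv_cast, equiv_cast, equiv_transport]
    exact h.thin γ γ' hγ h₀ h₁ _)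
  comp γ₂ γ₁ hγ z := (Φ.equiv _).injective (by
    rw [equiv_transport, equiv_cast, equiv_cast, equiv_transport, equiv_cast, equiv_transport]
    exact h.comp γ₂ γ₁ hγ _)
  smooth k n c hc W hW T r g hg hgW z :=
    h.smooth k n c hc W hW (Φ.locTrivSymm T) r g hg hgW z

theorem isBimoduleBundle (Φ : BimodIso m m') {a : AlgData A} {b : AlgData B} (h : IsBimoduleBundle a b M' m') :
    IsBimoduleBundle a b M m where
  isBimoduleStructure :=
    { isBimodule := fun x =>
        { left_mul := fun y z w => (Φ.equiv x).injective (by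
            simp only [Φ.map_left, (h.isBimoduleStructure.isBimodule x).left_mul])
          left_one := fun w => (Φ.equiv x).injective (by
            simp only [Φ.map_left, (h.isBimoduleStructure.isBimodule x).left_one])
          right_mul := fun y z w => (Φ.equiv x).injective (by
            simp only [Φ.map_right, (h.isBimoduleStructure.isBimodule x).right_mul])
          right_one := fun w => (Φ.equiv x).injective (by
            simp only [Φ.map_right, (h.isBimoduleStructure.isBimodule x).right_one])
          comm := fun y z w => (Φ.equiv x).injective (by
            simp only [Φ.map_left, Φ.map_right, (h.isBimoduleStructure.isBimodule x).comm]) }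
      smooth_left := fun n c hc e f he hf => by
        have := Φ.isPlot_symm_apply (h.isBimoduleStructure.smooth_left n c hc e _ he
          (Φ.isPlot_apply hf))
        simpa only [← Φ.map_left, LinearEquiv.symm_apply_apply] using this
      smooth_right := fun n c hc e f he hf => by
        have := Φ.isPlot_symm_apply (h.isBimoduleStructure.smooth_right n c hc _ f
          (Φ.isPlot_apply he) hf)
        simpa only [← Φ.map_right, LinearEquiv.symm_apply_apply] using this }
  left_isAlgebraBundle := h.left_isAlgebraBundle
  right_isAlgebraBundle := h.right_isAlgebraBundle
  locallyTrivial := by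
    obtain ⟨ka, kb, km, a₀, b₀, m₀, v, ha, hb, hm, H⟩ := h.locallyTrivial
    refine ⟨ka, kb, km, a₀, b₀, m₀, Φ.isVectorBundle v, ha, hb, hm, fun n c hc p => ?_⟩
    obtain ⟨W, hW, hp, TA, TB, TM, K⟩ := H n c hc p
    refine ⟨W, hW, hp, TA, TB, Φ.locTriv TM, fun q => ?_⟩
    obtain ⟨h₁, h₂, h₃, h₄, h₅, h₆⟩ := K q
    refine ⟨h₁, h₂, h₃, h₄, fun x z => (Φ.equiv _).injective ?_,
      fun z y => (Φ.equiv _).injective ?_⟩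
    · rw [Φ.map_left]
      simpa only [locTriv, LinearEquiv.trans_apply, LinearEquiv.apply_symm_apply] using h₅ x z
    · rw [Φ.map_right]
      simpa only [locTriv, LinearEquiv.trans_apply, LinearEquiv.apply_symm_apply] using h₆ z y

end BimodIso

/-! ## Ranks of smooth maps into the target space -/

namespace TargetSpace

variable {I : Type w} {T : TargetSpace.{u, w} I}

theorem mdifferentiable_of_isPlot {n : ℕ} {f : Eu n → T.M} (hf : IsPlot f) :
    MDifferentiable (𝓡 n) (𝓡 T.dim) f :=
  ContMDiff.mdifferentiable (n := ∞) (T.isPlot_iff.1 hf) (by simp)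

/-- The dimension of the range of the differential. -/
theorem finrank_range_le {n k : ℕ} (f : Eu n →ₗ[ℝ] Eu k) (g : Eu k →ₗ[ℝ] Eu T.dim) :
    Module.finrank ℝ (LinearMap.range (g.comp f)) ≤ Module.finrank ℝ (LinearMap.range g) :=
  Submodule.finrank_mono (LinearMap.range_comp_le_range f g)

theorem RankLE.comp {n m k : ℕ} {g : Eu m → T.M} (hg : IsPlot g) (h : T.RankLE k g)
    {θ : Eu n → Eu m} (hθ : ContDiff ℝ ∞ θ) : T.RankLE k fun a => g (θ a) := by
  intro a
  have hθ' : MDifferentiableAt (𝓡 n) (𝓡 m) θ a :=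
    ((hθ.differentiable (by simp)) a).mdifferentiableAt
  have e := mfderiv_comp a (mdifferentiable_of_isPlot hg (θ a)) hθ'
  change Module.finrank ℝ (LinearMap.range (mfderiv (𝓡 n) (𝓡 T.dim) (g ∘ θ) a).toLinearMap) ≤ k
  rw [e]
  exact (finrank_range_le _ _).trans (h (θ a))

theorem finrank_range_le_dim {n d : ℕ} (L : Eu n →L[ℝ] Eu d) :
    Module.finrank ℝ (LinearMap.range L.toLinearMap) ≤ n := by
  have h := LinearMap.finrank_range_le L.toLinearMap
  rwa [finrank_euclideanSpace_fin] at h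

theorem rankLE_self {n : ℕ} (g : Eu n → T.M) : T.RankLE n g := fun a =>
  finrank_range_le_dim (n := n) (d := T.dim) (mfderiv (𝓡 n) (𝓡 T.dim) g a)

/-- A half-space is convex with nonempty interior, so differentials are determined from one side
even on its boundary hyperplane. -/
theorem uniqueDiffWithinAt_halfSpace {n : ℕ} (l : Fin n) (c : ℝ) (a : Eu n) (h : a l ≤ c) :
    UniqueDiffWithinAt ℝ {b : Eu n | b l ≤ c} a := by
  let L : Eu n →L[ℝ] ℝ := EuclideanSpace.proj l
  have hc : Convex ℝ {b : Eu n | b l ≤ c} :=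
    convex_halfSpace_le (f := fun b : Eu n => b l) L.toLinearMap.isLinear c
  have hi : {b : Eu n | b l < c} ⊆ interior {b : Eu n | b l ≤ c} :=
    interior_maximal (fun b (hb : b l < c) => hb.le) (isOpen_lt L.continuous continuous_const)
  refine uniqueDiffWithinAt_convex hc ⟨EuclideanSpace.single l (c - 1), hi ?_⟩ (subset_closure h)
  simp

/-- The rank of a map which is glued from two maps along a hyperplane. -/
theorem RankLE.glue {n k : ℕ} (l : Fin n) (c : ℝ) {f f₁ f₂ : Eu n → T.M} (hf : IsPlot f)
    (hf₁ : IsPlot f₁) (hf₂ : IsPlot f₂) (h₁ : T.RankLE k f₁) (h₂ : T.RankLE k f₂)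
    (hle : ∀ b, b l ≤ c → f b = f₁ b) (hlt : ∀ b, c < b l → f b = f₂ b) : T.RankLE k f := by
  -- Two smooth maps which agree on a set with unique differentials have the same differential at
  -- its points. For the closed half-space this includes the gluing hyperplane.
  have key : ∀ (g : Eu n → T.M) (S : Set (Eu n)) (a : Eu n), IsPlot g → a ∈ S →
      UniqueDiffWithinAt ℝ S a → (∀ b ∈ S, f b = g b) → T.RankLE k g →
      Module.finrank ℝ (LinearMap.range (mfderiv (𝓡 n) (𝓡 T.dim) f a).toLinearMap) ≤ k := by
    intro g S a hg ha hS hfg hk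
    have e1 := ((mdifferentiable_of_isPlot hf a).hasMFDerivAt.hasMFDerivWithinAt (s := S))
    have e2 := ((mdifferentiable_of_isPlot hg a).hasMFDerivAt.hasMFDerivWithinAt (s := S)).congr_of_eventuallyEq
      (eventually_nhdsWithin_of_forall hfg) (hfg a ha)
    have hS' : UniqueMDiffWithinAt (𝓡 n) S a := uniqueMDiffWithinAt_iff_uniqueDiffWithinAt.2 hS
    have e3 := UniqueMDiffWithinAt.eq hS' e1 e2
    rw [e3]
    exact hk a
  intro a
  rcases le_or_gt (a l) c with ha | ha
  · exact key f₁ _ a hf₁ ha (uniqueDiffWithinAt_halfSpace l c a ha) hle h₁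
  · exact key f₂ {b | c < b l} a hf₂ ha
      ((isOpen_lt continuous_const (EuclideanSpace.proj l : Eu n →L[ℝ] ℝ).continuous).uniqueDiffWithinAt
        ha) hlt h₂

/-! ### Coordinates -/

theorem contDiff_coord {n : ℕ} (l : Fin n) : ContDiff ℝ ∞ fun a : Eu n => a l :=
  (EuclideanSpace.proj l : Eu n →L[ℝ] ℝ).contDiff

theorem RankLE.comp₂ {n k : ℕ} {H : ℝ → ℝ → T.M} (hH : IsPlot fun a : Eu 2 => H (a 0) (a 1))
    (h : T.RankLE k fun a : Eu 2 => H (a 0) (a 1)) {σ τ : Eu n → ℝ} (hσ : ContDiff ℝ ∞ σ)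
    (hτ : ContDiff ℝ ∞ τ) : T.RankLE k fun a => H (σ a) (τ a) := by
  have hθ : ContDiff ℝ ∞ fun a => (!₂[σ a, τ a] : Eu 2) := by
    refine contDiff_euclidean.2 (Fin.forall_fin_two.2 ⟨?_, ?_⟩)
    · simpa using hσ
    · simpa using hτ
  have e : (fun a => H (σ a) (τ a)) =
      fun a => (fun b : Eu 2 => H (b 0) (b 1)) !₂[σ a, τ a] := by funext a; simp
  rw [e]
  exact RankLE.comp hH h hθ

/-- The map factors through a one-dimensional domain. -/
theorem rankLE_one_of_comp {n : ℕ} {g : ℝ → T.M} (hg : DSmooth g) {τ : Eu n → ℝ}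
    (hτ : ContDiff ℝ ∞ τ) : T.RankLE 1 fun a => g (τ a) := by
  have h1 : IsPlot fun a : Eu 1 => g (a 0) := hg _ _ (contDiff_coord 0).isPlot
  have hθ : ContDiff ℝ ∞ fun a => (!₂[τ a] : Eu 1) := by
    refine contDiff_euclidean.2 (Fin.forall_fin_one.2 ?_)
    simpa using hτ
  have e : (fun a => g (τ a)) = fun a => (fun b : Eu 1 => g (b 0)) !₂[τ a] := by funext a; simp
  rw [e]
  exact RankLE.comp h1 (rankLE_self _) hθ

variable {i j k l : I}

theorem isPlot_eval {n : ℕ} {p : Eu n → DPath T.M} (hp : IsPlot p) {τ : Eu n → ℝ}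
    (hτ : ContDiff ℝ ∞ τ) : IsPlot fun b => p b (τ b) :=
  hp n id τ contDiff_id hτ

theorem isPlot_evalP {n : ℕ} {p : Eu n → T.P i j} (hp : IsPlot p) {τ : Eu n → ℝ}
    (hτ : ContDiff ℝ ∞ τ) : IsPlot fun b => (p b).1 (τ b) :=
  isPlot_eval (isPlot_subtype_iff.1 hp) hτ

theorem _root_.BraneGeometry.DPath.isPlot_comp {X : Type u} [DiffeologicalSpace X] (γ : DPath X)
    {n : ℕ} {τ : Eu n → ℝ} (hτ : ContDiff ℝ ∞ τ) : IsPlot fun b => γ (τ b) :=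
  γ.smooth n τ hτ.isPlot

/-! ### Thin homotopy classes of paths -/

/-- Two paths are connected by a thin path with fixed end points. -/
def ThinEq (γ γ' : T.P i j) : Prop := ∃ Γ : DPath (T.P i j), FixedEndsThin Γ ∧ Γ 0 = γ ∧ Γ 1 = γ'

theorem isPlot_adjoint (Γ : DPath (T.P i j)) : IsPlot fun a : Eu 2 => (Γ (a 0)).1 (a 1) :=
  isPlot_evalP (Γ.isPlot_comp (contDiff_coord 0)) (contDiff_coord 1)

theorem fixedEndsThin_const (γ : T.P i j) : FixedEndsThin (DPath.const γ) := by
  exact ⟨fun _ => ⟨rfl, rfl⟩, rankLE_one_of_comp γ.1.smooth (contDiff_coord 1)⟩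

theorem ThinEq.refl (γ : T.P i j) : ThinEq γ γ := ⟨_, fixedEndsThin_const γ, rfl, rfl⟩

theorem FixedEndsThin.rev {Γ : DPath (T.P i j)} (h : FixedEndsThin Γ) : FixedEndsThin Γ.rev := by
  refine ⟨fun s => ?_, ?_⟩
  · rw [DPath.rev_apply, DPath.rev_zero]
    exact ⟨(h.1 _).1.trans (h.1 1).1.symm, (h.1 _).2.trans (h.1 1).2.symm⟩
  · exact RankLE.comp₂ (H := fun s t => (Γ s).1 t) (isPlot_adjoint Γ) h.2
      (contDiff_const.sub (contDiff_coord 0)) (contDiff_coord 1)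

theorem ThinEq.symm {γ γ' : T.P i j} (h : ThinEq γ γ') : ThinEq γ' γ := by
  obtain ⟨Γ, h, h0, h1⟩ := h
  exact ⟨Γ.rev, h.rev, by rw [DPath.rev_zero, h1], by rw [DPath.rev_one, h0]⟩

theorem FixedEndsThin.comp {Γ₂ Γ₁ : DPath (T.P i j)} (h₂ : FixedEndsThin Γ₂)
    (h₁ : FixedEndsThin Γ₁) (h : Γ₁ 1 = Γ₂ 0) : FixedEndsThin (Γ₂.comp Γ₁ h) := by
  refine ⟨fun s => ?_, ?_⟩
  · rw [DPath.comp_zero, DPath.comp_apply]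
    split_ifs
    · exact h₁.1 _
    · exact ⟨(h₂.1 _).1.trans ((congrArg (fun γ => γ.1 0) h.symm).trans (h₁.1 1).1),
        (h₂.1 _).2.trans ((congrArg (fun γ => γ.1 1) h.symm).trans (h₁.1 1).2)⟩
  · have k₁ : ContDiff ℝ ∞ fun a : Eu 2 => 2 * a 0 := contDiff_const.mul (contDiff_coord 0)
    have k₂ : ContDiff ℝ ∞ fun a : Eu 2 => 2 * a 0 - 1 := k₁.sub contDiff_const
    refine RankLE.glue 0 (1 / 2) (isPlot_adjoint _)
      (f₁ := fun a => (Γ₁ (2 * a 0)).1 (a 1)) (f₂ := fun a => (Γ₂ (2 * a 0 - 1)).1 (a 1))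
      (isPlot_evalP (Γ₁.isPlot_comp k₁) (contDiff_coord 1))
      (isPlot_evalP (Γ₂.isPlot_comp k₂) (contDiff_coord 1)) ?_ ?_
      (fun b hb => by rw [DPath.comp_apply, if_pos hb])
      (fun b hb => by rw [DPath.comp_apply, if_neg (not_le.2 hb)])
    · exact RankLE.comp₂ (H := fun s t => (Γ₁ s).1 t) (isPlot_adjoint Γ₁) h₁.2 k₁ (contDiff_coord 1)
    · exact RankLE.comp₂ (H := fun s t => (Γ₂ s).1 t) (isPlot_adjoint Γ₂) h₂.2 k₂ (contDiff_coord 1)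

theorem ThinEq.trans {γ γ' γ'' : T.P i j} (h : ThinEq γ γ') (h' : ThinEq γ' γ'') :
    ThinEq γ γ'' := by
  obtain ⟨Γ, h, h0, h1⟩ := h
  obtain ⟨Γ', h', h0', h1'⟩ := h'
  exact ⟨Γ'.comp Γ (h1.trans h0'.symm), h'.comp h _, by rw [DPath.comp_zero, h0],
    by rw [DPath.comp_one, h1']⟩

theorem ThinEq.one_eq {γ γ' : T.P i j} (h : ThinEq γ γ') : γ.1 1 = γ'.1 1 := by
  obtain ⟨Γ, h, rfl, rfl⟩ := h
  exact (h.1 1).2.symm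

/-- A pair of paths in path spaces with matching end points is a path of composable pairs. -/
def pairPath (Γ₂ : DPath (T.P j k)) (Γ₁ : DPath (T.P i j))
    (h : ∀ s, (Γ₁ s).1 1 = (Γ₂ s).1 0) : DPath (T.Comp i j k) where
  toFun s := ⟨(Γ₂ s, Γ₁ s), h s⟩
  smooth _ _ hp :=
    isPlot_subtype_iff.2 (isPlot_prod_iff.2 ⟨Γ₂.smooth _ _ hp, Γ₁.smooth _ _ hp⟩)
  sit := by
    obtain ⟨ε, hε, h0, h1⟩ := Γ₁.sit
    obtain ⟨δ, hδ, k0, k1⟩ := Γ₂.sit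
    refine ⟨min ε δ, lt_min hε hδ, fun t ht => Subtype.ext (Prod.ext ?_ ?_),
      fun t ht => Subtype.ext (Prod.ext ?_ ?_)⟩
    · exact k0 t (ht.trans (min_le_right _ _))
    · exact h0 t (ht.trans (min_le_left _ _))
    · have := min_le_right ε δ
      exact k1 t (by linarith)
    · have := min_le_left ε δ
      exact h1 t (by linarith)

/-- The adjoint of the concatenated family is glued along t = 1/2 from reparametrizations of the two
given adjoints, so `RankLE.glue` keeps the rank at one. -/
theorem FixedEndsThin.conc {Γ₂ : DPath (T.P j k)} {Γ₁ : DPath (T.P i j)} (h₂ : FixedEndsThin Γ₂)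
    (h₁ : FixedEndsThin Γ₁) (h : ∀ s, (Γ₁ s).1 1 = (Γ₂ s).1 0) :
    FixedEndsThin ((pairPath Γ₂ Γ₁ h).map conc dSmooth_conc) := by
  refine ⟨fun s => ?_, ?_⟩
  · change (TargetSpace.comp (Γ₂ s) (Γ₁ s) (h s)).1 0 = (TargetSpace.comp (Γ₂ 0) (Γ₁ 0) (h 0)).1 0 ∧
      (TargetSpace.comp (Γ₂ s) (Γ₁ s) (h s)).1 1 = (TargetSpace.comp (Γ₂ 0) (Γ₁ 0) (h 0)).1 1
    rw [TargetSpace.comp_zero, TargetSpace.comp_zero, TargetSpace.comp_one, TargetSpace.comp_one]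
    exact ⟨(h₁.1 s).1, (h₂.1 s).2⟩
  · have k₁ : ContDiff ℝ ∞ fun a : Eu 2 => 2 * a 1 := contDiff_const.mul (contDiff_coord 1)
    have k₂ : ContDiff ℝ ∞ fun a : Eu 2 => 2 * a 1 - 1 := k₁.sub contDiff_const
    refine RankLE.glue 1 (1 / 2) (isPlot_adjoint _)
      (f₁ := fun a => (Γ₁ (a 0)).1 (2 * a 1)) (f₂ := fun a => (Γ₂ (a 0)).1 (2 * a 1 - 1))
      (isPlot_evalP (Γ₁.isPlot_comp (contDiff_coord 0)) k₁)
      (isPlot_evalP (Γ₂.isPlot_comp (contDiff_coord 0)) k₂) ?_ ?_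
      (fun b hb => if_pos hb) (fun b hb => if_neg (not_le.2 hb))
    · exact RankLE.comp₂ (H := fun s t => (Γ₁ s).1 t) (isPlot_adjoint Γ₁) h₁.2 (contDiff_coord 0) k₁
    · exact RankLE.comp₂ (H := fun s t => (Γ₂ s).1 t) (isPlot_adjoint Γ₂) h₂.2 (contDiff_coord 0) k₂

theorem ThinEq.comp {γ₂ γ₂' : T.P j k} {γ₁ γ₁' : T.P i j} (h₂ : ThinEq γ₂ γ₂')
    (h₁ : ThinEq γ₁ γ₁') (h : γ₁.1 1 = γ₂.1 0) (h' : γ₁'.1 1 = γ₂'.1 0) :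
    ThinEq (TargetSpace.comp γ₂ γ₁ h) (TargetSpace.comp γ₂' γ₁' h') := by
  obtain ⟨Γ₂, k₂, rfl, rfl⟩ := h₂
  obtain ⟨Γ₁, k₁, rfl, rfl⟩ := h₁
  exact ⟨_, k₂.conc k₁ fun s => ((k₁.1 s).2.trans (h.trans (k₂.1 s).1.symm)), rfl, rfl⟩

end TargetSpace

/-! ## Reparametrizations -/

/-- Smooth maps `ℝ → ℝ` along which paths with sitting instants may be reparametrized. -/
structure IsReparam (κ : ℝ → ℝ) : Prop where
  smooth : ContDiff ℝ ∞ κ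
  -- One-sided bounds suffice, because a path is constant on all of (-∞, ε] and [1 - ε, ∞). The
  -- constant 4 accommodates `step`, which vanishes up to 1/4 and never exceeds 1.
  le : ∀ t, κ t ≤ 4 * max t 0
  ge : ∀ t, 1 - κ t ≤ 4 * max (1 - t) 0

section Reparam

variable {X : Type u} [DiffeologicalSpace X]

theorem DPath.reparam_le {γ : DPath X} {κ : ℝ → ℝ} (h : IsReparam κ) {t : ℝ} (ht : t ≤ 0) :
    γ (κ t) = γ 0 := by
  obtain ⟨ε, hε, h0, -⟩ := γ.sit
  have h1 := h.le t
  rw [max_eq_right ht] at h1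
  exact h0 _ (by linarith)

theorem DPath.reparam_ge {γ : DPath X} {κ : ℝ → ℝ} (h : IsReparam κ) {t : ℝ} (ht : 1 ≤ t) :
    γ (κ t) = γ 1 := by
  obtain ⟨ε, hε, -, h0⟩ := γ.sit
  have h1 := h.ge t
  rw [max_eq_right (by linarith)] at h1
  exact h0 _ (by linarith)

/-- The reparametrization of a path. -/
def DPath.reparam (γ : DPath X) (κ : ℝ → ℝ) (h : IsReparam κ) : DPath X where
  toFun t := γ (κ t)
  smooth := γ.smooth.comp h.smooth.dSmooth
  sit := by
    obtain ⟨ε, hε, h0, h1⟩ := γ.sit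
    refine ⟨ε / 4, by positivity, fun t ht => ?_, fun t ht => ?_⟩
    · rw [DPath.reparam_le h le_rfl]
      refine h0 _ ((h.le t).trans ?_)
      have : max t 0 ≤ ε / 4 := max_le ht (by positivity)
      linarith
    · rw [DPath.reparam_ge h le_rfl]
      refine h1 _ ?_
      have h2 := h.ge t
      have : max (1 - t) 0 ≤ ε / 4 := max_le (by linarith) (by positivity)
      linarith

theorem DPath.reparam_zero (γ : DPath X) (κ : ℝ → ℝ) (h : IsReparam κ) :
    γ.reparam κ h 0 = γ 0 := DPath.reparam_le h le_rfl

theorem DPath.reparam_one (γ : DPath X) (κ : ℝ → ℝ) (h : IsReparam κ) :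
    γ.reparam κ h 1 = γ 1 := DPath.reparam_ge h le_rfl

theorem isPlot_reparamFamily {κ : ℝ → ℝ → ℝ} (hκ : ContDiff ℝ ∞ fun q : ℝ × ℝ => κ q.1 q.2)
    (h : ∀ r, IsReparam (κ r)) {n : ℕ} {p : Eu n → DPath X} (hp : IsPlot p) {r : Eu n → ℝ}
    (hr : ContDiff ℝ ∞ r) : IsPlot fun b => (p b).reparam (κ (r b)) (h (r b)) :=
  fun m g _ hg hτ => hp m g _ hg (hκ.comp ((hr.comp hg).prodMk hτ))

theorem isReparam_of_contDiff {κ : ℝ → ℝ → ℝ} (hκ : ContDiff ℝ ∞ fun q : ℝ × ℝ => κ q.1 q.2)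
    (hle : ∀ r t, κ r t ≤ 4 * max t 0) (hge : ∀ r t, 1 - κ r t ≤ 4 * max (1 - t) 0) (r : ℝ) :
    IsReparam (κ r) :=
  ⟨hκ.comp (contDiff_const.prodMk contDiff_id), hle r, hge r⟩

end Reparam

namespace TargetSpace

variable {I : Type w} {T : TargetSpace.{u, w} I} {i j k l : I}

/-! ## Deformations of families of paths -/

/-- Deformations, with fixed end points, of a family `F 0` of paths into a family `F 1`, which do
not increase ranks. -/
structure IsDeformation {Z : Type u} [DiffeologicalSpace Z] (F : ℝ → Z → T.P i j) : Prop where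
  smooth : ∀ (n : ℕ) (r : Eu n → ℝ) (z : Eu n → Z), ContDiff ℝ ∞ r → IsPlot z →
    IsPlot fun b => F (r b) (z b)
  ends : ∀ r z, (F r z).1 0 = (F 0 z).1 0 ∧ (F r z).1 1 = (F 0 z).1 1
  -- The first rank condition makes each deformation path thin, so that transport along it is
  -- canonical. The second is what the rank-two condition on superficial connections asks of the
  -- homotopy along Γ.
  rank_one : ∀ z, T.RankLE 1 fun a : Eu 2 => (F (a 0) z).1 (a 1)
  rank_two : ∀ Γ : DPath Z, T.RankLE 2 fun a : Eu 3 => (F (a 0) (Γ (a 1))).1 (a 2)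

section Deformation

variable {Z : Type u} [DiffeologicalSpace Z]

/-- A deformation which consists of reparametrizations, piecewise. -/
theorem IsDeformation.of_piecewise {F : ℝ → Z → T.P i j}
    (smooth : ∀ (n : ℕ) (r : Eu n → ℝ) (z : Eu n → Z), ContDiff ℝ ∞ r → IsPlot z →
      IsPlot fun b => F (r b) (z b))
    (ends : ∀ r z, (F r z).1 0 = (F 0 z).1 0 ∧ (F r z).1 1 = (F 0 z).1 1)
    {p : Z → DPath T.M} (hp : DSmooth p) {κ κ' : ℝ → ℝ → ℝ}
    (hκ : ContDiff ℝ ∞ fun q : ℝ × ℝ => κ q.1 q.2) (hκ' : ContDiff ℝ ∞ fun q : ℝ × ℝ => κ' q.1 q.2)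
    (hF : ∀ r z t, (F r z).1 t = if t ≤ 1 / 2 then p z (κ r t) else p z (κ' r t)) :
    IsDeformation F where
  smooth := smooth
  ends := ends
  rank_one z := by
    have hs : ∀ {κ : ℝ → ℝ → ℝ}, (ContDiff ℝ ∞ fun q : ℝ × ℝ => κ q.1 q.2) →
        ContDiff ℝ ∞ fun a : Eu 2 => κ (a 0) (a 1) := fun h =>
      h.comp ((contDiff_coord 0).prodMk (contDiff_coord 1))
    -- For fixed z each piece factors through κ or κ', that is, through a one-dimensional domain.
    exact RankLE.glue 1 (1 / 2)
      (isPlot_evalP (smooth 2 _ _ (contDiff_coord 0) isPlot_const) (contDiff_coord 1))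
      (f₁ := fun a => p z (κ (a 0) (a 1))) (f₂ := fun a => p z (κ' (a 0) (a 1)))
      ((p z).isPlot_comp (hs hκ)) ((p z).isPlot_comp (hs hκ'))
      (rankLE_one_of_comp (p z).smooth (hs hκ)) (rankLE_one_of_comp (p z).smooth (hs hκ'))
      (fun b hb => by rw [hF, if_pos hb]) (fun b hb => by rw [hF, if_neg (not_le.2 hb)])
  rank_two Γ := by
    have hs : ∀ {κ : ℝ → ℝ → ℝ}, (ContDiff ℝ ∞ fun q : ℝ × ℝ => κ q.1 q.2) →
        ContDiff ℝ ∞ fun a : Eu 3 => κ (a 0) (a 2) := fun h =>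
      h.comp ((contDiff_coord 0).prodMk (contDiff_coord 2))
    have hΓ : ∀ n (l : Fin n), IsPlot fun a : Eu n => Γ (a l) := fun n l =>
      Γ.isPlot_comp (contDiff_coord l)
    have hpΓ : ∀ n (l : Fin n), IsPlot fun a : Eu n => p (Γ (a l)) := fun n l => hp _ _ (hΓ n l)
    -- Each piece of the three-parameter map factors through this two-parameter map, whence rank
    -- two.
    have h2 : IsPlot fun a : Eu 2 => p (Γ (a 0)) (a 1) := isPlot_eval (hpΓ 2 0) (contDiff_coord 1)
    exact RankLE.glue 2 (1 / 2)
      (isPlot_evalP (smooth 3 _ _ (contDiff_coord 0) (hΓ 3 1)) (contDiff_coord 2))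
      (f₁ := fun a => p (Γ (a 1)) (κ (a 0) (a 2))) (f₂ := fun a => p (Γ (a 1)) (κ' (a 0) (a 2)))
      (isPlot_eval (hpΓ 3 1) (hs hκ)) (isPlot_eval (hpΓ 3 1) (hs hκ'))
      (RankLE.comp₂ (H := fun s t => p (Γ s) t) h2 (rankLE_self _) (contDiff_coord 1) (hs hκ))
      (RankLE.comp₂ (H := fun s t => p (Γ s) t) h2 (rankLE_self _) (contDiff_coord 1) (hs hκ'))
      (fun b hb => by rw [hF, if_pos hb]) (fun b hb => by rw [hF, if_neg (not_le.2 hb)])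

variable {F : ℝ → Z → T.P i j} (hF : IsDeformation F)

theorem IsDeformation.dSmooth (hF : IsDeformation F) (r : ℝ) : DSmooth (F r) :=
  fun n z hz => hF.smooth n (fun _ => r) z contDiff_const hz

/-- The path from `F 0 z` to `F 1 z`. -/
def IsDeformation.path (z : Z) : DPath (T.P i j) where
  -- Running the parameter through `step` creates the sitting instants.
  toFun r := F (step r) z
  smooth n _ hp := hF.smooth n _ _ (contDiff_step.comp hp.contDiff) isPlot_const
  sit := by
    refine ⟨1 / 4, by norm_num, fun t ht => ?_, fun t ht => ?_⟩
    · rw [step_of_le ht, step_zero]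
    · rw [step_of_ge (by linarith), step_one]

theorem IsDeformation.path_zero (z : Z) : hF.path z 0 = F 0 z := by
  change F (step 0) z = _
  rw [step_zero]

theorem IsDeformation.path_one (z : Z) : hF.path z 1 = F 1 z := by
  change F (step 1) z = _
  rw [step_one]

theorem IsDeformation.fixedEndsThin (z : Z) : FixedEndsThin (hF.path z) := by
  refine ⟨fun s => ?_, ?_⟩
  · exact ⟨(hF.ends _ z).1.trans (hF.ends (step 0) z).1.symm,
      (hF.ends _ z).2.trans (hF.ends (step 0) z).2.symm⟩
  · exact RankLE.comp₂ (H := fun s t => (F s z).1 t)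
      (isPlot_evalP (hF.smooth 2 _ _ (contDiff_coord 0) isPlot_const) (contDiff_coord 1))
      (hF.rank_one z) (contDiff_step.comp (contDiff_coord 0)) (contDiff_coord 1)

theorem IsDeformation.thinEq (hF : IsDeformation F) (z : Z) : ThinEq (F 0 z) (F 1 z) :=
  ⟨hF.path z, hF.fixedEndsThin z, hF.path_zero z, hF.path_one z⟩

/-- The homotopy from `F 0 ∘ Γ` to `F 1 ∘ Γ`. -/
def IsDeformation.homotopy (Γ : DPath Z) : DPath (DPath (T.P i j)) where
  toFun r := Γ.map (F (step r)) (hF.dSmooth _)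
  smooth n p hp := fun m g τ hg hτ =>
    hF.smooth m _ _ (contDiff_step.comp (hp.contDiff.comp hg)) (Γ.isPlot_comp hτ)
  sit := by
    refine ⟨1 / 4, by norm_num, fun t ht => ?_, fun t ht => ?_⟩
    · refine DPath.ext (funext fun s => ?_)
      change F (step t) (Γ s) = F (step 0) (Γ s)
      rw [step_of_le ht, step_zero]
    · refine DPath.ext (funext fun s => ?_)
      change F (step t) (Γ s) = F (step 1) (Γ s)
      rw [step_of_ge (by linarith), step_one]

theorem IsDeformation.homotopy_zero (Γ : DPath Z) :
    hF.homotopy Γ 0 = Γ.map (F 0) (hF.dSmooth 0) := by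
  refine DPath.ext (funext fun s => ?_)
  change F (step 0) (Γ s) = F 0 (Γ s)
  rw [step_zero]

theorem IsDeformation.homotopy_one (Γ : DPath Z) :
    hF.homotopy Γ 1 = Γ.map (F 1) (hF.dSmooth 1) := by
  refine DPath.ext (funext fun s => ?_)
  change F (step 1) (Γ s) = F 1 (Γ s)
  rw [step_one]

theorem IsDeformation.homotopy_ends (Γ : DPath Z) (r s : ℝ) :
    (hF.homotopy Γ r s).1 0 = (hF.homotopy Γ 0 s).1 0 ∧
      (hF.homotopy Γ r s).1 1 = (hF.homotopy Γ 0 s).1 1 :=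
  ⟨(hF.ends _ _).1.trans (hF.ends (step 0) _).1.symm,
    (hF.ends _ _).2.trans (hF.ends (step 0) _).2.symm⟩

theorem IsDeformation.homotopy_rank (Γ : DPath Z) :
    T.RankLE 2 fun a : Eu 3 => (hF.homotopy Γ (a 0) (a 1)).1 (a 2) := by
  have hθ : ContDiff ℝ ∞ fun a : Eu 3 => (!₂[step (a 0), a 1, a 2] : Eu 3) := by
    refine contDiff_euclidean.2 fun l => ?_
    fin_cases l
    · exact (contDiff_step.comp (contDiff_coord (n := 3) 0) :
        ContDiff ℝ ∞ fun a : Eu 3 => step (a 0))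
    · simpa using contDiff_coord (n := 3) 1
    · simpa using contDiff_coord (n := 3) 2
  have hp : IsPlot fun a : Eu 3 => (F (a 0) (Γ (a 1))).1 (a 2) :=
    isPlot_evalP (hF.smooth 3 _ _ (contDiff_coord 0) (Γ.isPlot_comp (contDiff_coord 1)))
      (contDiff_coord 2)
  have e : (fun a : Eu 3 => (hF.homotopy Γ (a 0) (a 1)).1 (a 2)) = fun a : Eu 3 =>
      (fun b : Eu 3 => (F (b 0) (Γ (b 1))).1 (b 2)) !₂[step (a 0), a 1, a 2] := by
    funext a
    change (F (step (a 0)) (Γ (a 1))).1 (a 2) = _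
    simp
  rw [e]
  exact RankLE.comp hp (hF.rank_two Γ) hθ

end Deformation

/-! ### Reparametrization of paths between branes -/

/-- The reparametrization of a path between branes. -/
def reparam (γ : T.P i j) (κ : ℝ → ℝ) (h : IsReparam κ) : T.P i j :=
  ⟨γ.1.reparam κ h, by rw [DPath.reparam_zero]; exact γ.2.1,
    by rw [DPath.reparam_one]; exact γ.2.2⟩

theorem isDeformation_reparam {κ : ℝ → ℝ → ℝ} (hκ : ContDiff ℝ ∞ fun q : ℝ × ℝ => κ q.1 q.2)
    (h : ∀ r, IsReparam (κ r)) :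
    IsDeformation fun (r : ℝ) (γ : T.P i j) => reparam γ (κ r) (h r) :=
  .of_piecewise (fun _ _ _ hr hz => isPlot_reparamFamily hκ h (isPlot_subtype_iff.1 hz) hr)
    (fun r γ => ⟨(γ.1.reparam_zero _ (h r)).trans (γ.1.reparam_zero _ (h 0)).symm,
      (γ.1.reparam_one _ (h r)).trans (γ.1.reparam_one _ (h 0)).symm⟩)
    (p := Subtype.val) dSmooth_val hκ hκ (fun _ _ _ => (ite_self _).symm)

/-- The deformation of `γ` into `γ ⋆ cp`. -/
def delay (r t : ℝ) : ℝ := t + step r * (t - 1)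

theorem contDiff_delay : ContDiff ℝ ∞ fun q : ℝ × ℝ => delay q.1 q.2 :=
  contDiff_snd.add ((contDiff_step.comp contDiff_fst).mul (contDiff_snd.sub contDiff_const))

/-- With `step r` in [0, 1] for every real r, 1 - `delay r t` is (1 - t) times a factor between 1
and 2. -/
theorem isReparam_delay (r : ℝ) : IsReparam (delay r) := by
  refine isReparam_of_contDiff contDiff_delay (fun r t => ?_) (fun r t => ?_) r
  all_goals
    have h0 := step_nonneg r
    have h1 := step_le_one r
    simp only [delay]
  · rcases le_total t 0 with ht | ht
    · rw [max_eq_right ht]; nlinarith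
    · rw [max_eq_left ht]; nlinarith
  · rcases le_total t 1 with ht | ht
    · rw [max_eq_left (by linarith)]; nlinarith
    · rw [max_eq_right (by linarith)]; nlinarith

/-- The deformation of `γ` into `cp ⋆ γ`. -/
def hasten (r t : ℝ) : ℝ := t + step r * t

theorem contDiff_hasten : ContDiff ℝ ∞ fun q : ℝ × ℝ => hasten q.1 q.2 :=
  contDiff_snd.add ((contDiff_step.comp contDiff_fst).mul contDiff_snd)

theorem isReparam_hasten (r : ℝ) : IsReparam (hasten r) := by
  refine isReparam_of_contDiff contDiff_hasten (fun r t => ?_) (fun r t => ?_) r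
  all_goals
    have h0 := step_nonneg r
    have h1 := step_le_one r
    simp only [hasten]
  · rcases le_total t 0 with ht | ht
    · rw [max_eq_right ht]; nlinarith
    · rw [max_eq_left ht]; nlinarith
  · rcases le_total t 1 with ht | ht
    · rw [max_eq_left (by linarith)]; nlinarith
    · rw [max_eq_right (by linarith)]; nlinarith

/-- The deformation of `γ` into a path with sitting instants independent of `γ`. -/
def settle (r t : ℝ) : ℝ := t + step r * (step t - t)

theorem contDiff_settle : ContDiff ℝ ∞ fun q : ℝ × ℝ => settle q.1 q.2 :=
  contDiff_snd.add ((contDiff_step.comp contDiff_fst).mul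
    ((contDiff_step.comp contDiff_snd).sub contDiff_snd))

theorem step_le (t : ℝ) : step t ≤ 4 * max t 0 := by
  rcases le_total t (1 / 4) with h | h
  · rw [step_of_le h]; positivity
  · rw [max_eq_left (by linarith)]
    linarith [step_le_one t]

theorem step_ge (t : ℝ) : 1 - step t ≤ 4 * max (1 - t) 0 := by
  rcases le_total (3 / 4) t with h | h
  · rw [step_of_ge h, sub_self]; positivity
  · rw [max_eq_left (by linarith)]
    linarith [step_nonneg t]

theorem isReparam_settle (r : ℝ) : IsReparam (settle r) := by
  refine isReparam_of_contDiff contDiff_settle (fun r t => ?_) (fun r t => ?_) r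
  all_goals
    have h0 := step_nonneg r
    have h1 := step_le_one r
    simp only [settle]
  · have h2 := step_le t
    have h3 : t ≤ 4 * max t 0 := by
      have := le_max_left t 0
      have := le_max_right t 0
      linarith
    nlinarith
  · have h2 := step_ge t
    have h3 : 1 - t ≤ 4 * max (1 - t) 0 := by
      have := le_max_left (1 - t) 0
      have := le_max_right (1 - t) 0
      linarith
    nlinarith

theorem reparam_delay_zero (γ : T.P i j) : reparam γ (delay 0) (isReparam_delay 0) = γ :=
  Subtype.ext (DPath.ext (funext fun t => by
    change γ.1 (t + step 0 * (t - 1)) = γ.1 t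
    rw [step_zero, zero_mul, add_zero]))

theorem reparam_delay_one (γ : T.P i j) :
    reparam γ (delay 1) (isReparam_delay 1) = comp γ (cp (ev₀ γ)) rfl :=
  Subtype.ext (DPath.ext (funext fun t => by
    change γ.1 (t + step 1 * (t - 1)) = if t ≤ 1 / 2 then γ.1 0 else γ.1 (2 * t - 1)
    rw [step_one]
    split_ifs with h
    · exact γ.1.eq_of_le_zero (by linarith)
    · congr 1; ring))

theorem reparam_hasten_zero (γ : T.P i j) : reparam γ (hasten 0) (isReparam_hasten 0) = γ :=
  Subtype.ext (DPath.ext (funext fun t => by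
    change γ.1 (t + step 0 * t) = γ.1 t
    rw [step_zero, zero_mul, add_zero]))

theorem reparam_hasten_one (γ : T.P i j) :
    reparam γ (hasten 1) (isReparam_hasten 1) = comp (cp (ev₁ γ)) γ rfl :=
  Subtype.ext (DPath.ext (funext fun t => by
    change γ.1 (t + step 1 * t) = if t ≤ 1 / 2 then γ.1 (2 * t) else γ.1 1
    rw [step_one]
    split_ifs with h
    · congr 1; ring
    · exact γ.1.eq_of_one_le (by linarith)))

/-- `γ̄' ⋆ γ'` for reparametrizations `γ'` of `γ`. -/
def backForth (r : ℝ) (γ : T.P i j) : T.P i i :=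
  comp (rev (reparam γ (settle r) (isReparam_settle r)))
    (reparam γ (settle r) (isReparam_settle r)) (rev_zero _).symm

/-- The tent function traced by γ̄ ⋆ γ has a corner at 1/2, which is harmless only because γ is
constant near its end. Scaling the tent towards 0 would destroy smoothness, so γ is settled first:
this replaces the tent by the smooth function `bump`, which can then be scaled. -/
theorem isDeformation_backForth : IsDeformation (backForth : ℝ → T.P i j → T.P i i) := by
  have k₁ : ContDiff ℝ ∞ fun q : ℝ × ℝ => (q.1, 2 * q.2) :=
    contDiff_fst.prodMk (contDiff_const.mul contDiff_snd)
  have k₂ : ContDiff ℝ ∞ fun q : ℝ × ℝ => (q.1, 1 - (2 * q.2 - 1)) :=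
    contDiff_fst.prodMk (contDiff_const.sub ((contDiff_const.mul contDiff_snd).sub contDiff_const))
  refine .of_piecewise (fun n r z hr hz => ?_) (fun r γ => ?_) (p := Subtype.val) dSmooth_val
    (κ := fun r t => settle r (2 * t)) (κ' := fun r t => settle r (1 - (2 * t - 1)))
    (contDiff_settle.comp k₁) (contDiff_settle.comp k₂) (fun r γ t => rfl)
  · have h := (isDeformation_reparam (T := T) (i := i) (j := j) contDiff_settle
      isReparam_settle).smooth n r z hr hz
    exact dSmooth_conc n (fun b => (⟨(rev (reparam (z b) (settle (r b)) (isReparam_settle _)),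
      reparam (z b) (settle (r b)) (isReparam_settle _)), (rev_zero _).symm⟩ : T.Comp i j i))
      (isPlot_subtype_iff.2 (isPlot_prod_iff.2 ⟨dSmooth_revP _ _ h, h⟩))
  · have h : ∀ r, (backForth r γ).1 0 = γ.1 0 ∧ (backForth r γ).1 1 = γ.1 0 := fun r => by
      rw [backForth, comp_zero, comp_one, rev_one]
      exact ⟨γ.1.reparam_zero _ (isReparam_settle r), γ.1.reparam_zero _ (isReparam_settle r)⟩
    exact ⟨(h r).1.trans (h 0).1.symm, (h r).2.trans (h 0).2.symm⟩

theorem backForth_zero (γ : T.P i j) : backForth 0 γ = comp (rev γ) γ (rev_zero γ).symm := by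
  have h : reparam γ (settle 0) (isReparam_settle 0) = γ :=
    Subtype.ext (DPath.ext (funext fun t => by
      change γ.1 (t + step 0 * (step t - t)) = γ.1 t
      rw [step_zero, zero_mul, add_zero]))
  simp only [backForth, h]

/-! ### Contraction of a settled back-and-forth path -/

/-- A smooth function with sitting instants which goes from `0` to `1` and back. -/
def bump (t : ℝ) : ℝ := step (2 * t) * step (2 - 2 * t)

theorem contDiff_bump : ContDiff ℝ ∞ bump :=
  (contDiff_step.comp (contDiff_const.mul contDiff_id)).mul
    (contDiff_step.comp (contDiff_const.sub (contDiff_const.mul contDiff_id)))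

theorem bump_of_le {t : ℝ} (h : t ≤ 1 / 8) : bump t = 0 := by
  rw [bump, step_of_le (by linarith), zero_mul]

theorem bump_of_ge {t : ℝ} (h : 7 / 8 ≤ t) : bump t = 0 := by
  rw [bump, step_of_le (t := 2 - 2 * t) (by linarith), mul_zero]

/-- The retraction of `γ̄ ⋆ γ` to its initial point. -/
def retract (r : ℝ) (γ : T.P i j) : T.P i i :=
  ⟨{toFun := fun t => γ.1 ((1 - step r) * bump t)
    smooth := γ.1.smooth.comp ((contDiff_const.mul contDiff_bump :
      ContDiff ℝ ∞ fun t => (1 - step r) * bump t).dSmooth)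
    sit := by
      refine ⟨1 / 8, by norm_num, fun t ht => ?_, fun t ht => ?_⟩
      · rw [bump_of_le ht, bump_of_le (by norm_num)]
      · rw [bump_of_ge (by linarith), bump_of_ge (by norm_num)] },
    by
      change γ.1 ((1 - step r) * bump 0) ∈ _
      rw [bump_of_le (by norm_num), mul_zero]; exact γ.2.1,
    by
      change γ.1 ((1 - step r) * bump 1) ∈ _
      rw [bump_of_ge (by norm_num), mul_zero]; exact γ.2.1⟩

theorem isDeformation_retract : IsDeformation (retract : ℝ → T.P i j → T.P i i) := by
  have hs : ContDiff ℝ ∞ fun q : ℝ × ℝ => (1 - step q.1) * bump q.2 :=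
    (contDiff_const.sub (contDiff_step.comp contDiff_fst)).mul (contDiff_bump.comp contDiff_snd)
  refine .of_piecewise (fun n r z hr hz => ?_) (fun r γ => ?_) (p := Subtype.val) dSmooth_val
    hs hs (fun r γ t => (ite_self _).symm)
  · exact fun m g τ hg hτ => isPlot_subtype_iff.1 hz m g _ hg
      (hs.comp ((hr.comp hg).prodMk hτ))
  · have h : ∀ r, (retract r γ).1 0 = γ.1 0 ∧ (retract r γ).1 1 = γ.1 0 := fun r => by
      refine ⟨?_, ?_⟩
      · change γ.1 ((1 - step r) * bump 0) = _
        rw [bump_of_le (by norm_num), mul_zero]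
      · change γ.1 ((1 - step r) * bump 1) = _
        rw [bump_of_ge (by norm_num), mul_zero]
    exact ⟨(h r).1.trans (h 0).1.symm, (h r).2.trans (h 0).2.symm⟩

/-- On each half of the interval one of the two factors of `bump` is identically 1. -/
theorem backForth_one (γ : T.P i j) : backForth 1 γ = retract 0 γ :=
  Subtype.ext (DPath.ext (funext fun t => by
    change (if t ≤ 1 / 2 then γ.1 (2 * t + step 1 * (step (2 * t) - 2 * t)) else
      γ.1 (1 - (2 * t - 1) + step 1 * (step (1 - (2 * t - 1)) - (1 - (2 * t - 1))))) =
      γ.1 ((1 - step 0) * (step (2 * t) * step (2 - 2 * t)))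
    rw [step_one, step_zero]
    split_ifs with h
    · rw [step_of_ge (t := 2 - 2 * t) (by linarith)]; congr 1; ring
    · rw [step_of_ge (t := 2 * t) (by linarith), show 1 - (2 * t - 1) = 2 - 2 * t by ring]
      congr 1; ring))

theorem retract_one (γ : T.P i j) : retract 1 γ = cp (ev₀ γ) :=
  Subtype.ext (DPath.ext (funext fun t => by
    change γ.1 ((1 - step 1) * bump t) = γ.1 0
    rw [step_one, sub_self, zero_mul]))

/-! ### Thin equivalences -/

theorem thinEq_comp_cp (γ : T.P i j) : ThinEq γ (comp γ (cp (ev₀ γ)) rfl) := by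
  have h := (isDeformation_reparam (T := T) (i := i) (j := j) contDiff_delay
    isReparam_delay).thinEq γ
  simp only [reparam_delay_zero, reparam_delay_one] at h
  exact h

theorem thinEq_cp_comp (γ : T.P i j) : ThinEq γ (comp (cp (ev₁ γ)) γ rfl) := by
  have h := (isDeformation_reparam (T := T) (i := i) (j := j) contDiff_hasten
    isReparam_hasten).thinEq γ
  simp only [reparam_hasten_zero, reparam_hasten_one] at h
  exact h

/-- The two deformations, settling and then retracting, are joined at `backForth_one`. -/
theorem thinEq_rev_comp (γ : T.P i j) : ThinEq (comp (rev γ) γ (rev_zero γ).symm) (cp (ev₀ γ)) := by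
  have h := isDeformation_backForth.thinEq γ
  have h' := isDeformation_retract.thinEq γ
  rw [backForth_zero, backForth_one] at h
  rw [retract_one] at h'
  exact h.trans h'

theorem thinEq_comp_rev (γ : T.P i j) : ThinEq (comp γ (rev γ) (rev_one γ)) (cp (ev₁ γ)) := by
  have h := thinEq_rev_comp (rev γ)
  have e : ev₀ (rev γ) = ev₁ γ := Subtype.ext (rev_zero γ)
  simp only [rev_rev, e] at h
  exact h

/-- The paths between `(γ₃ ⋆ γ₂) ⋆ (cp ⋆ γ₁)` and `(γ₃ ⋆ cp) ⋆ (γ₂ ⋆ γ₁)`, as maps. -/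
def slideMap (γ₁ : T.P i j) (γ₂ : T.P j k) (γ₃ : T.P k l) (r t : ℝ) : T.M :=
  if t - 1 / 4 ≤ 0 then γ₁.1 (4 * t) else
    -- Only γ₂ moves: its run, of length 1/4, slides from [1/2, 3/4] at r = 0 to [1/4, 1/2] at r =
    -- 1, and it rests at its end points on the remainder of [1/4, 3/4].
    if t - 3 / 4 ≤ 0 then γ₂.1 (4 * t - 2 + step r) else γ₃.1 (4 * t - 3)

variable {γ₁ : T.P i j} {γ₂ : T.P j k} {γ₃ : T.P k l}

theorem isPlot_slideMap (h : γ₁.1 1 = γ₂.1 0) (h' : γ₂.1 1 = γ₃.1 0) {n : ℕ} {r t : Eu n → ℝ}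
    (hr : ContDiff ℝ ∞ r) (ht : ContDiff ℝ ∞ t) :
    IsPlot fun b => slideMap γ₁ γ₂ γ₃ (r b) (t b) := by
  have k4 : ContDiff ℝ ∞ fun b => 4 * t b := contDiff_const.mul ht
  have h2 : IsPlot fun b => γ₂.1 (4 * t b - 2 + step (r b)) :=
    γ₂.1.isPlot_comp ((k4.sub contDiff_const).add (contDiff_step.comp hr))
  have h3 : IsPlot fun b => γ₃.1 (4 * t b - 3) := γ₃.1.isPlot_comp (k4.sub contDiff_const)
  have inner : IsPlot fun b => if t b - 3 / 4 ≤ 0 then γ₂.1 (4 * t b - 2 + step (r b)) else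
      γ₃.1 (4 * t b - 3) := fun a =>
    contMDiffAt_glue h2 h3 (isPlot_const (x := γ₂.1 1)) (ht.continuous.sub continuous_const)
      (fun b hb => γ₂.1.eq_of_one_le (by linarith [step_nonneg (r b)]))
      (fun b hb => (γ₃.1.eq_of_le_zero (by linarith)).trans h'.symm)
  exact fun a => contMDiffAt_glue (γ₁.1.isPlot_comp k4) inner (isPlot_const (x := γ₁.1 1))
      (ht.continuous.sub continuous_const) (fun b hb => γ₁.1.eq_of_one_le (by linarith))
      (fun b hb => by
        change (if t b - 3 / 4 ≤ 0 then _ else _) = _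
        rw [if_pos (by linarith), h]
        exact γ₂.1.eq_of_le_zero (by linarith [step_le_one (r b)]))

/-- The paths between `(γ₃ ⋆ γ₂) ⋆ (cp ⋆ γ₁)` and `(γ₃ ⋆ cp) ⋆ (γ₂ ⋆ γ₁)`. -/
def slide (h : γ₁.1 1 = γ₂.1 0) (h' : γ₂.1 1 = γ₃.1 0) (r : ℝ) : T.P i l :=
  ⟨{toFun := slideMap γ₁ γ₂ γ₃ r
    smooth := fun _ _ hp => isPlot_slideMap h h' contDiff_const hp.contDiff
    sit := by
      obtain ⟨ε, hε, h0, -⟩ := γ₁.1.sit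
      obtain ⟨δ, hδ, -, h1⟩ := γ₃.1.sit
      refine ⟨min (1 / 8) (min (ε / 4) (δ / 4)), by positivity, fun t ht => ?_, fun t ht => ?_⟩
      · have h4 : t ≤ 1 / 8 := ht.trans (min_le_left _ _)
        have h5 : t ≤ ε / 4 := ht.trans ((min_le_right _ _).trans (min_le_left _ _))
        rw [slideMap, slideMap, if_pos (by linarith), if_pos (by norm_num), h0 _ (by linarith),
          mul_zero]
      · have h4 : min (1 / 8) (min (ε / 4) (δ / 4)) ≤ 1 / 8 := min_le_left _ _
        have h5 : min (1 / 8) (min (ε / 4) (δ / 4)) ≤ δ / 4 :=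
          (min_le_right _ _).trans (min_le_right _ _)
        have h6 : t ≥ 1 - min (1 / 8) (min (ε / 4) (δ / 4)) := ht
        rw [slideMap, slideMap, if_neg (by linarith), if_neg (by linarith), if_neg (by norm_num),
          if_neg (by norm_num), h1 _ (by linarith)]
        norm_num },
    by
      change slideMap γ₁ γ₂ γ₃ r 0 ∈ _
      rw [slideMap, if_pos (by norm_num), mul_zero]
      exact γ₁.2.1,
    by
      change slideMap γ₁ γ₂ γ₃ r 1 ∈ _
      rw [slideMap, if_neg (by norm_num), if_neg (by norm_num)]
      norm_num
      exact γ₃.2.2⟩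

/-- Three pieces, each factoring through one real variable, glue to a map of rank one. The parameter
space of the deformation plays no role: the family is constant in it. -/
theorem thinEq_slide (h : γ₁.1 1 = γ₂.1 0) (h' : γ₂.1 1 = γ₃.1 0) :
    ThinEq (slide h h' 0) (slide h h' 1) := by
  have sm : ∀ {n : ℕ} {r : Eu n → ℝ}, ContDiff ℝ ∞ r → IsPlot fun b => slide h h' (r b) :=
    fun hr m g τ hg hτ => isPlot_slideMap h h' (hr.comp hg) hτ
  have k4 : ContDiff ℝ ∞ fun b : Eu 2 => 4 * b 1 := contDiff_const.mul (contDiff_coord 1)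
  have k2 : ContDiff ℝ ∞ fun b : Eu 2 => 4 * b 1 - 2 + step (b 0) :=
    (k4.sub contDiff_const).add (contDiff_step.comp (contDiff_coord 0))
  have k3 : ContDiff ℝ ∞ fun b : Eu 2 => 4 * b 1 - 3 := k4.sub contDiff_const
  have inner : IsPlot fun b : Eu 2 => if b 1 - 3 / 4 ≤ 0 then γ₂.1 (4 * b 1 - 2 + step (b 0)) else
      γ₃.1 (4 * b 1 - 3) := fun a =>
    contMDiffAt_glue (γ₂.1.isPlot_comp k2) (γ₃.1.isPlot_comp k3) (isPlot_const (x := γ₂.1 1))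
      ((contDiff_coord 1).continuous.sub continuous_const)
      (fun b hb => γ₂.1.eq_of_one_le (by linarith [step_nonneg (b 0)]))
      (fun b hb => (γ₃.1.eq_of_le_zero (by linarith)).trans h'.symm)
  have hF : IsDeformation fun (r : ℝ) (_ : T.P i j) => slide h h' r :=
    { smooth := fun n r z hr _ => sm hr
      ends := fun r _ => ⟨by
          change slideMap γ₁ γ₂ γ₃ r 0 = slideMap γ₁ γ₂ γ₃ 0 0
          rw [slideMap, slideMap, if_pos (by norm_num), if_pos (by norm_num)], by
          change slideMap γ₁ γ₂ γ₃ r 1 = slideMap γ₁ γ₂ γ₃ 0 1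
          rw [slideMap, slideMap, if_neg (by norm_num), if_neg (by norm_num), if_neg (by norm_num),
            if_neg (by norm_num)]⟩
      rank_one := fun _ => RankLE.glue 1 (1 / 4)
        (isPlot_slideMap h h' (contDiff_coord 0) (contDiff_coord 1)) (γ₁.1.isPlot_comp k4) inner
        (rankLE_one_of_comp γ₁.1.smooth k4)
        (RankLE.glue 1 (3 / 4) inner (γ₂.1.isPlot_comp k2) (γ₃.1.isPlot_comp k3)
          (rankLE_one_of_comp γ₂.1.smooth k2) (rankLE_one_of_comp γ₃.1.smooth k3)
          (fun b hb => if_pos (by linarith)) (fun b hb => if_neg (by linarith)))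
        (fun b hb => if_pos (by linarith)) (fun b hb => if_neg (by linarith))
      rank_two := fun Γ => by
        exact RankLE.comp₂ (H := fun s t => (slide h h' s).1 t)
          (isPlot_slideMap h h' (contDiff_coord 0) (contDiff_coord 1)) (rankLE_self _)
          (contDiff_coord 0) (contDiff_coord 2) }
  exact hF.thinEq γ₁

/-- Concatenation is associative up to thin homotopy. -/
theorem thinEq_assoc (h : γ₁.1 1 = γ₂.1 0) (h' : γ₂.1 1 = γ₃.1 0) :
    ThinEq (comp (comp γ₃ γ₂ h') γ₁ (h.trans (comp_zero _ _ _).symm))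
      (comp γ₃ (comp γ₂ γ₁ h) ((comp_one _ _ _).trans h')) := by
  -- Inserting constant paths next to γ₁ on one side and next to γ₃ on the other puts γ₁ on the
  -- first quarter and γ₃ on the last quarter in both bracketings, so that only the middle has to
  -- slide. The inserted constants are removed up to thin equivalence at the end.
  have e₀ : slide h h' 0 = comp (comp γ₃ γ₂ h') (comp (cp (ev₁ γ₁)) γ₁ rfl)
      ((comp_one _ _ _).trans (h.trans (comp_zero _ _ _).symm)) :=
    Subtype.ext (DPath.ext (funext fun t => by
      change slideMap γ₁ γ₂ γ₃ 0 t = if t ≤ 1 / 2 then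
        (if 2 * t ≤ 1 / 2 then γ₁.1 (2 * (2 * t)) else γ₁.1 1) else
        (if 2 * t - 1 ≤ 1 / 2 then γ₂.1 (2 * (2 * t - 1)) else γ₃.1 (2 * (2 * t - 1) - 1))
      rw [slideMap, step_zero]
      rcases le_or_gt t (1 / 4) with h1 | h1
      · rw [if_pos (by linarith), if_pos (by linarith), if_pos (by linarith)]; congr 1; ring
      rw [if_neg (by linarith)]
      rcases le_or_gt t (1 / 2) with h2 | h2
      · rw [if_pos (by linarith), if_pos h2, if_neg (by linarith), h]
        exact γ₂.1.eq_of_le_zero (by linarith)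
      rw [if_neg (not_le.2 h2)]
      rcases le_or_gt t (3 / 4) with h3 | h3
      · rw [if_pos (by linarith), if_pos (by linarith)]; congr 1; ring
      · rw [if_neg (by linarith), if_neg (by linarith)]; congr 1; ring))
  have e₁ : slide h h' 1 = comp (comp γ₃ (cp (ev₀ γ₃)) rfl) (comp γ₂ γ₁ h)
      ((comp_one _ _ _).trans (h'.trans (comp_zero γ₃ (cp (ev₀ γ₃)) rfl).symm)) :=
    Subtype.ext (DPath.ext (funext fun t => by
      change slideMap γ₁ γ₂ γ₃ 1 t = if t ≤ 1 / 2 then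
        (if 2 * t ≤ 1 / 2 then γ₁.1 (2 * (2 * t)) else γ₂.1 (2 * (2 * t) - 1)) else
        (if 2 * t - 1 ≤ 1 / 2 then γ₃.1 0 else γ₃.1 (2 * (2 * t - 1) - 1))
      rw [slideMap, step_one]
      rcases le_or_gt t (1 / 4) with h1 | h1
      · rw [if_pos (by linarith), if_pos (by linarith), if_pos (by linarith)]; congr 1; ring
      rw [if_neg (by linarith)]
      rcases le_or_gt t (1 / 2) with h2 | h2
      · rw [if_pos (by linarith), if_pos h2, if_neg (by linarith)]; congr 1; ring
      rw [if_neg (not_le.2 h2)]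
      rcases le_or_gt t (3 / 4) with h3 | h3
      · rw [if_pos (by linarith), if_pos (by linarith), ← h']
        exact γ₂.1.eq_of_one_le (by linarith)
      · rw [if_neg (by linarith), if_neg (by linarith)]; congr 1; ring))
  have t := thinEq_slide h h'
  rw [e₀, e₁] at t
  exact ((ThinEq.refl _).comp (thinEq_cp_comp γ₁) _ _).trans
    (t.trans ((thinEq_comp_cp γ₃).symm.comp (ThinEq.refl _) _ _))

end TargetSpace

/-! ### Transport along constant paths and along thin paths -/

namespace VecFam

variable {X : Type u} [DiffeologicalSpace X] {E : VecFam.{u, v} X} {ptE : E.Transport}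

/-- The constant path concatenated with itself is itself, so its transport is idempotent; being
invertible, it is the identity. -/
theorem IsConnection.along_const (hE : E.IsConnection ptE) (x : X) (e : E x) :
    along ptE (DPath.const x) rfl rfl e = e := by
  have h := (hE.along_comp (DPath.const x) (DPath.const x) rfl rfl rfl rfl e).trans
    (along_congr (DPath.const_comp_const x) _ _ e)
  exact (along ptE (DPath.const x) rfl rfl).injective h

end VecFam

theorem HermBundle.herm_cast {X : Type u} [DiffeologicalSpace X] (E : HermBundle.{u, v} X) {x y : X}
    (h : x = y) (e f : E x) :
    E.herm y (E.toVecFam.cast h e) (E.toVecFam.cast h f) = E.herm x e f := by subst h; rfl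

namespace TargetSpace

variable {I : Type w} {T : TargetSpace.{u, w} I} {i j : I} {E : VecFam.{u, v} (T.P i j)}
  {pt : E.Transport}

theorem IsSuperficial.along_thin (S : IsSuperficial E pt) {Γ₁ Γ₂ : DPath (T.P i j)}
    (t₁ : FixedEndsThin Γ₁) (t₂ : FixedEndsThin Γ₂) {x y : T.P i j} (h₀ : Γ₁ 0 = x) (h₁ : Γ₁ 1 = y)
    (k₀ : Γ₂ 0 = x) (k₁ : Γ₂ 1 = y) (e : E x) :
    VecFam.along pt Γ₁ h₀ h₁ e = VecFam.along pt Γ₂ k₀ k₁ e := by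
  subst h₀; subst h₁
  have h := S.thin Γ₁ Γ₂ t₁ t₂ k₀.symm k₁.symm e
  rw [VecFam.along_eq_cast Γ₂, h]
  exact (E.cast_symm_cast k₁.symm _).symm

theorem IsSuperficial.along_rankTwo (S : IsSuperficial E pt) (h : DPath (DPath (T.P i j)))
    (ends : ∀ r s, (h r s).1 0 = (h 0 s).1 0 ∧ (h r s).1 1 = (h 0 s).1 1)
    (rank : T.RankLE 2 (fun a : Eu 3 => (h (a 0) (a 1)).1 (a 2))) {x y x' y' : T.P i j}
    (h₀₀ : h 0 0 = x) (h₀₁ : h 0 1 = y) (h₁₀ : h 1 0 = x') (h₁₁ : h 1 1 = y') (e : E x) :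
    VecFam.along pt (h.map (fun Γ => Γ 1) (DPath.dSmooth_eval 1)) h₀₁ h₁₁
        (VecFam.along pt (h 0) h₀₀ h₀₁ e) =
      VecFam.along pt (h 1) h₁₀ h₁₁
        (VecFam.along pt (h.map (fun Γ => Γ 0) (DPath.dSmooth_eval 0)) h₀₀ h₁₀ e) := by
  subst h₀₀; subst h₀₁; subst h₁₀; subst h₁₁
  exact S.rankTwo h ends rank e

end TargetSpace

namespace LBGData

variable {I : Type w} {T : TargetSpace.{u, w} I} {G : LBGData.{u, v, w} T} {i j k l : I}

/-! ## Canonical isomorphisms -/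

/-- The definition of `dR` chooses some thin path and takes the value zero if there is none.
Superficiality makes the choice irrelevant, so any thin path at hand computes it. -/
theorem IsLBG.dR_eq (hG : G.IsLBG) {γ γ' : T.P i j} {Γ : DPath (T.P i j)} (h : FixedEndsThin Γ)
    (h₀ : Γ 0 = γ) (h₁ : Γ 1 = γ') (v : G.R i j γ) :
    G.dR i j γ γ' v = VecFam.along (G.ptR i j) Γ h₀ h₁ v := by
  have hex : ∃ Γ : DPath (T.P i j), FixedEndsThin Γ ∧ Γ 0 = γ ∧ Γ 1 = γ' := ⟨Γ, h, h₀, h₁⟩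
  rw [dR, VecFam.canonical, dif_pos hex]
  exact (hG.R_superficial i j).along_thin hex.choose_spec.1 h
    hex.choose_spec.2.1 hex.choose_spec.2.2 h₀ h₁ v

theorem IsLBG.dR_refl (hG : G.IsLBG) (γ : T.P i j) (v : G.R i j γ) : G.dR i j γ γ v = v := by
  rw [hG.dR_eq (γ := γ) (γ' := γ) (fixedEndsThin_const γ) rfl rfl]
  exact (hG.R_connection i j).isConnection.along_const γ v

theorem IsLBG.dR_eq_cast (hG : G.IsLBG) {γ γ' : T.P i j} (h : γ = γ') (v : G.R i j γ) :
    G.dR i j γ γ' v = (G.R i j).toVecFam.cast h v := by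
  subst h; exact hG.dR_refl γ v

theorem IsLBG.dR_dR (hG : G.IsLBG) {γ γ' γ'' : T.P i j} (h : ThinEq γ γ') (h' : ThinEq γ' γ'')
    (v : G.R i j γ) : G.dR i j γ' γ'' (G.dR i j γ γ' v) = G.dR i j γ γ'' v := by
  obtain ⟨Γ, t, h₀, h₁⟩ := h
  obtain ⟨Γ', t', h₀', h₁'⟩ := h'
  rw [hG.dR_eq t h₀ h₁, hG.dR_eq t' h₀' h₁', hG.dR_eq (t'.comp t (h₁.trans h₀'.symm))
    ((DPath.comp_zero _ _ _).trans h₀) ((DPath.comp_one _ _ _).trans h₁')]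
  exact (hG.R_connection i j).isConnection.along_comp Γ' Γ h₀ h₁ h₀' h₁' v

/-- Thin paths with fixed ends stay composable at every time and concatenate to a thin path with
fixed ends. Parallelism of `chi` along this path of pairs is the claim. -/
theorem IsLBG.chi_dR (hG : G.IsLBG) {γ₂ γ₂' : T.P j k} {γ₁ γ₁' : T.P i j} (t₂ : ThinEq γ₂ γ₂')
    (t₁ : ThinEq γ₁ γ₁') (h : γ₁.1 1 = γ₂.1 0) (h' : γ₁'.1 1 = γ₂'.1 0) (x : G.R j k γ₂)
    (y : G.R i j γ₁) :
    G.chi i j k γ₁' γ₂' h' (G.dR j k γ₂ γ₂' x) (G.dR i j γ₁ γ₁' y) =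
      G.dR i k (comp γ₂ γ₁ h) (comp γ₂' γ₁' h') (G.chi i j k γ₁ γ₂ h x y) := by
  obtain ⟨Γ₂, t₂, rfl, rfl⟩ := t₂
  obtain ⟨Γ₁, t₁, rfl, rfl⟩ := t₁
  have hs : ∀ s, (Γ₁ s).1 1 = (Γ₂ s).1 0 := fun s =>
    (t₁.1 s).2.trans (h.trans (t₂.1 s).1.symm)
  rw [hG.dR_eq t₂ rfl rfl, hG.dR_eq t₁ rfl rfl, hG.dR_eq
    (γ := comp (Γ₂ 0) (Γ₁ 0) h) (γ' := comp (Γ₂ 1) (Γ₁ 1) h') (t₂.conc t₁ hs) rfl rfl]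
  exact hG.chi_parallel i j k (pairPath Γ₂ Γ₁ hs) x y

/-- The canonical isomorphisms between fibres over `f z` and `g z` commute with parallel
transport. -/
structure IsNatural (G : LBGData.{u, v, w} T) {Z : Type u} [DiffeologicalSpace Z]
    (f g : Z → T.P i j) (hf : DSmooth f) (hg : DSmooth g) : Prop where
  thinEq : ∀ z, ThinEq (f z) (g z)
  natural : ∀ (Γ : DPath Z) (v : G.R i j (f (Γ 0))),
    G.dR i j (f (Γ 1)) (g (Γ 1))
        (VecFam.along (G.ptR i j) (Γ.map f hf) (x := f (Γ 0)) (y := f (Γ 1)) rfl rfl v) =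
      VecFam.along (G.ptR i j) (Γ.map g hg) (x := g (Γ 0)) (y := g (Γ 1)) rfl rfl
        (G.dR i j (f (Γ 0)) (g (Γ 0)) v)

section Natural

variable {Z Z' : Type u} [DiffeologicalSpace Z] [DiffeologicalSpace Z'] {f g g' : Z → T.P i j}
  {hf : DSmooth f} {hg : DSmooth g} {hg' : DSmooth g'}

theorem IsLBG.isNatural_of_eq (hG : G.IsLBG) (h : f = g) : G.IsNatural f g hf hg := by
  subst h
  exact ⟨fun z => ThinEq.refl _, fun Γ v => by rw [hG.dR_refl, hG.dR_refl]⟩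

/-- The rank-two condition is applied to the homotopy from F 0 ∘ Γ to F 1 ∘ Γ. Its two transverse
sides are the deformation paths of Γ 0 and Γ 1; these are thin, so transport along them is `dR`. -/
theorem IsLBG.isNatural_of_deformation (hG : G.IsLBG) {F : ℝ → Z → T.P i j}
    (hF : IsDeformation F) (h₀ : F 0 = f) (h₁ : F 1 = g) : G.IsNatural f g hf hg := by
  subst h₀; subst h₁
  refine ⟨hF.thinEq, fun Γ v => ?_⟩
  have key := (hG.R_superficial i j).along_rankTwo (hF.homotopy Γ) (hF.homotopy_ends Γ)
    (hF.homotopy_rank Γ) (hF.path_zero (Γ 0)) (hF.path_zero (Γ 1)) (hF.path_one (Γ 0))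
    (hF.path_one (Γ 1)) v
  have k₀ := VecFam.along_congr (ptE := G.ptR i j) (hF.homotopy_zero Γ) (hF.path_zero (Γ 0))
    (hF.path_zero (Γ 1)) v
  have k₁ := VecFam.along_congr (ptE := G.ptR i j) (hF.homotopy_one Γ) (hF.path_one (Γ 0))
    (hF.path_one (Γ 1))
  refine Eq.trans (congrArg _ k₀.symm) (Eq.trans ?_ (k₁ _))
  rw [hG.dR_eq (hF.fixedEndsThin (Γ 0)) (hF.path_zero _) (hF.path_one _),
    hG.dR_eq (hF.fixedEndsThin (Γ 1)) (hF.path_zero _) (hF.path_one _)]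
  exact key

theorem IsNatural.symm (hG : G.IsLBG) (h : G.IsNatural f g hf hg) : G.IsNatural g f hg hf := by
  refine ⟨fun z => (h.thinEq z).symm, fun Γ v => ?_⟩
  have e := h.natural Γ (G.dR i j _ _ v)
  rw [hG.dR_dR (h.thinEq (Γ 0)).symm (h.thinEq (Γ 0)), hG.dR_refl] at e
  rw [← e, hG.dR_dR (h.thinEq (Γ 1)) (h.thinEq (Γ 1)).symm, hG.dR_refl]

theorem IsNatural.trans (hG : G.IsLBG) (h : G.IsNatural f g hf hg) (h' : G.IsNatural g g' hg hg') :
    G.IsNatural f g' hf hg' :=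
  ⟨fun z => (h.thinEq z).trans (h'.thinEq z), fun Γ v => by
    rw [← hG.dR_dR (h.thinEq (Γ 1)) (h'.thinEq (Γ 1)), h.natural, h'.natural,
      hG.dR_dR (h.thinEq (Γ 0)) (h'.thinEq (Γ 0))]⟩

theorem IsNatural.precomp (h : G.IsNatural f g hf hg) {s : Z' → Z} (hs : DSmooth s) :
    G.IsNatural (fun z => f (s z)) (fun z => g (s z)) (hf.comp hs) (hg.comp hs) :=
  ⟨fun _ => h.thinEq _, fun Γ v => h.natural (Γ.map s hs) v⟩

end Natural

theorem dSmooth_comp_of {Z : Type u} [DiffeologicalSpace Z] {r₂ : Z → T.P j k} {r₁ : Z → T.P i j}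
    (h₂ : DSmooth r₂) (h₁ : DSmooth r₁) (h : ∀ z, (r₁ z).1 1 = (r₂ z).1 0) :
    DSmooth fun z => comp (r₂ z) (r₁ z) (h z) := fun n p hp =>
  dSmooth_conc n (fun b => (⟨(r₂ (p b), r₁ (p b)), h (p b)⟩ : T.Comp i j k))
    (isPlot_subtype_iff.2 (isPlot_prod_iff.2 ⟨h₂ _ _ hp, h₁ _ _ hp⟩))

theorem IsLBG.isNatural_comp_cp (hG : G.IsLBG) :
    G.IsNatural (fun γ : T.P i j => comp γ (cp (ev₀ γ)) rfl) (fun γ => γ)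
      (dSmooth_comp_of dSmooth_id (dSmooth_cp.comp dSmooth_ev₀) _) dSmooth_id :=
  (hG.isNatural_of_deformation (isDeformation_reparam contDiff_delay isReparam_delay)
    (funext reparam_delay_zero) (funext reparam_delay_one)).symm hG

theorem IsLBG.isNatural_cp_comp (hG : G.IsLBG) :
    G.IsNatural (fun γ : T.P i j => comp (cp (ev₁ γ)) γ rfl) (fun γ => γ)
      (dSmooth_comp_of (dSmooth_cp.comp dSmooth_ev₁) dSmooth_id _) dSmooth_id :=
  (hG.isNatural_of_deformation (isDeformation_reparam contDiff_hasten isReparam_hasten)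
    (funext reparam_hasten_zero) (funext reparam_hasten_one)).symm hG

theorem IsLBG.isNatural_rev_comp (hG : G.IsLBG) :
    G.IsNatural (fun γ : T.P i j => comp (rev γ) γ (rev_zero γ).symm) (fun γ => cp (ev₀ γ))
      (dSmooth_comp_of dSmooth_revP dSmooth_id _) (dSmooth_cp.comp dSmooth_ev₀) :=
  (hG.isNatural_of_deformation isDeformation_backForth (hg := isDeformation_backForth.dSmooth 1)
    (funext backForth_zero) rfl).trans hG
    (hG.isNatural_of_deformation isDeformation_retract (funext backForth_one).symm
      (funext retract_one))

theorem IsLBG.isNatural_comp_rev (hG : G.IsLBG) :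
    G.IsNatural (fun γ : T.P i j => comp γ (rev γ) (rev_one γ)) (fun γ => cp (ev₁ γ))
      (dSmooth_comp_of dSmooth_id dSmooth_revP _) (dSmooth_cp.comp dSmooth_ev₁) := by
  have h := (hG.isNatural_rev_comp (i := j) (j := i)).precomp (dSmooth_revP (i := i) (j := j))
  refine ((hG.isNatural_of_eq ?_).trans hG h).trans hG (hG.isNatural_of_eq ?_)
  · funext γ; simp only [rev_rev]
  · funext γ; exact congrArg cp (Subtype.ext (rev_zero γ))

/-! ## Multiplication -/

/-- Lifted path concatenation, followed by the canonical isomorphism to the fibre over `γ`. -/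
def mu (G : LBGData.{u, v, w} T) {γ₁ : T.P i j} {γ₂ : T.P j k} (h : γ₁.1 1 = γ₂.1 0) (γ : T.P i k) :
    G.R j k γ₂ →ₗ[ℂ] G.R i j γ₁ →ₗ[ℂ] G.R i k γ :=
  (G.chi i j k γ₁ γ₂ h).compr₂ (G.dR i k _ γ)

theorem IsLBG.mu_comp (hG : G.IsLBG) {γ₁ : T.P i j} {γ₂ : T.P j k} (h : γ₁.1 1 = γ₂.1 0)
    (x : G.R j k γ₂) (y : G.R i j γ₁) : G.mu h (comp γ₂ γ₁ h) x y = G.chi i j k γ₁ γ₂ h x y :=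
  hG.dR_refl _ _

/-- Both sides are a triple product under `chi` followed by a canonical isomorphism. The two
bracketings differ by `chi_assoc`, and canonical isomorphisms compose along thin equivalences.
Leaving the intermediate paths free lets one lemma cover algebras, modules and the passage through
γ̄ ⋆ γ. -/
theorem IsLBG.mu_assoc (hG : G.IsLBG) {γ₁ : T.P i j} {γ₂ : T.P j k} {γ₃ : T.P k l}
    (h : γ₁.1 1 = γ₂.1 0) (h' : γ₂.1 1 = γ₃.1 0) {γ₂₁ : T.P i k} {γ₃₂ : T.P j l} {δ : T.P i l}
    (t : ThinEq (comp γ₂ γ₁ h) γ₂₁) (t' : ThinEq (comp γ₃ γ₂ h') γ₃₂) (q : γ₁.1 1 = γ₃₂.1 0)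
    (q' : γ₂₁.1 1 = γ₃.1 0) (t'' : ThinEq (comp γ₃ γ₂₁ q') δ) (x : G.R k l γ₃) (y : G.R j k γ₂)
    (z : G.R i j γ₁) : G.mu q δ (G.mu h' γ₃₂ x y) z = G.mu q' δ x (G.mu h γ₂₁ y z) := by
  have e₁ := hG.chi_dR t' (ThinEq.refl γ₁) (h.trans (comp_zero _ _ _).symm) q
    (G.chi _ _ _ γ₂ γ₃ h' x y) z
  have e₂ := hG.chi_dR (ThinEq.refl γ₃) t ((comp_one _ _ _).trans h') q' x
    (G.chi _ _ _ γ₁ γ₂ h y z)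
  have s : ThinEq (comp γ₃ (comp γ₂ γ₁ h) ((comp_one _ _ _).trans h')) (comp γ₃ γ₂₁ q') :=
    (ThinEq.refl γ₃).comp t _ _
  have s' : ThinEq (comp (comp γ₃ γ₂ h') γ₁ (h.trans (comp_zero _ _ _).symm)) (comp γ₃₂ γ₁ q) :=
    t'.comp (ThinEq.refl γ₁) _ _
  have a := thinEq_assoc h h'
  rw [hG.dR_refl] at e₁ e₂
  change G.dR _ _ _ _ (G.chi _ _ _ _ _ _ (G.dR _ _ _ _ _) z) =
    G.dR _ _ _ _ (G.chi _ _ _ _ _ _ x (G.dR _ _ _ _ _))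
  rw [e₁, e₂, ← hG.chi_assoc, hG.dR_dR s t'', hG.dR_dR a (s.trans t''),
    hG.dR_dR s' (s'.symm.trans (a.trans (s.trans t'')))]

theorem thinEq_comp_cp_of {γ : T.P i j} {x : T.Q i} (h : (cp x : T.P i i).1 1 = γ.1 0) :
    ThinEq (comp γ (cp x) h) γ := by
  obtain rfl : ev₀ γ = x := Subtype.ext h.symm
  exact (thinEq_comp_cp γ).symm

theorem thinEq_cp_comp_of {γ : T.P i j} {y : T.Q j} (h : γ.1 1 = (cp y : T.P j j).1 0) :
    ThinEq (comp (cp y) γ h) γ := by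
  obtain rfl : ev₁ γ = y := Subtype.ext h
  exact (thinEq_cp_comp γ).symm

theorem IsLBG.mu_eps (hG : G.IsLBG) {γ : T.P i j} {x : T.Q i} (h : (cp x : T.P i i).1 1 = γ.1 0)
    (v : G.R i j γ) : G.mu h γ v (G.eps i x) = v := by
  obtain rfl : ev₀ γ = x := Subtype.ext h.symm
  change G.dR i j _ _ (G.chi i i j (cp (ev₀ γ)) γ rfl v (G.eps i (ev₀ γ))) = v
  rw [hG.chi_eps, hG.dR_dR (thinEq_comp_cp γ) (thinEq_comp_cp γ).symm, hG.dR_refl]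

theorem IsLBG.eps_mu (hG : G.IsLBG) {γ : T.P i j} {y : T.Q j} (h : γ.1 1 = (cp y : T.P j j).1 0)
    (v : G.R i j γ) : G.mu h γ (G.eps j y) v = v := by
  obtain rfl : ev₁ γ = y := Subtype.ext h
  change G.dR i j _ _ (G.chi i j j γ (cp (ev₁ γ)) rfl (G.eps j (ev₁ γ)) v) = v
  rw [hG.eps_chi, hG.dR_dR (thinEq_cp_comp γ) (thinEq_cp_comp γ).symm, hG.dR_refl]

/-- Multiplication is parallel over every parameter space. -/
theorem IsLBG.parallelBilin_mu (hG : G.IsLBG) {Z : Type u} [DiffeologicalSpace Z]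
    {r₂ : Z → T.P j k} {r₁ : Z → T.P i j} {r : Z → T.P i k} (h₂ : DSmooth r₂) (h₁ : DSmooth r₁)
    (hr : DSmooth r) (h : ∀ z, (r₁ z).1 1 = (r₂ z).1 0)
    (N : G.IsNatural (fun z => comp (r₂ z) (r₁ z) (h z)) r (dSmooth_comp_of h₂ h₁ h) hr) :
    VecFam.ParallelBilin ((G.ptR j k).pullback r₂ h₂) ((G.ptR i j).pullback r₁ h₁)
      ((G.ptR i k).pullback r hr) fun z => G.mu (h z) (r z) := by
  intro Γ x y
  -- Parallelism of `chi` handles the concatenated path; naturality then moves the canonical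
  -- isomorphism past the transport.
  have e := hG.chi_parallel i j k
    (pairPath (Γ.map r₂ h₂) (Γ.map r₁ h₁) fun s => h (Γ s)) x y
  have e' := N.natural Γ (G.chi i j k _ _ (h (Γ 0)) x y)
  exact (congrArg (G.dR i k _ _) e).trans e'

end LBGData

namespace LBGData

variable {I : Type w} {T : TargetSpace.{u, w} I} {G : LBGData.{u, v, w} T} {i j k : I}

/-! ## Algebras and bimodules -/

theorem thinEq_cp_comp_cp (x : T.Q i) : ThinEq (comp (cp x) (cp x) rfl) (cp x) := by
  rw [cp_comp_cp]; exact ThinEq.refl _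

theorem IsLBG.algA_mul (hG : G.IsLBG) (x : T.Q i) (a b : G.A i x) :
    (G.algA i x).mul a b =
      G.mu (γ₁ := (cp x : T.P i i)) (γ₂ := (cp x : T.P i i)) rfl (cp x) a b :=
  (hG.dR_eq_cast (cp_comp_cp x) _).symm

theorem IsLBG.isAlgebra (hG : G.IsLBG) (x : T.Q i) : (G.algA i x).IsAlgebra where
  assoc a b c := by
    simp only [hG.algA_mul]
    exact hG.mu_assoc rfl rfl (thinEq_cp_comp_cp x) (thinEq_cp_comp_cp x) rfl rfl
      (thinEq_cp_comp_cp x) a b c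
  one_mul a := by
    rw [hG.algA_mul]
    exact hG.eps_mu (γ := cp x) rfl a
  mul_one a := by
    rw [hG.algA_mul]
    exact hG.mu_eps (γ := cp x) rfl a

section Multiplicativity

variable {γ₁ : T.P i j} {γ₂ : T.P j k} {γ : T.P i k} (h : γ₁.1 1 = γ₂.1 0)

/-- The actions are `mu` with a constant path, so this lemma and the next two are `mu_assoc` with
the constant path in the last, first and middle position. -/
theorem IsLBG.mu_left (hG : G.IsLBG) (t : ThinEq (comp γ₂ γ₁ h) γ) {z : T.Q k} (h₂ : ev₁ γ₂ = z)
    (h₃ : ev₁ γ = z) (a : G.A k z) (v : G.R j k γ₂) (w : G.R i j γ₁) :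
    G.mu h γ (G.lact j k γ₂ z h₂ a v) w = G.lact i k γ z h₃ a (G.mu h γ v w) :=
  hG.mu_assoc (γ₃ := cp z) h (congrArg Subtype.val h₂) t (thinEq_cp_comp_of _) h (congrArg Subtype.val h₃)
    (thinEq_cp_comp_of _) a v w

theorem IsLBG.mu_right (hG : G.IsLBG) (t : ThinEq (comp γ₂ γ₁ h) γ) {x : T.Q i} (h₁ : ev₀ γ₁ = x)
    (h₃ : ev₀ γ = x) (v : G.R j k γ₂) (w : G.R i j γ₁) (b : G.A i x) :
    G.mu h γ v (G.ract i j γ₁ x h₁ w b) = G.ract i k γ x h₃ (G.mu h γ v w) b :=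
  (hG.mu_assoc (congrArg Subtype.val h₁).symm h (thinEq_comp_cp_of _) t
    (congrArg Subtype.val h₃).symm h t v w b).symm

theorem IsLBG.mu_middle (hG : G.IsLBG) (t : ThinEq (comp γ₂ γ₁ h) γ) {y : T.Q j} (h₁ : ev₁ γ₁ = y)
    (h₂ : ev₀ γ₂ = y) (v : G.R j k γ₂) (a : G.A j y) (w : G.R i j γ₁) :
    G.mu h γ (G.ract j k γ₂ y h₂ v a) w = G.mu h γ v (G.lact i j γ₁ y h₁ a w) :=
  hG.mu_assoc (congrArg Subtype.val h₁) (congrArg Subtype.val h₂).symm (thinEq_cp_comp_of _)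
    (thinEq_comp_cp_of _) h h t v a w

end Multiplicativity

theorem IsLBG.isBimodule (hG : G.IsLBG) (γ : T.P i j) {y : T.Q j} {x : T.Q i} (h₁ : ev₁ γ = y)
    (h₀ : ev₀ γ = x) : (⟨G.lact i j γ y h₁, G.ract i j γ x h₀⟩ :
      Actions (G.A j y) (G.A i x) (G.R i j γ)).IsBimodule (G.algA j y) (G.algA i x) where
  left_mul a b v := by
    rw [hG.algA_mul]
    exact hG.mu_left (congrArg Subtype.val h₁) (thinEq_cp_comp_of _) rfl h₁ a b v
  left_one v := hG.eps_mu _ v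
  right_mul v a b := by
    rw [hG.algA_mul]
    exact hG.mu_right (congrArg Subtype.val h₀).symm (thinEq_comp_cp_of _) rfl h₀ v a b
  right_one v := hG.mu_eps _ v
  comm a v b := (hG.mu_right (congrArg Subtype.val h₁) (thinEq_cp_comp_of _) h₀ h₀ a v b).symm

/-! ## Partitions of unity -/

theorem nontrivial_A (hrk : ∀ i, 0 < (G.R i i).rank) (x : T.Q i) :
    Nontrivial (G.A i x) := by
  have := (G.R i i).isVectorBundle.finite (cp x)
  exact Module.nontrivial_of_finrank_pos (R := ℂ)
    (((G.R i i).isVectorBundle.finrank (cp x)).symm ▸ hrk i)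

theorem herm_self_ne_zero {v : G.R i j γ} (hv : v ≠ 0) : (G.R i j).herm γ v v ≠ 0 := fun h => by
  have := (G.R i j).herm_pos γ v hv
  rw [h] at this
  exact lt_irrefl _ this

/-- If the unit vanished, so would the whole algebra, against the positivity of the rank. -/
theorem IsLBG.herm_eps_ne_zero (hG : G.IsLBG) (hrk : ∀ i, 0 < (G.R i i).rank) (x : T.Q i) :
    (G.R i i).herm (cp x) (G.eps i x) (G.eps i x) ≠ 0 := by
  refine herm_self_ne_zero fun h => ?_
  have := nontrivial_A hrk x
  obtain ⟨v, hv⟩ := exists_ne (0 : G.A i x)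
  apply hv
  rw [← (hG.isAlgebra x).one_mul v]
  change (G.algA i x).mul (G.eps i x) v = 0
  rw [h, map_zero]; rfl

/-- This is `cardy` carried along the canonical isomorphism to the constant path at the end point,
so that it becomes an identity in A_j. -/
theorem IsLBG.sum_mu_alpha (hG : G.IsLBG) (γ : T.P i j) {n : ℕ}
    (b : Module.Basis (Fin n) ℂ (G.R i j γ))
    (hb : ∀ r s, (G.R i j).herm γ (b r) (b s) = if r = s then 1 else 0) (v : G.A i (ev₀ γ)) :
    ∑ r, G.mu (rev_one γ) (cp (ev₁ γ)) (G.ract i j γ (ev₀ γ) rfl (b r) v) (G.alpha i j γ (b r)) =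
      (G.R i i).herm _ (G.eps i (ev₀ γ)) v • G.eps j (ev₁ γ) := by
  have t : ThinEq (comp (comp γ (cp (ev₀ γ)) rfl) (rev γ) (rev_one_comp_cp γ))
      (comp γ (rev γ) (rev_one γ)) := (thinEq_comp_cp γ).symm.comp (ThinEq.refl _) _ _
  have t' := thinEq_comp_rev γ
  have e := congrArg (G.dR j j _ (cp (ev₁ γ))) (hG.cardy i j γ n b hb v)
  rw [map_sum, map_smul, hG.dR_dR (t.trans t').symm (t.trans t'), hG.dR_refl] at e
  rw [← e]
  refine Finset.sum_congr rfl fun r _ => ?_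
  have e₁ := hG.chi_dR (thinEq_comp_cp γ).symm (ThinEq.refl (rev γ)) (rev_one_comp_cp γ)
    (rev_one γ) (G.chi i i j (cp (ev₀ γ)) γ rfl (b r) v) (G.alpha i j γ (b r))
  rw [hG.dR_refl] at e₁
  exact (congrArg (G.dR j j _ _) e₁).trans (hG.dR_dR t t' _)

/-- The normalization condition with v = ε, divided by h(ε, ε). The reversed path γ' and the end
point y are kept as variables with equations, so that the lemma also applies to `rev γ` with reverse
γ. -/
theorem IsLBG.exists_sum_mu (hG : G.IsLBG) (hrk : ∀ i, 0 < (G.R i i).rank) {γ : T.P i j}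
    {γ' : T.P j i} (e : rev γ = γ') {y : T.Q j} (hy : ev₁ γ = y) (h : γ'.1 1 = γ.1 0) :
    ∃ (n : ℕ) (b : Fin n → G.R i j γ) (b' : Fin n → G.R j i γ'),
      ∑ r, G.mu h (cp y) (b r) (b' r) = G.eps j y := by
  subst e; subst hy
  have := (G.R i j).isVectorBundle.finite γ
  obtain ⟨n, b, hb⟩ := exists_orthonormal_basis ((G.R i j).herm γ) ((G.R i j).herm_symm γ)
    ((G.R i j).herm_pos γ)
  have hne := hG.herm_eps_ne_zero hrk (ev₀ γ)
  refine ⟨n, fun r => b r, fun r =>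
    ((G.R i i).herm _ (G.eps i (ev₀ γ)) (G.eps i (ev₀ γ)))⁻¹ • G.alpha i j γ (b r), ?_⟩
  have key := hG.sum_mu_alpha γ b hb (G.eps i (ev₀ γ))
  have e : ∀ r, G.ract i j γ (ev₀ γ) rfl (b r) (G.eps i (ev₀ γ)) = b r := fun r => hG.mu_eps _ _
  simp only [e] at key
  simp only [map_smul, ← Finset.smul_sum]
  rw [key, smul_smul, inv_mul_cancel₀ hne, one_smul]

/-- The algebras `A i|_x` are simple. -/
theorem IsLBG.isSimple (hG : G.IsLBG) (x : T.Q i) : (G.algA i x).IsSimple := by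
  intro z hz
  have := (G.R i i).isVectorBundle.finite (cp x)
  obtain ⟨n, b, hb⟩ := exists_orthonormal_basis ((G.R i i).herm (cp x)) ((G.R i i).herm_symm _)
    ((G.R i i).herm_pos _)
  let α : G.A i x → G.A i x := fun v => G.alpha i i (cp x) v
  -- With this v, the normalization sum is ∑ (b_r z*) z b_r*, which lies in the two-sided ideal
  -- generated by z.
  set v : G.A i x := (G.algA i x).mul (α z) z with hv
  have key : ∑ r, (G.algA i x).mul ((G.algA i x).mul (b r) v) (α (b r)) =
      (G.R i i).herm (cp x) (G.eps i x) v • G.eps i x := by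
    simp only [hG.algA_mul]
    exact hG.sum_mu_alpha (cp x) b hb v
  -- The axiom `herm_left` on the constant path identifies the scalar, up to conjugation, with the
  -- norm of z. The cast accounts for cp ⋆ cp being equal to cp.
  have hc : (G.R i i).herm (cp x) v (G.eps i x) = (G.R i i).herm (cp x) z z := by
    have e : (G.R i i).toVecFam.cast (cp_comp_cp x) (G.dR i i (cp x) (comp (cp x) (cp x) rfl)
        (G.eps i x)) = G.eps i x := by
      rw [← hG.dR_eq_cast, hG.dR_dR (thinEq_cp_comp_cp x).symm (thinEq_cp_comp_cp x), hG.dR_refl]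
    conv_lhs => rw [← e]
    exact ((G.R i i).herm_cast (cp_comp_cp x) _ _).trans (hG.herm_left i i (cp x) z z)
  have hne : (G.R i i).herm (cp x) (G.eps i x) v ≠ 0 := by
    rw [← (G.R i i).herm_symm, hc]
    exact (map_ne_zero _).2 (herm_self_ne_zero hz)
  set c := (G.R i i).herm (cp x) (G.eps i x) v
  refine ⟨n, fun r => c⁻¹ • (G.algA i x).mul (b r) (α z), fun r => α (b r), ?_⟩
  have e : ∀ r, (G.algA i x).mul ((G.algA i x).mul (c⁻¹ • (G.algA i x).mul (b r) (α z)) z) (α (b r)) =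
      c⁻¹ • (G.algA i x).mul ((G.algA i x).mul (b r) v) (α (b r)) := fun r => by
    rw [map_smul, LinearMap.smul_apply, map_smul, LinearMap.smul_apply, (hG.isAlgebra x).assoc (b r)]
  simp only [e, ← Finset.smul_sum]
  rw [key, smul_smul, inv_mul_cancel₀ hne, one_smul]
  rfl

theorem thinEq_rev_comp_of (γ : T.P i j) {x : T.Q i} (h : ev₀ γ = x) :
    ThinEq (comp (rev γ) γ (rev_zero γ).symm) (cp x) := by
  subst h; exact thinEq_rev_comp γ

theorem thinEq_comp_rev_of (γ : T.P i j) {y : T.Q j} (h : ev₁ γ = y) :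
    ThinEq (comp γ (rev γ) (rev_one γ)) (cp y) := by
  subst h; exact thinEq_comp_rev γ

/-- Write 1 = ∑ c_r c'_r in A_i|_x with c'_r in R_ij|_γ and c_r in R_ji|_γ̄. Then z = ∑ (z c_r)
c'_r, so left linearity gives F(z) = ∑ (z c_r) F(c'_r) = z ∑ c_r F(c'_r). Conversely, if F is right
multiplication by b, this sum equals b. -/
theorem IsLBG.isBalancedRight (hG : G.IsLBG) (hrk : ∀ i, 0 < (G.R i i).rank) (γ : T.P i j)
    {y : T.Q j} {x : T.Q i} (h₁ : ev₁ γ = y) (h₀ : ev₀ γ = x) :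
    (⟨G.lact i j γ y h₁, G.ract i j γ x h₀⟩ :
      Actions (G.A j y) (G.A i x) (G.R i j γ)).IsBalancedRight := by
  intro F hF
  have hm := hG.isBimodule γ h₁ h₀
  obtain ⟨n, c, c', hc⟩ := hG.exists_sum_mu hrk (γ := rev γ) (γ' := γ) (rev_rev γ) (y := x)
    ((Subtype.ext (rev_one γ)).trans h₀) (rev_zero γ).symm
  have expand : ∀ z (w : Fin n → G.R i j γ),
      G.ract i j γ x h₀ z (∑ r, G.mu (rev_zero γ).symm (cp x) (c r) (w r)) =
        ∑ r, G.lact i j γ y h₁ (G.mu (rev_one γ) (cp y) z (c r)) (w r) := fun z w => by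
    rw [map_sum]
    refine Finset.sum_congr rfl fun r _ => ?_
    exact (hG.mu_assoc (rev_zero γ).symm (rev_one γ) (thinEq_rev_comp_of γ h₀)
      (thinEq_comp_rev_of γ h₁) (congrArg Subtype.val h₁) (congrArg Subtype.val h₀).symm
      (thinEq_comp_cp_of _) z (c r) (w r)).symm
  refine ⟨∑ r, G.mu (rev_zero γ).symm (cp x) (c r) (F (c' r)), fun z => ?_, fun b hb => ?_⟩
  · have e : z = ∑ r, G.lact i j γ y h₁ (G.mu (rev_one γ) (cp y) z (c r)) (c' r) := by
      rw [← expand, hc]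
      exact (hm.right_one z).symm
    conv_lhs => rw [e]
    rw [map_sum]
    refine Eq.trans ?_ (expand z fun r => F (c' r)).symm
    exact Finset.sum_congr rfl fun r _ => hF _ _
  · have e : ∀ r, G.mu (rev_zero γ).symm (cp x) (c r) (F (c' r)) =
        G.ract i i (cp x) x rfl (G.mu (rev_zero γ).symm (cp x) (c r) (c' r)) b := fun r => by
      rw [hb (c' r)]
      exact hG.mu_right (rev_zero γ).symm (thinEq_rev_comp_of γ h₀) h₀ rfl (c r) (c' r) b
    simp only [e, ← LinearMap.sum_apply, ← map_sum]
    rw [hc]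
    exact (hG.eps_mu (γ := cp x) rfl b).symm

/-- Any two of the bimodules are isomorphic. -/
theorem IsLBG.exists_bimoduleIso (hG : G.IsLBG) (hrk : ∀ i, 0 < (G.R i i).rank) (γ γ' : T.P i j) :
    ∃ (f : G.A j (ev₁ γ) ≃ₗ[ℂ] G.A j (ev₁ γ')) (g : G.A i (ev₀ γ) ≃ₗ[ℂ] G.A i (ev₀ γ'))
      (θ : G.R i j γ ≃ₗ[ℂ] G.R i j γ'),
      (∀ a b, f ((G.algA j _).mul a b) = (G.algA j _).mul (f a) (f b)) ∧
      f (G.algA j _).one = (G.algA j _).one ∧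
      (∀ a b, g ((G.algA i _).mul a b) = (G.algA i _).mul (g a) (g b)) ∧
      g (G.algA i _).one = (G.algA i _).one ∧
      (∀ a v, θ ((G.bimod i j γ).left a v) = (G.bimod i j γ').left (f a) (θ v)) ∧
      (∀ v b, θ ((G.bimod i j γ).right v b) = (G.bimod i j γ').right (θ v) (g b)) := by
  have vA := (G.R j j).isVectorBundle
  have vM := (G.R i j).isVectorBundle
  have := vA.finite (cp (ev₁ γ))
  have := vA.finite (cp (ev₁ γ'))
  have := vM.finite γ
  have := vM.finite γ'
  have := nontrivial_A hrk (ev₁ γ)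
  have := nontrivial_A hrk (ev₁ γ')
  exact Actions.exists_bimoduleIso (hG.isAlgebra _) (hG.isAlgebra _) (hG.isSimple _)
    (hG.isSimple _) ((vA.finrank (cp (ev₁ γ))).trans (vA.finrank (cp (ev₁ γ'))).symm)
    ((vM.finrank γ).trans (vM.finrank γ').symm) (hG.isBimodule γ rfl rfl)
    (hG.isBimodule γ' rfl rfl) (hG.isBalancedRight hrk γ rfl rfl)
    (hG.isBalancedRight hrk γ' rfl rfl)

/-! ## Parallelism -/

theorem IsLBG.parallelBilin_lact (hG : G.IsLBG) (i j : I) :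
    VecFam.ParallelBilin (((G.ptR j j).pullback cp dSmooth_cp).pullback ev₁ dSmooth_ev₁)
      (G.ptR i j) (G.ptR i j) (fun γ => (G.bimod i j γ).left) := fun Γ a v =>
  hG.parallelBilin_mu (dSmooth_cp.comp dSmooth_ev₁) dSmooth_id dSmooth_id (fun _ => rfl)
    hG.isNatural_cp_comp Γ a v

theorem IsLBG.parallelBilin_ract (hG : G.IsLBG) (i j : I) :
    VecFam.ParallelBilin (G.ptR i j)
      (((G.ptR i i).pullback cp dSmooth_cp).pullback ev₀ dSmooth_ev₀) (G.ptR i j)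
      (fun γ => (G.bimod i j γ).right) := fun Γ v a =>
  hG.parallelBilin_mu dSmooth_id (dSmooth_cp.comp dSmooth_ev₀) dSmooth_id (fun _ => rfl)
    hG.isNatural_comp_cp Γ v a

theorem IsLBG.parallelBilin_algA (hG : G.IsLBG) (i : I) :
    VecFam.ParallelBilin ((G.ptR i i).pullback cp dSmooth_cp) ((G.ptR i i).pullback cp dSmooth_cp)
      ((G.ptR i i).pullback cp dSmooth_cp) (fun x => (G.algA i x).mul) := fun Γ a b => by
  rw [hG.algA_mul, hG.algA_mul]
  exact hG.parallelBilin_mu dSmooth_cp dSmooth_cp dSmooth_cp (fun _ => rfl)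
    (hG.isNatural_of_eq (funext cp_comp_cp)) Γ a b

theorem IsLBG.isBimoduleBundle_bimod (hG : G.IsLBG) (hrk : ∀ i, 0 < (G.R i i).rank) (i j : I) :
    IsBimoduleBundle ((G.algA j).pullback ev₁) ((G.algA i).pullback ev₀)
      (G.R i j).toVecFam (G.bimod i j) :=
  isBimoduleBundle_of_parallel
    (((G.R j j).isVectorBundle.pullback dSmooth_cp).pullback dSmooth_ev₁)
    (((G.R i i).isVectorBundle.pullback dSmooth_cp).pullback dSmooth_ev₀) (G.R i j).isVectorBundle
    (((hG.R_connection j j).isConnection.pullback dSmooth_cp).pullback dSmooth_ev₁)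
    (((hG.R_connection i i).isConnection.pullback dSmooth_cp).pullback dSmooth_ev₀)
    (hG.R_connection i j).isConnection (fun _ => hG.isAlgebra _) (fun _ => hG.isAlgebra _)
    (fun γ => hG.isBimodule γ rfl rfl) ((hG.parallelBilin_algA j).pullback dSmooth_ev₁)
    (fun Γ => hG.eps_parallel j (Γ.map ev₁ dSmooth_ev₁))
    ((hG.parallelBilin_algA i).pullback dSmooth_ev₀)
    (fun Γ => hG.eps_parallel i (Γ.map ev₀ dSmooth_ev₀))
    (hG.parallelBilin_lact i j) (hG.parallelBilin_ract i j) (hG.exists_bimoduleIso hrk)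

/-- The end points of a concatenation agree with those of the pair only up to a propositional
equality; this version absorbs that equality and so applies to c^*R_ik. -/
theorem IsLBG.isBimoduleBundle_bimodAlong (hG : G.IsLBG) (hrk : ∀ i, 0 < (G.R i i).rank)
    {Y : Type u} [DiffeologicalSpace Y] {r : Y → T.P i j} (hr : DSmooth r) {e₁ : Y → T.Q j}
    {e₀ : Y → T.Q i} (h₁ : ∀ y, ev₁ (r y) = e₁ y) (h₀ : ∀ y, ev₀ (r y) = e₀ y) :
    IsBimoduleBundle ((G.algA j).pullback e₁) ((G.algA i).pullback e₀)
      ((G.R i j).toVecFam.pullback r) (G.bimodAlong i j r e₁ e₀ h₁ h₀) := by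
  obtain rfl : (fun y => ev₁ (r y)) = e₁ := funext h₁
  obtain rfl : (fun y => ev₀ (r y)) = e₀ := funext h₀
  have s₁ : DSmooth fun y => ev₁ (r y) := dSmooth_ev₁.comp hr
  have s₀ : DSmooth fun y => ev₀ (r y) := dSmooth_ev₀.comp hr
  exact isBimoduleBundle_of_parallel
    (((G.R j j).isVectorBundle.pullback dSmooth_cp).pullback s₁)
    (((G.R i i).isVectorBundle.pullback dSmooth_cp).pullback s₀)
    ((G.R i j).isVectorBundle.pullback hr)
    (((hG.R_connection j j).isConnection.pullback dSmooth_cp).pullback s₁)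
    (((hG.R_connection i i).isConnection.pullback dSmooth_cp).pullback s₀)
    ((hG.R_connection i j).isConnection.pullback hr) (fun _ => hG.isAlgebra _)
    (fun _ => hG.isAlgebra _) (fun γ => hG.isBimodule _ rfl rfl)
    ((hG.parallelBilin_algA j).pullback s₁) (fun Γ => hG.eps_parallel j (Γ.map _ s₁))
    ((hG.parallelBilin_algA i).pullback s₀) (fun Γ => hG.eps_parallel i (Γ.map _ s₀))
    (fun Γ => hG.parallelBilin_lact i j (Γ.map r hr))
    (fun Γ => hG.parallelBilin_ract i j (Γ.map r hr))
    (fun y y' => hG.exists_bimoduleIso hrk (r y) (r y'))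

/-! ## Tensor products -/

/-- Multiplication has a fibrewise inverse on the tensor product over the middle algebra. -/
theorem IsLBG.exists_mu_inverse (hG : G.IsLBG) (hrk : ∀ i, 0 < (G.R i i).rank) {γ₁ : T.P i j}
    {γ₂ : T.P j k} {γ : T.P i k} (h : γ₁.1 1 = γ₂.1 0) (t : ThinEq (comp γ₂ γ₁ h) γ) {y : T.Q j}
    (h₁ : ev₁ γ₁ = y) (h₂ : ev₀ γ₂ = y) :
    ∃ (s : ℕ) (b : Fin s → G.R j k γ₂) (p : Fin s → G.R i k γ →ₗ[ℂ] G.R i j γ₁)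
      (σ : Fin s → G.R j k γ₂ → G.A j y), (∀ u, ∑ r, G.mu h γ (b r) (p r u) = u) ∧
      (∀ w, ∑ r, G.ract j k γ₂ y h₂ (b r) (σ r w) = w) ∧
      ∀ r w z, p r (G.mu h γ w z) = G.lact i j γ₁ y h₁ (σ r w) z := by
  obtain ⟨s, b, b', hb⟩ := hG.exists_sum_mu hrk (γ := γ₂) rfl rfl (rev_one γ₂)
  have q : γ.1 1 = (rev γ₂).1 0 := t.one_eq.symm.trans ((comp_one _ _ _).trans (rev_zero γ₂).symm)
  have q' : γ.1 1 = γ₂.1 1 := t.one_eq.symm.trans (comp_one _ _ _)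
  have tr : ThinEq (comp (rev γ₂) γ₂ (rev_zero γ₂).symm) (cp y) := thinEq_rev_comp_of γ₂ h₂
  -- This is γ̄₂ ⋆ (γ₂ ⋆ γ₁) ~ (γ̄₂ ⋆ γ₂) ⋆ γ₁ ~ cp ⋆ γ₁ ~ γ₁, which lets b'_r u be regarded as an
  -- element over γ₁.
  have t' : ThinEq (comp (rev γ₂) γ q) γ₁ :=
    (((ThinEq.refl _).comp t.symm _ ((comp_one _ _ _).trans (rev_zero γ₂).symm)).trans
      (thinEq_assoc h (rev_zero γ₂).symm).symm).trans
      ((tr.comp (ThinEq.refl γ₁) _ (congrArg Subtype.val h₁)).trans (thinEq_cp_comp_of _))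
  -- With 1 = ∑ b_r b'_r over the end point of γ₂, the maps are left multiplications by b'_r, both
  -- on R_ik and on R_jk. The three identities are then rebracketings.
  refine ⟨s, b, fun r => G.mu q γ₁ (b' r), fun r w => G.mu (rev_zero γ₂).symm (cp y) (b' r) w,
    fun u => ?_, fun w => ?_, fun r w z => ?_⟩
  · have e : ∀ r, G.mu h γ (b r) (G.mu q γ₁ (b' r) u) =
        G.mu q' γ (G.mu (rev_one γ₂) (cp (ev₁ γ₂)) (b r) (b' r)) u := fun r =>
      (hG.mu_assoc q (rev_one γ₂) t' (thinEq_comp_rev γ₂) q' h t (b r) (b' r) u).symm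
    simp only [e, ← LinearMap.sum_apply, ← map_sum]
    rw [hb]
    exact hG.eps_mu _ u
  · have e : ∀ r, G.ract j k γ₂ y h₂ (b r) (G.mu (rev_zero γ₂).symm (cp y) (b' r) w) =
        G.lact j k γ₂ (ev₁ γ₂) rfl (G.mu (rev_one γ₂) (cp (ev₁ γ₂)) (b r) (b' r)) w := fun r =>
      (hG.mu_assoc (rev_zero γ₂).symm (rev_one γ₂) tr (thinEq_comp_rev γ₂) rfl
        (congrArg Subtype.val h₂).symm (thinEq_comp_cp_of _) (b r) (b' r) w).symm
    simp only [e, ← LinearMap.sum_apply, ← map_sum]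
    rw [hb]
    exact hG.eps_mu _ w
  · exact (hG.mu_assoc h (rev_zero γ₂).symm t tr (congrArg Subtype.val h₁) q t' (b' r) w z).symm

end LBGData

/-! ### Bundle isomorphisms from tensor products -/

namespace LBGData

variable {I : Type w} {T : TargetSpace.{u, w} I} {G : LBGData.{u, v, w} T}

/-- Lifted path concatenation induces isomorphisms on tensor products of bimodules. -/
theorem IsLBG.exists_compIso (hG : G.IsLBG) (hrk : ∀ i, 0 < (G.R i i).rank) (i j k : I) :
    ∃ t, IsTensorActions (G.compLeft i j k) (G.compRight i j k) t ∧
      ∃ Φ : BimodIso t (G.compTotal i j k), ∀ q w v,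
        Φ.equiv q (tmulB (G.compLeft i j k) (G.compRight i j k) q w v) =
          G.mu q.2 (conc q) w v :=
  BraneGeometry.exists_tensorIso ((G.R j k).isVectorBundle.pullback dSmooth_fst)
    ((G.R i j).isVectorBundle.pullback dSmooth_snd)
    ((G.R i k).isVectorBundle.pullback dSmooth_conc)
    ((hG.R_connection j k).isConnection.pullback dSmooth_fst)
    ((hG.R_connection i j).isConnection.pullback dSmooth_snd)
    ((hG.R_connection i k).isConnection.pullback dSmooth_conc)
    (hG.parallelBilin_mu dSmooth_fst dSmooth_snd dSmooth_conc (fun q => q.2)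
      (hG.isNatural_of_eq rfl))
    (fun q w r v => hG.mu_middle q.2 (ThinEq.refl _) rfl (Subtype.ext q.2.symm) w r v)
    (fun q r w v => hG.mu_left q.2 (ThinEq.refl _) rfl (Subtype.ext (comp_one _ _ q.2)) r w v)
    (fun q w v r => hG.mu_right q.2 (ThinEq.refl _) rfl (Subtype.ext (comp_zero _ _ q.2)) w v r)
    (fun q => hG.exists_mu_inverse hrk q.2 (ThinEq.refl _) rfl (Subtype.ext q.2.symm))

/-- The product R_ji|_γ̄ × R_ij|_γ → A_i|_x is the pairing: γ̄ ⋆ γ is thinly equivalent to the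
constant path, and naturally so, which makes the pairing parallel over P_ij. -/
theorem IsLBG.exists_leftIso (hG : G.IsLBG) (hrk : ∀ i, 0 < (G.R i i).rank) (i j : I) :
    ∃ t, IsTensorActions (G.revBimod i j) (G.bimod i j) t ∧
      Nonempty (BimodIso t ((G.algA i).pullback (ev₀ : T.P i j → T.Q i)).regular) := by
  obtain ⟨t, ht, Φ, -⟩ := BraneGeometry.exists_tensorIso
    (m := G.revBimod i j) (n := G.bimod i j)
    (g := ((G.algA i).pullback (ev₀ : T.P i j → T.Q i)).regular)
    (β := fun γ => G.mu (rev_zero γ).symm (cp (ev₀ γ)))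
    ((G.R j i).isVectorBundle.pullback dSmooth_revP) (G.R i j).isVectorBundle
    (((G.R i i).isVectorBundle.pullback dSmooth_cp).pullback dSmooth_ev₀)
    ((hG.R_connection j i).isConnection.pullback dSmooth_revP) (hG.R_connection i j).isConnection
    (((hG.R_connection i i).isConnection.pullback dSmooth_cp).pullback dSmooth_ev₀)
    (fun Γ w v => hG.parallelBilin_mu dSmooth_revP dSmooth_id (dSmooth_cp.comp dSmooth_ev₀)
      (fun γ => (rev_zero γ).symm) hG.isNatural_rev_comp Γ w v)
    (fun γ w r v => hG.mu_middle _ (thinEq_rev_comp γ) rfl (Subtype.ext (rev_zero γ)) w r v)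
    (fun γ r w v => (hG.mu_left (z := ev₀ γ) _ (thinEq_rev_comp γ)
      (Subtype.ext (rev_one γ)) rfl r w v).trans (hG.algA_mul _ _ _).symm)
    (fun γ w v r => (hG.mu_right _ (thinEq_rev_comp γ) rfl rfl w v r).trans
      (hG.algA_mul _ _ _).symm)
    (fun γ => hG.exists_mu_inverse hrk _ (thinEq_rev_comp γ) rfl (Subtype.ext (rev_zero γ)))
  exact ⟨t, ht, ⟨Φ⟩⟩

theorem IsLBG.exists_rightIso (hG : G.IsLBG) (hrk : ∀ i, 0 < (G.R i i).rank) (i j : I) :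
    ∃ t, IsTensorActions (G.bimod i j) (G.revBimod i j) t ∧
      Nonempty (BimodIso t ((G.algA j).pullback (ev₁ : T.P i j → T.Q j)).regular) := by
  obtain ⟨t, ht, Φ, -⟩ := BraneGeometry.exists_tensorIso
    (m := G.bimod i j) (n := G.revBimod i j)
    (g := ((G.algA j).pullback (ev₁ : T.P i j → T.Q j)).regular)
    (β := fun γ => G.mu (rev_one γ) (cp (ev₁ γ)))
    (G.R i j).isVectorBundle ((G.R j i).isVectorBundle.pullback dSmooth_revP)
    (((G.R j j).isVectorBundle.pullback dSmooth_cp).pullback dSmooth_ev₁)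
    (hG.R_connection i j).isConnection ((hG.R_connection j i).isConnection.pullback dSmooth_revP)
    (((hG.R_connection j j).isConnection.pullback dSmooth_cp).pullback dSmooth_ev₁)
    (fun Γ w v => hG.parallelBilin_mu dSmooth_id dSmooth_revP (dSmooth_cp.comp dSmooth_ev₁)
      (fun γ => rev_one γ) hG.isNatural_comp_rev Γ w v)
    (fun γ w r v => hG.mu_middle (y := ev₀ γ) _ (thinEq_comp_rev γ) (Subtype.ext (rev_one γ)) rfl
      w r v)
    (fun γ r w v => (hG.mu_left _ (thinEq_comp_rev γ) rfl rfl r w v).trans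
      (hG.algA_mul _ _ _).symm)
    (fun γ w v r => (hG.mu_right (x := ev₁ γ) _ (thinEq_comp_rev γ)
      (Subtype.ext (rev_zero γ)) rfl w v r).trans (hG.algA_mul _ _ _).symm)
    (fun γ => hG.exists_mu_inverse (y := ev₀ γ) hrk _ (thinEq_comp_rev γ)
      (Subtype.ext (rev_one γ)) rfl)
  exact ⟨t, ht, ⟨Φ⟩⟩

end LBGData

end BraneGeometry

end

/-! ### Bimodule bundles, fusion isomorphisms and Morita equivalences -/

theorem theoremC {I : Type w} (T : TargetSpace.{u, w} I) (G : LBGData.{u, v, w} T)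
    (hG : G.IsLBG) (hrk : ∀ i, 0 < (G.R i i).rank) :
    -- `R i j` is a bundle of bimodules, and its actions are connection-preserving
    (∀ i j : I,
      IsBimoduleBundle ((G.algA j).pullback ev₁) ((G.algA i).pullback ev₀)
        (G.R i j).toVecFam (G.bimod i j) ∧
      VecFam.ParallelBilin
        (((G.ptR j j).pullback cp dSmooth_cp).pullback ev₁ dSmooth_ev₁) (G.ptR i j) (G.ptR i j)
        (fun γ => (G.bimod i j γ).left) ∧
      VecFam.ParallelBilin
        (G.ptR i j) (((G.ptR i i).pullback cp dSmooth_cp).pullback ev₀ dSmooth_ev₀) (G.ptR i j)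
        (fun γ => (G.bimod i j γ).right)) ∧
    -- lifted path concatenation induces connection-preserving isomorphisms of bundles of bimodules
    (∀ i j k : I,
      ∃ (t : BimodData _ _ (tensorB (G.compLeft i j k) (G.compRight i j k)))
        (pt : (tensorB (G.compLeft i j k) (G.compRight i j k)).Transport),
        IsTensorActions (G.compLeft i j k) (G.compRight i j k) t ∧
        IsBimoduleBundle ((G.algA k).pullback fun q : T.Comp i j k => ev₁ q.1.1)
          ((G.algA i).pullback fun q : T.Comp i j k => ev₀ q.1.2) _ t ∧
        IsTensorTransport (G.compLeft i j k) (G.compRight i j k)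
          ((G.ptR j k).pullback _ dSmooth_fst) ((G.ptR i j).pullback _ dSmooth_snd) pt ∧
        VecFam.IsConnection _ pt ∧
        ∃ Φ : BimodIso t (G.compTotal i j k),
          (∀ (q : T.Comp i j k) (w : G.R j k q.1.1) (v : G.R i j q.1.2),
            Φ.equiv q (tmulB (G.compLeft i j k) (G.compRight i j k) q w v) =
              G.chi i j k q.1.2 q.1.1 q.2 w v) ∧
          ∀ (Γ : DPath (T.Comp i j k)) (z),
            Φ.equiv (Γ 1) (pt Γ z) =
              (G.ptR i k).pullback conc dSmooth_conc Γ (Φ.equiv (Γ 0) z)) ∧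
    -- `R j i|_{γ̄}` and `R i j|_γ` are mutually inverse Morita equivalences
    (∀ i j : I,
      MutuallyInverse ((G.algA i).pullback ev₀) ((G.algA j).pullback ev₁)
        (G.revBimod i j) (G.bimod i j)) := by
  refine ⟨fun i j => ⟨hG.isBimoduleBundle_bimod hrk i j, hG.parallelBilin_lact i j,
    hG.parallelBilin_ract i j⟩, fun i j k => ?_, fun i j =>
    ⟨hG.exists_leftIso hrk i j, hG.exists_rightIso hrk i j⟩⟩
  obtain ⟨t, ht, Φ, hΦ⟩ := hG.exists_compIso hrk i j k
  -- Bundle structure and connection on the tensor product are transported back from c^*R_ik along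
  -- Φ.
  refine ⟨t, Φ.transport ((G.ptR i k).pullback conc dSmooth_conc), ht,
    Φ.isBimoduleBundle (hG.isBimoduleBundle_bimodAlong hrk dSmooth_conc _ _),
    fun Γ w v => ?_, Φ.isConnection ((hG.R_connection i k).isConnection.pullback dSmooth_conc), Φ,
    fun q w v => (hΦ q w v).trans (hG.mu_comp q.2 w v), fun Γ z => Φ.equiv_transport _ Γ z⟩
  -- The transported connection is the one induced from the two factors exactly because
  -- concatenation is parallel; this is checked after applying Φ.
  apply (Φ.equiv (Γ 1)).injective
  rw [Φ.equiv_transport, hΦ, hΦ]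
  exact (hG.parallelBilin_mu dSmooth_fst dSmooth_snd dSmooth_conc (fun q => q.2)
    (hG.isNatural_of_eq rfl) Γ w v).symm
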